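/- **Setting.** Let $p$ be an odd prime, $\mathbb F$ a finite field of characteristic $p$, $W(k)$ the ring of Witt vectors of a subfield $k\subset\mathbb F$, and let $A$ be a compact (Hausdorff) local topological ring with maximal ideal $\mathfrak m$ and residue field $\mathbb F$, viewed as a $W(\mathbb F)$-algebra so that $W(\mathbb F)\to A\to A/\mathfrak m=\mathbb F$ is the residue map. Let $s:\mathbb F\to A$ be the Teichmüller lift; apply $s$ to matrices entrywise. For additive subgroups $X,Y$ of $A$, $XY$ denotes the closure of the additive subgroup generated by the products $xy$. A *pseudo-deformation* over $A$ here is a tuple $(\Pi,\bar\rho,t,d)$ where $\Pi$ is a profinite group; $\bar\rho:\Pi\to \mathrm{GL}_2(\mathbb F)$ is continuous and either absolutely irreducible or isomorphic to a sum of two distinct characters; $t:\Pi\to A$, $d:\Pi\to A^*$ are continuous, $d$ is a homomorphism, $t$ is central, $t(1)=2$ and $t(xy)+d(y)t(xy^{-1})=t(x)t(y)$; $t\equiv \mathrm{tr}\,\bar\rho$, $d\equiv\det\bar\rho \pmod{\mathfrak m}$; $d(\Pi)\subset s(\mathbb F)$; and $A$ is generated by $t(\Pi)$ as a topological $W(\mathbb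 F)$-algebra. It is *admissible* if moreover the largest pro-$p$ quotient of every open subgroup of $\Pi$ is topologically finitely generated. A *$(t,d)$-representation* is a homomorphism $\rho:\Pi\to\mathrm{GL}_2(A)$ with $\mathrm{tr}\,\rho=t$, $\det\rho=d$ and $A\rho(\Pi)=M_2(A)$. Write $G=\rho(\Pi)$ and let $\bar G\subset\mathrm{GL}_2(\mathbb F)$ be its reduction. The *Lie algebra attached to $\rho$* is the closed additive subgroup $L$ of $M_2(\mathfrak m)$ generated by the matrices $\gamma-\tfrac{\mathrm{tr}\,\gamma}{2}\mathrm{Id}$ with $\gamma\in G$, $\det\gamma=1$, $\gamma\equiv\mathrm{Id}\pmod{\mathfrak m}$. We say that $\rho$ is *well adapted* (dihedral case) if: (i) there is $g_0\in\Pi$ such that $\rho(g_0)$ is diagonal with diagonal entries distinct modulo $\mathfrak m$, and the reduction of $\rho(g_0)$ together with the scalar matrices of $\bar G$ generates a subgroup of index $2$ of $\bar G$; (ii) $s(\bar G)\subset G$; (iii) if $\bar G$ is non-abelian, it contains a matrix $\begin{pmatrix}0&b\\c&0\end{pmatrix}$ with $bc^{-1}\in\mathbb F_p^*$. For subsets $I,B\subset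 A$ let $\begin{pmatrix}I&B\\B&I\end{pmatrix}^0$ be the set of trace-zero matrices with diagonal entries in $I$ and off-diagonal entries in $B$. **Theorem.** (1) Let $(\Pi,\bar\rho,t,d)$ be a pseudo-deformation over $A$ (for instance an admissible one) such that the projective image of $\bar\rho$ is dihedral of order $2m>4$, and let $\rho:\Pi\to\mathrm{GL}_2(A)$ be a well adapted $(t,d)$-representation, with Lie algebra $L$. Then $\gcd(m,|\mathbb F|-1)>2$. Moreover, for every subfield $\mathbb F_q$ of $\mathbb F$ with $\gcd(m,q-1)>2$ there exist closed $W(\mathbb F_q)$-submodules $\tilde I_1,\tilde B_1$ of $\mathfrak m$ such that $$W(\mathbb F_q)L=\begin{pmatrix}\tilde I_1&\tilde B_1\\ \tilde B_1&\tilde I_1\end{pmatrix}^0,$$ $$\tilde B_1^2\subset\tilde I_1,\qquad \tilde I_1\tilde B_1\subset\tilde B_1,\qquad \tilde I_1^3\subset\tilde I_1,\qquad W(\mathbb F)1+W(\mathbb F)\tilde I_1+W(\mathbb F)\tilde I_1^2+W(\mathbb F)\tilde B_1=A.$$ (2) Conversely, assume $|\mathbb F|>3$ and let $\tilde I_1,\tilde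 B_1\subset\mathfrak m$ be closed $W(\mathbb F)$-submodules satisfying these four conditions. Then there exist a pseudo-deformation $(\Pi,\bar\rho,t,d)$ over $A$, which is moreover admissible if $A$ is noetherian, such that the projective image of $\bar\rho$ is dihedral of order $>4$, and a $(t,d)$-representation $\rho:\Pi\to\mathrm{GL}_2(A)$ whose attached Lie algebra is $$L=W(\mathbb F)L=\begin{pmatrix}\tilde I_1&\tilde B_1\\ \tilde B_1&\tilde I_1\end{pmatrix}^0.$$ -/

import Mathlib

open scoped MatrixGroups

noncomputable section

namespace PinkLie

/-! ### Profinite groups: Mazur's finiteness condition -/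

/-- A topological group is topologically finitely generated if it has a finite subset generating a
dense subgroup. -/
def TopologicallyFG (H : Type*) [Group H] [TopologicalSpace H] : Prop :=
  ∃ S : Set H, S.Finite ∧ Dense (Subgroup.closure S : Set H)

/-- The intersection of all open normal subgroups of `p`-power index. For a profinite group `H`,
the quotient `H ⧸ proPKernel p H` is the largest pro-`p` quotient of `H`. -/
def proPKernel (p : ℕ) (H : Type*) [Group H] [TopologicalSpace H] : Subgroup H :=
  sInf {U : Subgroup H | U.Normal ∧ IsOpen (U : Set H) ∧ ∃ k : ℕ, U.index = p ^ k}

instance proPKernel_normal (p : ℕ) (H : Type*) [Group H] [TopologicalSpace H] :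
    (proPKernel p H).Normal := by
  refine ⟨fun n hn g => ?_⟩
  simp only [proPKernel, Subgroup.mem_sInf, Set.mem_ofPred_eq] at hn ⊢
  intro U hU
  exact hU.1.conj_mem n (hn U hU) g

/-- Mazur's `p`-finiteness condition: the largest pro-`p` quotient of every open subgroup is
topologically finitely generated. -/
def PFiniteness (p : ℕ) (P : Type*) [Group P] [TopologicalSpace P] : Prop :=
  ∀ H : Subgroup P, IsOpen (H : Set P) → TopologicallyFG (H ⧸ proPKernel p H)

/-! ### Two-dimensional pseudo-representations and residual representations -/

/-- `(t, d)` is a two-dimensional pseudo-representation of the group `P` with values in `A`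
(`d`, being a monoid homomorphism on a group, takes values in the units of `A`). -/
structure IsPseudoRep {P A : Type*} [Group P] [CommRing A] (t : P → A) (d : P →* A) : Prop where
  central : ∀ x y, t (x * y) = t (y * x)
  map_one : t 1 = 2
  identity : ∀ x y, t (x * y) + d y * t (x * y⁻¹) = t x * t y

/-- The linear representation on `k²` attached to a homomorphism to `GL₂(k)`. -/
def toRepresentation {P k : Type*} [Group P] [Field k] (r : P →* GL (Fin 2) k) :
    Representation k P (Fin 2 → k) where
  toFun g := Matrix.mulVecLin (r g : Matrix (Fin 2) (Fin 2) k)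
  map_one' := by ext; simp
  map_mul' x y := by ext; simp

/-- `r` is absolutely irreducible: it is irreducible over the algebraic closure. -/
def IsAbsolutelyIrreducible {P k : Type*} [Group P] [Field k] (r : P →* GL (Fin 2) k) : Prop :=
  (toRepresentation
    ((Matrix.GeneralLinearGroup.map (algebraMap k (AlgebraicClosure k))).comp r)).IsIrreducible

/-- `r` is isomorphic to the direct sum of two distinct characters. -/
def IsSumOfDistinctCharacters {P k : Type*} [Group P] [Field k] (r : P →* GL (Fin 2) k) : Prop :=
  ∃ (χ₁ χ₂ : P →* kˣ) (Q : GL (Fin 2) k), χ₁ ≠ χ₂ ∧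
    ∀ g, (Q * r g * Q⁻¹ : GL (Fin 2) k).val = Matrix.diagonal ![(χ₁ g : k), (χ₂ g : k)]

/-- The projective image of a homomorphism to `GL₂(k)`. -/
def projectiveImage {P k : Type*} [Group P] [Field k] (r : P →* GL (Fin 2) k) :
    Subgroup PGL(2, k) :=
  (Matrix.ProjGenLinGroup.mk.comp r).range

/-! ### Constants and admissible pseudo-deformations

`F` is a finite field, `A` a topological algebra over the ring `WittVector p F` of Witt vectors,
which is local with residue field `F`; the residue map is denoted `res : A →+* F`. -/

section Admissible

variable (p : ℕ) [Fact p.Prime] {F A : Type*} [Field F] [CommRing A] [Algebra (WittVector p F) A]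

/-- The multiplicative section `s : F → A` of the residue map: the Teichmüller lift in
`WittVector p F`, seen in `A`. -/
def constLift : F →* A :=
  (algebraMap (WittVector p F) A : WittVector p F →* A).comp (WittVector.teichmuller p)

/-- `(P, ρbar, t, d)` satisfies all the conditions of an admissible pseudo-deformation over `A`,
except Mazur's finiteness condition on `P`. Since `F` is finite, hence discrete, `ρbar` is continuous
exactly when its kernel is open. -/
structure IsConstDetPseudoDeformation [TopologicalSpace A] (res : A →+* F)
    {P : Type*} [Group P] [TopologicalSpace P]
    (ρbar : P →* GL (Fin 2) F) (t : P → A) (d : P →* A) : Prop where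
  continuous_residual : IsOpen (ρbar.ker : Set P)
  multiplicityFree : IsAbsolutelyIrreducible ρbar ∨ IsSumOfDistinctCharacters ρbar
  pseudoRep : IsPseudoRep t d
  continuous_t : Continuous t
  continuous_d : Continuous d
  residual_trace : ∀ g, res (t g) = (ρbar g).val.trace
  residual_det : ∀ g, res (d g) = (ρbar g).val.det
  const_det : ∀ g, ∃ x : F, d g = constLift p x
  /-- `A` is generated by `t(P)` as a topological `W(F)`-algebra -/
  generated : Dense (Algebra.adjoin (WittVector p F) (Set.range t) : Set A)

/-- `(P, ρbar, t, d)` is an admissible pseudo-deformation over `A`. -/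
structure IsAdmissible [TopologicalSpace A] (res : A →+* F)
    {P : Type*} [Group P] [TopologicalSpace P]
    (ρbar : P →* GL (Fin 2) F) (t : P → A) (d : P →* A) : Prop extends
    IsConstDetPseudoDeformation p res ρbar t d where
  pFinite : PFiniteness p P

/-- `ρ : P → GL₂(A)` is a `(t, d)`-representation (with values in the faithful generalized matrix
algebra `M₂(A)`): trace `t`, determinant `d`, and `ρ(P)` spans `M₂(A)` over `A`. -/
structure IsTDRepresentation {A P : Type*} [CommRing A] [Group P] (t : P → A) (d : P →* A)
    (ρ : P →* GL (Fin 2) A) : Prop where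
  trace_eq : ∀ g, (ρ g).val.trace = t g
  det_eq : ∀ g, (ρ g).val.det = d g
  span_eq : Submodule.span A (Set.range fun g => (ρ g).val) = ⊤

/-- The image `Ḡ` of `ρ(P)` in `GL₂(F)`. -/
def residualImage {F A P : Type*} [Field F] [CommRing A] [Group P] (res : A →+* F)
    (ρ : P →* GL (Fin 2) A) : Subgroup (GL (Fin 2) F) :=
  ((Matrix.GeneralLinearGroup.map res).comp ρ).range

/-- `ρ` is adapted to `(g₀, lam, mu)`: `lam ≠ mu`, and `ρ(g₀)` is diagonal and reduces to
`diag(lam, mu)`. -/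
def IsAdaptedTo {F A P : Type*} [Field F] [CommRing A] [Group P] (res : A →+* F)
    (ρ : P →* GL (Fin 2) A) (g₀ : P) (lam mu : F) : Prop :=
  lam ≠ mu ∧ (ρ g₀).val 0 1 = 0 ∧ (ρ g₀).val 1 0 = 0 ∧
    res ((ρ g₀).val 0 0) = lam ∧ res ((ρ g₀).val 1 1) = mu

/-- `ρ` is well adapted, in the case of a dihedral projective image. (`⊥ : Subfield F` is the prime
field.) -/
structure IsWellAdapted (res : A →+* F) {P : Type*} [Group P] (ρ : P →* GL (Fin 2) A) : Prop where
  /-- `ρ` is adapted to some `g₀` whose image in `Ḡ`, together with the scalar matrices of `Ḡ`,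
  generates a subgroup of index `2` in `Ḡ` -/
  adapted : ∃ (g₀ : P) (lam mu : F), IsAdaptedTo res ρ g₀ lam mu ∧
    (Subgroup.zpowers (Matrix.GeneralLinearGroup.map res (ρ g₀)) ⊔
      (Subgroup.center (GL (Fin 2) F) ⊓ residualImage res ρ)).relIndex (residualImage res ρ) = 2
  /-- `s(Ḡ) ⊆ G` -/
  const_mem : ∀ x ∈ residualImage res ρ, ∃ g : P, (ρ g).val = x.val.map (constLift p (A := A))
  /-- if `Ḡ` is non-abelian, it contains some `(0 b; c 0)` with `b / c` in the prime field -/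
  antidiagonal : (¬ ∀ x ∈ residualImage res ρ, ∀ y ∈ residualImage res ρ, x * y = y * x) →
    ∃ x ∈ residualImage res ρ, x.val 0 0 = 0 ∧ x.val 1 1 = 0 ∧
      x.val 0 1 * (x.val 1 0)⁻¹ ∈ (⊥ : Subfield F)

variable (F A) in
/-- The image in `A` of the Witt vectors `W(k) ⊆ W(F)` of a subfield `k` of `F`. The `W(k)`-submodules
of an `A`-module are its submodules over this subring. -/
def wittSubring (k : Subfield F) : Subring A :=
  ((algebraMap (WittVector p F) A).comp (WittVector.map k.subtype)).range

end Admissible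

/-! ### Pink's Lie algebra -/

section Pink

variable {A : Type*} [CommRing A]

/-- `Θ(r) = r - (tr r / 2) Id` (`2` is a unit in all the rings considered). -/
def pinkTheta (r : Matrix (Fin 2) (Fin 2) A) : Matrix (Fin 2) (Fin 2) A :=
  r - (Ring.inverse 2 * r.trace) • (1 : Matrix (Fin 2) (Fin 2) A)

/-- `SR¹` for `R = M₂(A)`, `A` local: the matrices of determinant `1` that are congruent to the
identity modulo the maximal ideal. -/
def SR1 (A : Type*) [CommRing A] [IsLocalRing A] : Subgroup (GL (Fin 2) A) :=
  Matrix.GeneralLinearGroup.det.ker ⊓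
    (Matrix.GeneralLinearGroup.map (IsLocalRing.residue A)).ker

/-- The closed additive subgroup generated by `Θ(Γ)`, for a subgroup `Γ` of `GL₂(A)`. -/
def pinkLie [TopologicalSpace A] [IsTopologicalRing A] (Γ : Subgroup (GL (Fin 2) A)) :
    AddSubgroup (Matrix (Fin 2) (Fin 2) A) :=
  (AddSubgroup.closure ((fun g : GL (Fin 2) A => pinkTheta g.val) '' Γ)).topologicalClosure

/-- The Lie algebra `L` attached to `ρ`: Pink's Lie algebra of `Γ = ρ(P) ∩ SR¹`. -/
def lieAlg [TopologicalSpace A] [IsTopologicalRing A] [IsLocalRing A] {P : Type*} [Group P]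
    (ρ : P →* GL (Fin 2) A) : AddSubgroup (Matrix (Fin 2) (Fin 2) A) :=
  pinkLie (ρ.range ⊓ SR1 A)

/-- The trace zero matrices with diagonal entries in `I` and off-diagonal entries in `B`. -/
def traceZero (I B : Set A) : Set (Matrix (Fin 2) (Fin 2) A) :=
  {M | M.trace = 0 ∧ M 0 0 ∈ I ∧ M 1 1 ∈ I ∧ M 0 1 ∈ B ∧ M 1 0 ∈ B}

/-- The product `X Y`: the closure of the additive subgroup generated by all products `x * y`. -/
def closedMul [TopologicalSpace A] [IsTopologicalRing A] (X Y : AddSubgroup A) : AddSubgroup A :=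
  (AddSubgroup.closure (Set.image2 (· * ·) (X : Set A) (Y : Set A))).topologicalClosure

/-- The four conditions on the pair `(I, B)`:
`B² ⊆ I`, `I B ⊆ B`, `I³ ⊆ I` and `W 1 + W I + W I² + W B = A`. -/
structure StructureConditions (W : Type*) [CommRing W] [Algebra W A]
    [TopologicalSpace A] [IsTopologicalRing A] (I B : AddSubgroup A) : Prop where
  sq_B_le : closedMul B B ≤ I
  I_mul_B_le : closedMul I B ≤ B
  cube_I_le : closedMul (closedMul I I) I ≤ I
  sum_eq : Submodule.span W {(1 : A)} ⊔ Submodule.span W (I : Set A) ⊔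
    Submodule.span W (closedMul I I : Set A) ⊔ Submodule.span W (B : Set A) = ⊤

end Pink

end PinkLie

end

open PinkLie

universe u v w

/-! Direct part. For g of determinant one, g + g⁻¹ = tr(g)·1. Hence the Lie algebra L is stable
under brackets, under multiplication by tr(xy) with x, y in L, and under division by 2
(`pinkClosed_pinkLie`). A well adapted image contains two useful constant matrices. One is diagonal,
with ratio of entries ξ in 𝔽_q and ξ² ≠ 1; this is where gcd(m, q - 1) > 2 is used. The other is
antidiagonal, with ratio in the prime field. Conjugation by the first acts on diagonal, upper and
lower entries by 1, ξ, ξ⁻¹, which are distinct modulo 𝔪, so W(𝔽_q)L is the sum of its three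
components; conjugation by the second identifies the upper component with the lower one
(`exists_eq_traceZero_of_conj`). Applied to these components, Pink's operations give B² ⊆ I, IB ⊆ B
and I³ ⊆ I.

These inclusions make C = W + WI + WI² + WB a closed subalgebra. Every element of the image is a
constant matrix times some γ in SR¹, and γ is a scalar plus (a b; c -a) with a, b, c in C. The
determinant condition forces the scalar to be the square root of 1 + a² + bc congruent to 1, a limit
of powers of 1 + a² + bc, so it lies in C as well. Thus C contains all traces, and C = A
(`trace_mem_structureSubalgebra`).

Converse. The matrices √(1 + a² + bc) + (a b; c -a) with a in I and b, c in B form a group Γ,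
because the square roots multiply I and B into themselves (`pinkGroup`). The finite group D of
monomial matrices with Teichmüller entries normalizes Γ and has dihedral projective image; the
inclusion of DΓ in GL₂(A) has the required Lie algebra. For noetherian A a topologically finitely
generated subgroup with the same Lie algebra is needed. It exists because A is a noetherian module
over a ring R generated topologically by squares of finitely many elements of I and B (an
Eakin–Nagata argument), so that the R-modules I and B are finitely generated
(`exists_finset_generators`).

Topology. Since A is only assumed compact and Hausdorff, it has to be shown that the powers of 𝔪
tend to zero (`exists_maximalIdeal_pow_subset`). This rests on Bogolyubov's lemma, which gives small
open subgroups in compact abelian groups of finite exponent, applied to A/pⁿA. -/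

noncomputable section

namespace PinkLie

/-! ### Subgroups in sumsets, after Bogolyubov -/

section Bogolyubov

open scoped ComplexConjugate

/-- The unnormalised Fourier coefficient of the indicator function of `S`. -/
def fourierSum {E : Type*} [AddCommGroup E] (S : Finset E) (ψ : AddChar E ℂ) : ℂ :=
  ∑ s ∈ S, ψ s

lemma conj_fourierSum {E : Type*} [AddCommGroup E] [Finite E] (S : Finset E) (ψ : AddChar E ℂ) :
    conj (fourierSum S ψ) = ∑ s ∈ S, ψ (-s) := by
  simp only [fourierSum, map_sum, AddChar.map_neg_eq_conj]

lemma sum_sum_addChar {E ι : Type*} [AddCommGroup E] [Fintype E] [DecidableEq E]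
    (I : Finset ι) (g : ι → E) :
    ∑ ψ : AddChar E ℂ, ∑ i ∈ I, ψ (g i) = Fintype.card E * (I.filter fun i => g i = 0).card := by
  rw [Finset.sum_comm]
  simp only [AddChar.sum_apply_eq_ite, Finset.sum_ite, Finset.sum_const, nsmul_eq_mul]
  ring

/-- Parseval: orthogonality of characters keeps only the pairs in S × S with equal entries. -/
lemma sum_normSq_fourierSum {E : Type*} [AddCommGroup E] [Fintype E] (S : Finset E) :
    ∑ ψ : AddChar E ℂ, Complex.normSq (fourierSum S ψ) = Fintype.card E * S.card := by
  classical
  have h := sum_sum_addChar (S ×ˢ S) (fun x : E × E => x.1 + -x.2)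
  have hc : ((S ×ˢ S).filter fun x : E × E => x.1 + -x.2 = 0).card = S.card := by
    rw [← Finset.card_image_of_injective S (f := fun x => (x, x)) (fun a b hab => by simpa using hab)]
    congr 1
    ext ⟨a, b⟩
    simp only [Finset.mem_filter, Finset.mem_product, Finset.mem_image, Prod.mk.injEq,
      ← sub_eq_add_neg, sub_eq_zero]
    constructor
    · rintro ⟨⟨ha, hb⟩, rfl⟩
      exact ⟨a, ha, rfl, rfl⟩
    · rintro ⟨c, hc, rfl, rfl⟩
      exact ⟨⟨hc, hc⟩, rfl⟩
  rw [hc] at h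
  have : ((∑ ψ : AddChar E ℂ, Complex.normSq (fourierSum S ψ) : ℝ) : ℂ)
      = ((Fintype.card E * S.card : ℝ) : ℂ) := by
    push_cast
    rw [← h]
    refine Finset.sum_congr rfl fun ψ _ => ?_
    rw [← Complex.mul_conj, conj_fourierSum, fourierSum, Finset.sum_mul_sum, Finset.sum_product]
    simp [AddChar.map_add_eq_mul]
  exact_mod_cast this

/-- Up to the factor |E|, the fourth moment twisted by ψ(x) counts the solutions in S of x = a + b -
c - e. -/
lemma sum_normSq_sq_fourierSum_mul {E : Type*} [AddCommGroup E] [Fintype E] (S : Finset E) (x : E)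
    (hx : ∀ a ∈ S, ∀ b ∈ S, ∀ c ∈ S, ∀ e ∈ S, x ≠ a + b - c - e) :
    ∑ ψ : AddChar E ℂ, (Complex.normSq (fourierSum S ψ) : ℂ) ^ 2 * ψ x = 0 := by
  classical
  have h := sum_sum_addChar ((S ×ˢ S) ×ˢ (S ×ˢ S))
    (fun y : (E × E) × (E × E) => ((y.1.1 + -y.1.2) + (y.2.1 + -y.2.2)) + x)
  have hc : (((S ×ˢ S) ×ˢ (S ×ˢ S)).filter fun y : (E × E) × (E × E) =>
      ((y.1.1 + -y.1.2) + (y.2.1 + -y.2.2)) + x = 0) = ∅ := by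
    refine Finset.filter_eq_empty_iff.mpr ?_
    rintro ⟨⟨a, b⟩, ⟨c, e⟩⟩ hm h0
    simp only [Finset.mem_product] at hm
    refine hx b hm.1.2 e hm.2.2 a hm.1.1 c hm.2.1 ?_
    rw [← sub_eq_zero, ← h0]
    simp only
    abel
  rw [hc, Finset.card_empty, Nat.cast_zero, mul_zero] at h
  rw [← h]
  refine Finset.sum_congr rfl fun ψ _ => ?_
  rw [← Complex.mul_conj, conj_fourierSum, fourierSum, sq, Finset.sum_mul_sum,
    ← Finset.sum_product', Finset.sum_mul_sum, ← Finset.sum_product', Finset.sum_mul]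
  simp [AddChar.map_add_eq_mul]

/-- K is the common kernel of the characters with a large coefficient on S; Parseval leaves at most
2k² of them. For x in K, the trivial character outweighs all the small coefficients in the twisted
fourth moment, which therefore cannot vanish. The index bound is phrased as a pigeonhole statement
because that form passes to ultrafilter limits. -/
theorem exists_addSubgroup_subset_sumset {E : Type*} [AddCommGroup E] [Finite E] (N k : ℕ)
    (hN : 0 < N) (hE : ∀ x : E, N • x = 0) (S : Finset E) (hS : Nat.card E ≤ k * S.card) :
    ∃ K : AddSubgroup E, (∀ x ∈ K, ∃ a ∈ S, ∃ b ∈ S, ∃ c ∈ S, ∃ e ∈ S, x = a + b - c - e) ∧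
      ∀ f : Fin (N ^ (2 * k ^ 2) + 1) → E, ∃ i j, i ≠ j ∧ f i - f j ∈ K := by
  classical
  have := Fintype.ofFinite E
  rw [Nat.card_eq_fintype_card] at hS
  set n : ℝ := ((Fintype.card E : ℕ) : ℝ) with hn
  set σ : ℝ := ((S.card : ℕ) : ℝ) with hσ
  have hn0 : 0 < n := by rw [hn]; exact_mod_cast Fintype.card_pos
  have hσk : n ≤ k * σ := by rw [hn, hσ]; exact_mod_cast hS
  have hσ0 : 0 < σ := by
    rcases (Nat.cast_nonneg S.card : (0 : ℝ) ≤ S.card).eq_or_lt with h | h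
    · rw [hσ, ← h] at hσk; simp at hσk; linarith
    · exact h
  have hσn : σ ≤ n := by rw [hn, hσ]; exact_mod_cast Finset.card_le_univ S
  -- With this threshold the discarded characters contribute at most σ⁴/2 in absolute value, by
  -- Parseval, against the main term σ⁴.
  set L : Finset (AddChar E ℂ) :=
    Finset.univ.filter fun ψ => σ ^ 3 / (2 * n) < Complex.normSq (fourierSum S ψ) with hL
  have hsum := sum_normSq_fourierSum S
  have hLcard : L.card ≤ 2 * k ^ 2 := by
    have h1 : (L.card : ℝ) * (σ ^ 3 / (2 * n)) ≤ n * σ := by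
      rw [← hsum, ← nsmul_eq_mul]
      refine (Finset.card_nsmul_le_sum L (fun ψ => Complex.normSq (fourierSum S ψ)) _
        (fun ψ hψ => ?_)).trans
        (Finset.sum_le_univ_sum_of_nonneg fun ψ => Complex.normSq_nonneg _)
      exact (Finset.mem_filter.mp hψ).2.le
    have h2 : (L.card : ℝ) * σ ^ 2 ≤ 2 * n ^ 2 := by
      have := mul_le_mul_of_nonneg_right h1 (by positivity : 0 ≤ 2 * n / σ)
      calc (L.card : ℝ) * σ ^ 2 = (L.card : ℝ) * (σ ^ 3 / (2 * n)) * (2 * n / σ) := by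
            field_simp
        _ ≤ _ := this
        _ = 2 * n ^ 2 := by field_simp
    have h3 : n ^ 2 ≤ (k * σ) ^ 2 := by gcongr
    have h4 : (L.card : ℝ) * σ ^ 2 ≤ (2 * k ^ 2) * σ ^ 2 := by nlinarith
    have h5 := le_of_mul_le_mul_right h4 (by positivity)
    exact_mod_cast h5
  refine ⟨{ carrier := {x | ∀ ψ ∈ L, ψ x = 1}
            add_mem' := fun {a b} ha hb ψ hψ => by
              rw [AddChar.map_add_eq_mul, ha ψ hψ, hb ψ hψ, one_mul]
            zero_mem' := fun ψ _ => by simp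
            neg_mem' := fun {a} ha ψ hψ => by
              rw [AddChar.map_neg_eq_inv, ha ψ hψ, inv_one] }, ?_, ?_⟩
  · intro x hx
    by_contra hcon
    push Not at hcon
    have h0 := sum_normSq_sq_fourierSum_mul S x hcon
    have hre : ∑ ψ : AddChar E ℂ, Complex.normSq (fourierSum S ψ) ^ 2 * (ψ x).re = 0 := by
      have := congrArg Complex.re h0
      rw [Complex.re_sum, Complex.zero_re] at this
      rw [← this]
      refine Finset.sum_congr rfl fun ψ _ => ?_
      rw [← Complex.ofReal_pow, Complex.re_ofReal_mul]
    have hzero : fourierSum S (0 : AddChar E ℂ) = (σ : ℂ) := by simp [fourierSum, hσ]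
    have hmem0 : (0 : AddChar E ℂ) ∈ L := by
      simp only [hL, Finset.mem_filter, Finset.mem_univ, true_and, hzero, Complex.normSq_ofReal]
      rw [div_lt_iff₀ (by positivity)]
      nlinarith [mul_pos hσ0 hσ0]
    -- The last term cancels the loss at the trivial character, so the loss can be summed over all
    -- characters at once.
    have hlow : ∀ ψ : AddChar E ℂ, (if ψ = 0 then σ ^ 4 else 0)
        - σ ^ 3 / (2 * n) * Complex.normSq (fourierSum S ψ)
          + (if ψ = 0 then σ ^ 3 / (2 * n) * σ ^ 2 else 0)
        ≤ Complex.normSq (fourierSum S ψ) ^ 2 * (ψ x).re := by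
      intro ψ
      have hnn := Complex.normSq_nonneg (fourierSum S ψ)
      have hc : 0 ≤ σ ^ 3 / (2 * n) := by positivity
      by_cases hψ0 : ψ = 0
      · subst hψ0
        simp only [if_true, hzero, Complex.normSq_ofReal, AddChar.zero_apply, Complex.one_re]
        nlinarith
      · simp only [if_neg hψ0]
        by_cases hψ : ψ ∈ L
        · rw [show ψ x = 1 from hx ψ hψ, Complex.one_re]
          nlinarith [sq_nonneg (Complex.normSq (fourierSum S ψ)), mul_nonneg hc hnn]
        · have hle : Complex.normSq (fourierSum S ψ) ≤ σ ^ 3 / (2 * n) := by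
            by_contra h
            exact hψ (Finset.mem_filter.mpr ⟨Finset.mem_univ _, not_le.mp h⟩)
          have hre1 : -1 ≤ (ψ x).re := by
            have h1 := Complex.abs_re_le_norm (ψ x)
            rw [AddChar.norm_apply ψ x] at h1
            exact (abs_le.mp h1).1
          have hq := mul_le_mul_of_nonneg_right hle hnn
          nlinarith [mul_nonneg (sq_nonneg (Complex.normSq (fourierSum S ψ)))
            (by linarith : 0 ≤ (ψ x).re + 1)]
    have hfin := Finset.sum_le_sum fun ψ (_ : ψ ∈ Finset.univ) => hlow ψ
    rw [hre, Finset.sum_add_distrib, Finset.sum_sub_distrib, ← Finset.mul_sum, hsum] at hfin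
    simp only [Finset.sum_ite_eq', Finset.mem_univ, if_true] at hfin
    have e1 : σ ^ 3 / (2 * n) * (n * σ) = σ ^ 4 / 2 := by field_simp
    rw [e1] at hfin
    have : 0 < σ ^ 3 / (2 * n) * σ ^ 2 := by positivity
    have : 0 < σ ^ 4 := by positivity
    linarith
  · intro f
    have : NeZero N := ⟨hN.ne'⟩
    let g : Fin (N ^ (2 * k ^ 2) + 1) → L → rootsOfUnity N ℂ := fun i ψ =>
      rootsOfUnity.mkOfPowEq (ψ.1 (f i)) (by
        rw [← AddChar.map_nsmul_eq_pow, hE, AddChar.map_zero_eq_one])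
    have : Fintype (rootsOfUnity N ℂ) := Fintype.ofFinite _
    have hcard : Fintype.card (L → rootsOfUnity N ℂ) < Fintype.card (Fin (N ^ (2 * k ^ 2) + 1)) := by
      rw [Fintype.card_fun, Fintype.card_fin, Fintype.card_coe,
        ← Nat.card_eq_fintype_card (α := rootsOfUnity N ℂ), Complex.card_rootsOfUnity]
      exact Nat.lt_succ_of_le (Nat.pow_le_pow_right hN hLcard)
    obtain ⟨i, j, hij, hg⟩ := Fintype.exists_ne_map_eq_of_card_lt g hcard
    refine ⟨i, j, hij, fun ψ hψ => ?_⟩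
    have h1 := congrArg (fun u : rootsOfUnity N ℂ => ((u : ℂˣ) : ℂ)) (congrFun hg ⟨ψ, hψ⟩)
    simp only [g, rootsOfUnity.coe_mkOfPowEq] at h1
    rw [AddChar.map_sub_eq_div, h1, div_self]
    exact (AddChar.val_isUnit ψ _).ne_zero

/-- In an abelian group of finite exponent, if finitely many translates of `S` cover the group, then
`S + S - S - S` contains a subgroup of finite index. -/
theorem exists_finiteIndex_subset_sumset {H : Type*} [AddCommGroup H] (N : ℕ)
    (hN : 0 < N) (hH : ∀ x : H, N • x = 0) (S : Set H) (X : Finset H)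
    (hX : ∀ h : H, ∃ x ∈ X, h - x ∈ S) :
    ∃ K : AddSubgroup H, K.FiniteIndex ∧
      ∀ x ∈ K, ∃ a ∈ S, ∃ b ∈ S, ∃ c ∈ S, ∃ e ∈ S, x = a + b - c - e := by
  classical
  set k := X.card
  set M := N ^ (2 * k ^ 2) + 1
  have key : ∀ s : Finset H, ∃ K : AddSubgroup H,
      (∀ x ∈ K, ∃ a ∈ S, ∃ b ∈ S, ∃ c ∈ S, ∃ e ∈ S, x = a + b - c - e) ∧
      ∀ f : Fin M → H, (∀ i, f i ∈ s) → ∃ i j, i ≠ j ∧ f i - f j ∈ K := by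
    intro s
    set E := AddSubgroup.closure (s : Set H)
    have hfinE : Finite E := by
      have : AddGroup.FG E := (AddGroup.fg_iff_addSubgroup_fg _).mpr ⟨s, rfl⟩
      have : Module.Finite ℤ E := Module.Finite.iff_addGroup_fg.mpr this
      refine Module.finite_of_fg_torsion E fun x => ⟨⟨(N : ℤ), ?_⟩, ?_⟩
      · exact mem_nonZeroDivisors_of_ne_zero (by exact_mod_cast hN.ne')
      · refine Subtype.ext ?_
        simpa using hH x
    have := Fintype.ofFinite E
    choose q hqX hqS using fun e : E => hX e
    have hne : X.Nonempty := ⟨q 0, hqX 0⟩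
    -- One translate x + S contains at least 1/k of E; the shift by x cancels in a + b - c - e.
    obtain ⟨x, hx, hcard⟩ : ∃ x ∈ X, Nat.card E ≤ k * (Finset.univ.filter fun e => q e = x).card := by
      by_contra hcon
      push Not at hcon
      have h1 : Nat.card E = ∑ x ∈ X, (Finset.univ.filter fun e => q e = x).card := by
        rw [Nat.card_eq_fintype_card, ← Finset.card_univ]
        exact Finset.card_eq_sum_card_fiberwise fun e _ => hqX e
      have h2 : ∑ x ∈ X, k * (Finset.univ.filter fun e => q e = x).card < ∑ x ∈ X, Nat.card E :=
        Finset.sum_lt_sum_of_nonempty hne hcon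
      rw [← Finset.mul_sum, ← h1, Finset.sum_const, smul_eq_mul] at h2
      exact lt_irrefl _ h2
    obtain ⟨K, hK1, hK2⟩ := exists_addSubgroup_subset_sumset N k hN
      (fun e : E => Subtype.ext (hH e)) (Finset.univ.filter fun e => q e = x) hcard
    refine ⟨K.map E.subtype, ?_, ?_⟩
    · rintro _ ⟨y, hy, rfl⟩
      obtain ⟨a, ha, b, hb, c, hc, e, he, rfl⟩ := hK1 y hy
      simp only [Finset.mem_filter, Finset.mem_univ, true_and] at ha hb hc he
      refine ⟨a - x, ha ▸ hqS a, b - x, hb ▸ hqS b, c - x, hc ▸ hqS c, e - x, he ▸ hqS e, ?_⟩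
      simp only [AddSubgroup.subtype_apply, AddSubgroup.coe_sub, AddSubgroup.coe_add]
      abel
    · intro f hf
      obtain ⟨i, j, hij, hm⟩ := hK2 fun i => ⟨f i, AddSubgroup.subset_closure (hf i)⟩
      exact ⟨i, j, hij, ⟨_, hm, rfl⟩⟩
  choose K hK1 hK2 using key
  -- The subgroups `K s` need not be compatible with each other. Their limit along an ultrafilter is
  -- a subgroup, and the pigeonhole bound, a finite disjunction, survives in the limit.
  let 𝓤 : Ultrafilter (Finset H) := Ultrafilter.of Filter.atTop
  have h𝓤 : (𝓤 : Filter (Finset H)) ≤ Filter.atTop := Ultrafilter.of_le _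
  let K0 : AddSubgroup H :=
    { carrier := {h | ∀ᶠ s in (𝓤 : Filter (Finset H)), h ∈ K s}
      add_mem' := fun {a b} ha hb => by
        filter_upwards [ha, hb] with s h1 h2 using add_mem h1 h2
      zero_mem' := Filter.Eventually.of_forall fun s => zero_mem _
      neg_mem' := fun {a} ha => by filter_upwards [ha] with s h1 using neg_mem h1 }
  refine ⟨K0, ?_, ?_⟩
  · have hpig : ∀ f : Fin M → H, ∃ i j, i ≠ j ∧ f i - f j ∈ K0 := by
      intro f
      have hev : ∀ᶠ s in (𝓤 : Filter (Finset H)),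
          ∃ ij ∈ (Set.univ : Set (Fin M × Fin M)), ij.1 ≠ ij.2 ∧ f ij.1 - f ij.2 ∈ K s := by
        have := h𝓤 (Filter.eventually_ge_atTop (Finset.univ.image f))
        filter_upwards [this] with s hs
        obtain ⟨i, j, hij, hm⟩ := hK2 s f fun i => hs (Finset.mem_image_of_mem f (Finset.mem_univ i))
        exact ⟨(i, j), trivial, hij, hm⟩
      obtain ⟨⟨i, j⟩, -, hm⟩ :=
        (Ultrafilter.eventually_exists_mem_iff Set.finite_univ).mp hev
      obtain ⟨s, hs⟩ := (hm.and (Filter.Eventually.of_forall fun _ => trivial)).exists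
      exact ⟨i, j, hs.1.1, hm.mono fun s h => h.2⟩
    by_contra hinf
    have hi : Infinite (H ⧸ K0) := by
      rw [← not_finite_iff_infinite]
      exact fun h => hinf AddSubgroup.finiteIndex_of_finite_quotient
    obtain ⟨i, j, hij, hm⟩ := hpig fun i =>
      Quotient.out ((Infinite.natEmbedding (H ⧸ K0)) (i : ℕ))
    apply hij
    have hm' := neg_mem hm
    rw [neg_sub, sub_eq_neg_add, ← QuotientAddGroup.eq, QuotientAddGroup.out_eq',
      QuotientAddGroup.out_eq'] at hm'
    exact Fin.ext ((Infinite.natEmbedding (H ⧸ K0)).injective hm')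
  · intro x hx
    obtain ⟨s, hs⟩ := Filter.Eventually.exists (f := (𝓤 : Filter (Finset H))) hx
    exact hK1 s x hs

end Bogolyubov

/-! ### Open subgroups of compact abelian groups of finite exponent -/

section CompactTorsion

open Filter Topology Pointwise

/-- By compactness finitely many translates of a small V cover H, so V + V - V - V contains a
subgroup of finite index. Its closure is closed of finite index, hence open, and stays in U because
V + V - V - V lies in a closed part of U. -/
theorem exists_isOpen_addSubgroup_subset {H : Type*} [AddCommGroup H] [TopologicalSpace H]
    [IsTopologicalAddGroup H] [CompactSpace H] (N : ℕ) (hN : 0 < N)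
    (hH : ∀ x : H, N • x = 0) {U : Set H} (hU : U ∈ 𝓝 (0 : H)) :
    ∃ K : AddSubgroup H, IsOpen (K : Set H) ∧ (K : Set H) ⊆ U := by
  obtain ⟨U', hU', hU'c, hU'U⟩ := exists_mem_nhds_isClosed_subset hU
  have hcont : ContinuousAt (fun q : (H × H) × (H × H) => q.1.1 + q.1.2 - q.2.1 - q.2.2)
      ((0, 0), (0, 0)) := by fun_prop
  have hpre := hcont (show U' ∈ 𝓝 _ by simpa using hU')
  rw [mem_map, nhds_prod_eq, nhds_prod_eq, mem_prod_self_iff] at hpre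
  obtain ⟨T, hT, hTs⟩ := hpre
  rw [mem_prod_self_iff] at hT
  obtain ⟨V, hV, hVT⟩ := hT
  obtain ⟨X, hX⟩ : ∃ X : Finset H, ∀ h : H, ∃ x ∈ X, h - x ∈ V := by
    obtain ⟨X, -, hX⟩ := isCompact_univ.elim_nhds_subcover (fun x : H => {h | h - x ∈ V})
      (fun x _ => by
        have : ContinuousAt (fun h : H => h - x) x := by fun_prop
        exact this (by simpa using hV))
    refine ⟨X, fun h => ?_⟩
    simpa using hX (Set.mem_univ h)
  obtain ⟨K, hKf, hK⟩ := exists_finiteIndex_subset_sumset N hN hH V X hX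
  have hsub : (K : Set H) ⊆ U' := by
    intro x hx
    obtain ⟨a, ha, b, hb, c, hc, e, he, rfl⟩ := hK x hx
    exact hTs (show ((a, b), (c, e)) ∈ T ×ˢ T from
      ⟨hVT ⟨ha, hb⟩, hVT ⟨hc, he⟩⟩)
  have hfi : K.topologicalClosure.FiniteIndex := AddSubgroup.finiteIndex_of_le K.le_topologicalClosure
  exact ⟨K.topologicalClosure,
    AddSubgroup.isOpen_of_isClosed_of_finiteIndex _ K.isClosed_topologicalClosure,
    (closure_minimal hsub hU'c).trans hU'U⟩

end CompactTorsion

/-! ### Compact local rings are linearly topologised -/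

section CompactLocalRing

open Filter Topology Pointwise IsLocalRing

variable {A : Type*} [CommRing A] [TopologicalSpace A] [IsTopologicalRing A]
    [CompactSpace A] [T2Space A]

/-- The units are the projection of the compact set xy = 1. In the local case this makes the maximal
ideal open. -/
lemma isClosed_setOf_isUnit : IsClosed {a : A | IsUnit a} := by
  have h : {a : A | IsUnit a} = Prod.fst '' {x : A × A | x.1 * x.2 = 1} := by
    ext a
    simp [isUnit_iff_exists_inv]
  rw [h]
  exact ((isClosed_eq (by fun_prop) (by fun_prop)).isCompact.image continuous_fst).isClosed

lemma isOpen_maximalIdeal_of_compact [IsLocalRing A] : IsOpen (maximalIdeal A : Set A) := by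
  rw [← isClosed_compl_iff]
  convert isClosed_setOf_isUnit (A := A)
  ext a
  simp

lemma isClosed_maximalIdeal_of_compact [IsLocalRing A] : IsClosed (maximalIdeal A : Set A) :=
  (maximalIdeal A).toAddSubgroup.isClosed_of_isOpen isOpen_maximalIdeal_of_compact

omit [T2Space A] in
/-- In a compact ring, a neighbourhood of `0` contains `V * A` for some neighbourhood `V`. -/
lemma exists_nhds_mul_subset {U : Set A} (hU : U ∈ 𝓝 (0 : A)) :
    ∃ V ∈ 𝓝 (0 : A), ∀ v ∈ V, ∀ a, v * a ∈ U := by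
  have h := (isCompact_univ (X := A)).eventually_forall_of_forall_eventually (x₀ := (0 : A))
    (P := fun x y => x * y ∈ U) (fun y _ => by
      have : ContinuousAt (fun z : A × A => z.1 * z.2) (0, y) := by fun_prop
      exact this (by simpa using hU))
  exact ⟨_, h, fun v hv a => hv a trivial⟩

/-- The closure of the powers of x is a compact semigroup, so it contains an idempotent
(Ellis–Numakura). This idempotent lies in the maximal ideal, hence is 0. -/
lemma exists_pow_mem_nhds [IsLocalRing A] {x : A} (hx : x ∈ maximalIdeal A) {U : Set A}
    (hU : U ∈ 𝓝 (0 : A)) : ∃ n : ℕ, 0 < n ∧ x ^ n ∈ U := by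
  let S : Subsemigroup A := { carrier := {y | ∃ n : ℕ, 0 < n ∧ x ^ n = y}
                              mul_mem' := by
                                rintro _ _ ⟨n, hn, rfl⟩ ⟨k, hk, rfl⟩
                                exact ⟨n + k, by omega, pow_add _ _ _⟩ }
  obtain ⟨e, he, hee⟩ := exists_idempotent_in_compact_subsemigroup
    (fun r : A => continuous_mul_const r) (closure (S : Set A))
    ⟨x, subset_closure ⟨1, one_pos, pow_one x⟩⟩ isClosed_closure.isCompact
    (fun a ha b hb => S.topologicalClosure.mul_mem ha hb)
  have hem : e ∈ maximalIdeal A := by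
    refine closure_minimal ?_ isClosed_maximalIdeal_of_compact he
    rintro _ ⟨n, hn, rfl⟩
    exact Ideal.pow_mem_of_mem _ hx n hn
  have he0 : e = 0 := by
    have hu : IsUnit (1 - e) := by
      by_contra h
      have := (maximalIdeal A).add_mem h hem
      simp at this
    have : (1 - e) * e = 0 := by rw [sub_mul, hee, one_mul, sub_self]
    exact (hu.mul_right_eq_zero).mp this
  rw [he0] at he
  obtain ⟨_, hy, n, hn, rfl⟩ := mem_closure_iff_nhds.mp he U hU
  exact ⟨n, hn, hy⟩

variable [IsLocalRing A]

/-- Compact local rings of residue characteristic `p` are linearly topologised. -/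
theorem exists_isOpen_ideal_subset {p : ℕ} (hp : 0 < p) (hpm : (p : A) ∈ maximalIdeal A) {U : Set A}
    (hU : U ∈ 𝓝 (0 : A)) : ∃ J : Ideal A, IsOpen (J : Set A) ∧ (J : Set A) ⊆ U := by
  suffices h : ∃ K : AddSubgroup A, IsOpen (K : Set A) ∧ (K : Set A) ⊆ U by
    obtain ⟨K, hK, hKU⟩ := h
    -- The largest ideal inside K; compactness of A makes it open.
    let J : Ideal A := { carrier := {x | ∀ a, x * a ∈ K}
                         add_mem' := fun {x y} hx hy a => by
                           rw [add_mul]; exact add_mem (hx a) (hy a)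
                         zero_mem' := fun a => by rw [zero_mul]; exact zero_mem K
                         smul_mem' := fun c x hx a => by
                           rw [smul_eq_mul, mul_comm c x, mul_assoc]; exact hx _ }
    refine ⟨J, ?_, fun x hx => hKU (by simpa using hx 1)⟩
    obtain ⟨V, hV, hVK⟩ := exists_nhds_mul_subset (hK.mem_nhds (zero_mem K))
    exact J.toAddSubgroup.isOpen_of_mem_nhds (g := 0) (mem_of_superset hV fun v hv a => hVK v hv a)
  have hcont : ContinuousAt (fun q : A × A => q.1 + q.2) (0, 0) := by fun_prop
  have hpre := hcont (show U ∈ 𝓝 _ by simpa using hU)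
  rw [mem_map, nhds_prod_eq, mem_prod_self_iff] at hpre
  obtain ⟨V, hV, hVU⟩ := hpre
  obtain ⟨V', hV', hV'V⟩ := exists_nhds_mul_subset hV
  -- Half of U absorbs pⁿA. The other half is treated in A/pⁿA, which has finite exponent.
  obtain ⟨n, hn, hpn⟩ := exists_pow_mem_nhds hpm hV'
  let D : AddSubgroup A := (AddMonoidHom.mulLeft ((p : A) ^ n)).range
  have hDc : IsClosed (D : Set A) := by
    have : IsCompact (Set.range fun a : A => (p : A) ^ n * a) := isCompact_range (by fun_prop)
    exact this.isClosed
  have hDV : (D : Set A) ⊆ V := by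
    rintro _ ⟨a, rfl⟩
    exact hV'V _ hpn a
  have : IsClosed (D : Set A) := hDc
  have hexp : ∀ x : A ⧸ D, p ^ n • x = 0 := by
    intro x
    induction x using QuotientAddGroup.induction_on with
    | H z =>
      rw [← QuotientAddGroup.mk_nsmul, QuotientAddGroup.eq_zero_iff]
      exact ⟨z, by simp [nsmul_eq_mul]⟩
  have hVq : ((↑) : A → A ⧸ D) '' V ∈ 𝓝 (0 : A ⧸ D) :=
    (QuotientAddGroup.isOpenMap_coe (N := D)).image_mem_nhds hV
  obtain ⟨K, hK, hKV⟩ := exists_isOpen_addSubgroup_subset (p ^ n) (pow_pos hp n) hexp hVq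
  refine ⟨K.comap (QuotientAddGroup.mk' D), hK.preimage QuotientAddGroup.continuous_mk, ?_⟩
  intro x hx
  obtain ⟨v, hv, hvx⟩ := hKV hx
  have hd : -v + x ∈ D := QuotientAddGroup.eq.mp hvx
  have := hVU (show (v, -v + x) ∈ V ×ˢ V from ⟨hv, hDV hd⟩)
  simpa using this

/-- The quotient by an open ideal is finite, hence artinian, so its maximal ideal is nilpotent. -/
theorem exists_maximalIdeal_pow_subset {p : ℕ} (hp : 0 < p) (hpm : (p : A) ∈ maximalIdeal A)
    {U : Set A} (hU : U ∈ 𝓝 (0 : A)) : ∃ n : ℕ, ((maximalIdeal A ^ n : Ideal A) : Set A) ⊆ U := by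
  obtain ⟨J, hJ, hJU⟩ := exists_isOpen_ideal_subset hp hpm hU
  have : Finite (A ⧸ J) := AddSubgroup.quotient_finite_of_isOpen J.toAddSubgroup hJ
  obtain ⟨n, hn⟩ := exists_maximalIdeal_pow_le_of_isArtinianRing_quotient J
  exact ⟨n, fun x hx => hJU (hn hx)⟩

/-- Cosets of open ideals are clopen and separate points. This is what makes closed subgroups of `GL
(Fin 2) A` profinite. -/
theorem totallyDisconnectedSpace_of_compact {p : ℕ} (hp : 0 < p)
    (hpm : (p : A) ∈ maximalIdeal A) : TotallyDisconnectedSpace A := by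
  rw [totallyDisconnectedSpace_iff_connectedComponent_singleton]
  intro x
  refine Set.eq_singleton_iff_unique_mem.mpr ⟨mem_connectedComponent, fun y hy => ?_⟩
  by_contra hne
  have hU : {a : A | a ≠ y - x} ∈ 𝓝 (0 : A) :=
    isOpen_ne.mem_nhds (fun h => hne (by rw [eq_comm, sub_eq_zero] at h; exact h))
  obtain ⟨J, hJ, hJU⟩ := exists_isOpen_ideal_subset hp hpm hU
  have hJc : IsClosed (J : Set A) := J.toAddSubgroup.isClosed_of_isOpen hJ
  have hcl : IsClopen {a : A | a - x ∈ J} :=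
    ⟨hJc.preimage (by fun_prop : Continuous fun a : A => a - x),
      hJ.preimage (by fun_prop : Continuous fun a : A => a - x)⟩
  have := hcl.connectedComponent_subset (x := x) (by simp) hy
  exact hJU this rfl

end CompactLocalRing

/-! ### Square roots of elements congruent to 1 -/

section SquareRoot

open Filter Topology IsLocalRing

variable {A : Type*} [CommRing A] [IsLocalRing A]

/-- In xᵖ - 1 = (x - 1)(1 + x + ⋯ + xᵖ⁻¹) the second factor is congruent to p, so each p-th power
gains one power of the maximal ideal. -/
lemma one_add_pow_sub_one_mem {p : ℕ} (hpm : (p : A) ∈ maximalIdeal A) {u : A}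
    (hu : u ∈ maximalIdeal A) (n : ℕ) : (1 + u) ^ p ^ n - 1 ∈ maximalIdeal A ^ (n + 1) := by
  induction n with
  | zero => simpa using hu
  | succ n ih =>
    set x := (1 + u) ^ p ^ n with hx
    have hxm : x - 1 ∈ maximalIdeal A := Ideal.pow_le_self (Nat.succ_ne_zero n) ih
    have hs : ∑ i ∈ Finset.range p, x ^ i ∈ maximalIdeal A := by
      have : ∑ i ∈ Finset.range p, x ^ i = ∑ i ∈ Finset.range p, (x ^ i - 1) + p := by
        simp [Finset.sum_sub_distrib]
      rw [this]
      refine add_mem (sum_mem fun i _ => ?_) hpm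
      exact Ideal.mem_of_dvd _ (sub_one_dvd_pow_sub_one x i) hxm
    rw [pow_succ p n, pow_mul, ← hx, ← mul_geom_sum x p, pow_succ (maximalIdeal A) (n + 1)]
    exact Ideal.mul_mem_mul ih hs

variable [TopologicalSpace A] [IsTopologicalRing A] [CompactSpace A] [T2Space A]

lemma tendsto_of_mem_maximalIdeal_pow {p : ℕ} (hp : 0 < p) (hpm : (p : A) ∈ maximalIdeal A)
    {f : ℕ → A} (hf : ∀ n, f n ∈ maximalIdeal A ^ n) : Tendsto f atTop (𝓝 0) := by
  intro U hU
  obtain ⟨n, hn⟩ := exists_maximalIdeal_pow_subset hp hpm hU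
  exact mem_map.mpr (mem_of_superset (Ici_mem_atTop n) fun k hk => hn (Ideal.pow_le_pow_right hk (hf k)))

/-- The powers (1 + u)^((pⁿ + 1)/2) have squares tending to 1 + u. Any limit point is therefore a
square root, and being a limit of powers it stays in C. -/
lemma exists_sqrt_mem_of_isClosed {p : ℕ} (hp : 0 < p) (hodd : Odd p) (hpm : (p : A) ∈ maximalIdeal A)
    (C : Submonoid A) (hC : IsClosed (C : Set A)) {u : A} (hu : u ∈ maximalIdeal A)
    (huC : 1 + u ∈ C) : ∃ y ∈ C, y ^ 2 = 1 + u ∧ y - 1 ∈ maximalIdeal A := by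
  let 𝓤 : Ultrafilter ℕ := Ultrafilter.of atTop
  have h𝓤 : (𝓤 : Filter ℕ) ≤ atTop := Ultrafilter.of_le _
  let f : ℕ → A := fun n => (1 + u) ^ ((p ^ n + 1) / 2)
  obtain ⟨y, -, hy⟩ := isCompact_univ.ultrafilter_le_nhds (𝓤.map f) (by simp)
  have hy : Tendsto f 𝓤 (𝓝 y) := hy
  refine ⟨y, hC.mem_of_tendsto hy (Eventually.of_forall fun n => pow_mem huC _), ?_, ?_⟩
  · have h1 : Tendsto (fun n => f n ^ 2) 𝓤 (𝓝 (y ^ 2)) := hy.pow 2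
    have h2 : Tendsto (fun n => (1 + u) ^ p ^ n) atTop (𝓝 1) := by
      have := (tendsto_of_mem_maximalIdeal_pow hp hpm (f := fun n => (1 + u) ^ p ^ n - 1)
        fun n => Ideal.pow_le_pow_right (Nat.le_succ n) (one_add_pow_sub_one_mem hpm hu n)).add_const 1
      simpa using this
    have h3 : Tendsto (fun n => f n ^ 2) 𝓤 (𝓝 (1 * (1 + u))) := by
      refine ((h2.mono_left h𝓤).mul_const (1 + u)).congr fun n => ?_
      rw [← pow_succ, ← pow_mul, Nat.div_mul_cancel]
      exact even_iff_two_dvd.mp (Odd.add_one (hodd.pow))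
    rw [one_mul] at h3
    exact tendsto_nhds_unique h1 h3
  · refine isClosed_maximalIdeal_of_compact.mem_of_tendsto (hy.sub_const 1)
      (Eventually.of_forall fun n => ?_)
    exact Ideal.mem_of_dvd _ (sub_one_dvd_pow_sub_one _ _) (by simpa using hu)

omit [TopologicalSpace A] [IsTopologicalRing A] [CompactSpace A] [T2Space A] in
-- x + y is congruent to 2, hence a unit.
lemma eq_of_sq_eq_sq (h2 : IsUnit (2 : A)) {x y : A} (h : x ^ 2 = y ^ 2)
    (hx : x - 1 ∈ maximalIdeal A) (hy : y - 1 ∈ maximalIdeal A) : x = y := by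
  have hu : IsUnit (x + y) := by
    by_contra hn
    have : (2 : A) ∈ maximalIdeal A := by
      have := sub_mem hn (add_mem hx hy)
      convert this using 1
      ring
    exact this h2
  have : (x + y) * (x - y) = 0 := by linear_combination h
  exact sub_eq_zero.mp (hu.mul_right_eq_zero.mp this)

end SquareRoot

/-! ### Scalars that preserve closed additive subgroups -/

section ClosedSubgroups

open Filter Topology IsLocalRing

variable {A : Type*} [CommRing A] [IsLocalRing A] [TopologicalSpace A] [IsTopologicalRing A]
  [CompactSpace A] [T2Space A]
  {M : Type*} [AddCommGroup M] [Module A M] [TopologicalSpace M] [ContinuousSMul A M]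

/-- 1/2 is the limit of the integers (pⁿ + 1)/2. -/
lemma half_smul_mem {p : ℕ} (hp : 0 < p) (hodd : Odd p) (hpm : (p : A) ∈ maximalIdeal A)
    {h : A} (hh : 2 * h = 1) {X : AddSubgroup M} (hX : IsClosed (X : Set M)) {x : M} (hx : x ∈ X) :
    h • x ∈ X := by
  have h0 : Tendsto (fun n => (p : A) ^ n) atTop (𝓝 0) :=
    tendsto_of_mem_maximalIdeal_pow hp hpm fun n => Ideal.pow_mem_pow hpm n
  have h1 : Tendsto (fun n => (h * ((p : A) ^ n + 1)) • x) atTop (𝓝 ((h * (0 + 1)) • x)) :=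
    ((h0.add_const 1).const_mul h).smul_const x
  rw [zero_add, mul_one] at h1
  refine hX.mem_of_tendsto h1 (Eventually.of_forall fun n => ?_)
  have h2 : h * ((p : A) ^ n + 1) = (((p ^ n + 1) / 2 : ℕ) : A) := by
    have h3 : (2 * ((p ^ n + 1) / 2) : ℕ) = p ^ n + 1 :=
      Nat.mul_div_cancel' (even_iff_two_dvd.mp (Odd.add_one hodd.pow))
    have h4 := congrArg (Nat.cast : ℕ → A) h3
    push_cast at h4
    rw [← h4]
    linear_combination (((p ^ n + 1) / 2 : ℕ) : A) * hh
  rw [h2, Nat.cast_smul_eq_nsmul]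
  exact nsmul_mem hx _

/-- A closed additive subgroup stable under multiplication by Teichmüller representatives is
stable under multiplication by all Witt vectors. -/
lemma smul_mem_of_teichmuller {p : ℕ} [Fact p.Prime] (hpm : (p : A) ∈ maximalIdeal A)
    {k : Type*} [Field k] [Finite k] [CharP k p] (φ : WittVector p k →+* A) {X : AddSubgroup M}
    (hX : IsClosed (X : Set M))
    (h : ∀ x : k, ∀ m ∈ X, φ (WittVector.teichmuller p x) • m ∈ X) (w : WittVector p k)
    {m : M} (hm : m ∈ X) : φ w • m ∈ X := by
  -- Modulo pⁿ⁺¹, w is a sum of powers of p times Teichmüller representatives, and pⁿ⁺¹ tends to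
  -- zero in A.
  choose z hz using WittVector.dvd_sub_sum_teichmuller_iterateFrobeniusEquiv_coeff w
  have h0 : Tendsto (fun n => φ w - (p : A) ^ (n + 1) * φ (z n)) atTop (𝓝 (φ w - 0)) := by
    refine Tendsto.const_sub _ (tendsto_of_mem_maximalIdeal_pow (Fact.out : p.Prime).pos hpm
      fun n => Ideal.mul_mem_right _ _ (Ideal.pow_le_pow_right (Nat.le_succ n) (Ideal.pow_mem_pow hpm _)))
  rw [sub_zero] at h0
  refine hX.mem_of_tendsto (h0.smul_const m) (Eventually.of_forall fun n => ?_)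
  have h1 := congrArg φ (hz n)
  rw [map_sub, map_mul, map_pow, map_natCast, map_sum, sub_eq_iff_eq_add', ← sub_eq_iff_eq_add] at h1
  rw [h1, Finset.sum_smul]
  refine sum_mem fun i _ => ?_
  rw [map_mul, mul_comm, mul_smul, map_pow, map_natCast, ← Nat.cast_pow, Nat.cast_smul_eq_nsmul]
  exact nsmul_mem (h _ m hm) _

end ClosedSubgroups

/-- If closed additive subgroups stable under the (finite) monoid `T` are stable under `R`, then the
`R`-span of a closed additive subgroup is closed. -/
lemma isClosed_span_of_isClosed {M R k : Type*} [AddCommGroup M] [TopologicalSpace M]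
    [IsTopologicalAddGroup M] [CompactSpace M] [T2Space M] [CommRing R] [Module R M]
    [Monoid k] [Finite k] (T : k →* R) (hc : ∀ x, Continuous fun m : M => T x • m)
    (hT : ∀ X : AddSubgroup M, IsClosed (X : Set M) → (∀ x, ∀ m ∈ X, T x • m ∈ X) →
      ∀ r : R, ∀ m ∈ X, r • m ∈ X) {X : AddSubgroup M} (hX : IsClosed (X : Set M)) :
    IsClosed (Submodule.span R (X : Set M) : Set M) := by
  classical
  have := Fintype.ofFinite k
  -- The span turns out to be the range of `f`, a finite sum of the compact sets T x • X.
  let f : (k → X) →+ M :=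
    { toFun := fun g => ∑ x, T x • (g x : M)
      map_zero' := by simp
      map_add' := fun g h => by simp [Finset.sum_add_distrib] }
  have hf : Continuous f := continuous_finsetSum _ fun x _ =>
    (hc x).comp (continuous_subtype_val.comp (continuous_apply x))
  have : CompactSpace X := isCompact_iff_compactSpace.mp hX.isCompact
  have hcl : IsClosed (f.range : Set M) := (isCompact_range hf).isClosed
  have hmem : ∀ x : k, ∀ m ∈ X, T x • m ∈ f.range := fun x m hm => by
    refine ⟨Pi.single x ⟨m, hm⟩, ?_⟩
    change ∑ y, T y • ((Pi.single x (⟨m, hm⟩ : X) : k → X) y : M) = _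
    rw [Finset.sum_eq_single x]
    · simp
    · intro y _ hy
      simp [Pi.single_eq_of_ne hy]
    · simp
  have hst : ∀ x : k, ∀ m ∈ f.range, T x • m ∈ f.range := by
    rintro x _ ⟨g, rfl⟩
    change T x • ∑ y, T y • (g y : M) ∈ _
    rw [Finset.smul_sum]
    refine sum_mem fun y _ => ?_
    rw [smul_smul, ← map_mul]
    exact hmem _ _ (g y).2
  let N : Submodule R M := { f.range with smul_mem' := fun r m hm => hT f.range hcl hst r m hm }
  have hN : Submodule.span R (X : Set M) = N := by
    refine le_antisymm (Submodule.span_le.mpr fun m hm => ?_) ?_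
    · have := hmem 1 m hm
      rwa [map_one, one_smul] at this
    · rintro _ ⟨g, rfl⟩
      exact sum_mem fun x _ => Submodule.smul_mem _ _ (Submodule.subset_span (g x).2)
  rw [hN]
  exact hcl

/-! ### Closed Witt submodules -/

section WittAlgebra

open Filter Topology IsLocalRing

variable {p : ℕ} [Fact p.Prime] {F A : Type*} [Field F] [Finite F] [CharP F p] [CommRing A]
  [IsLocalRing A] [TopologicalSpace A] [IsTopologicalRing A] [CompactSpace A] [T2Space A]
  [Algebra (WittVector p F) A]

/-- Through its coefficients W(F) is the compact space of sequences in F. The structure map is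
continuous on it, because agreement of the first n coefficients is congruence modulo pⁿ. -/
lemma isClosed_range_algebraMap_wittVector (hpm : (p : A) ∈ maximalIdeal A) :
    IsClosed (Set.range (algebraMap (WittVector p F) A)) := by
  let : TopologicalSpace F := ⊥
  have : DiscreteTopology F := ⟨rfl⟩
  have hcont : Continuous fun c : ℕ → F => algebraMap (WittVector p F) A (WittVector.mk p c) := by
    rw [continuous_iff_continuousAt]
    intro c U hU
    have hU' : {a | algebraMap (WittVector p F) A (WittVector.mk p c) + a ∈ U} ∈ 𝓝 (0 : A) := by
      have : ContinuousAt (fun a => algebraMap (WittVector p F) A (WittVector.mk p c) + a) 0 := by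
        fun_prop
      exact this (by simpa using hU)
    obtain ⟨n, hn⟩ := exists_maximalIdeal_pow_subset (Fact.out : p.Prime).pos hpm hU'
    have hev : ∀ᶠ c' in 𝓝 c, ∀ i < n, c' i = c i := by
      have : ∀ i ∈ Finset.range n, ∀ᶠ c' in 𝓝 c, c' i = c i := fun i _ =>
        (continuous_apply i).continuousAt.eventually
          ((isOpen_discrete ({c i} : Set F)).mem_nhds (Set.mem_singleton (c i)))
      filter_upwards [(Finset.eventually_all (Finset.range n)).mpr this] with c' hc' i hi
      exact hc' i (Finset.mem_range.mpr hi)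
    refine mem_map.mpr ?_
    filter_upwards [hev] with c' hc'
    have h1 : WittVector.mk p c' - WittVector.mk p c ∈ Ideal.span {((p : WittVector p F) ^ n)} := by
      rw [WittVector.mem_span_p_pow_iff_le_coeff_eq_zero]
      exact WittVector.le_coeff_eq_iff_le_sub_coeff_eq_zero.mp hc'
    obtain ⟨z, hz⟩ := Ideal.mem_span_singleton'.mp h1
    have h2 := hn (show algebraMap (WittVector p F) A (WittVector.mk p c' - WittVector.mk p c) ∈ _ by
      rw [← hz, map_mul, map_pow, map_natCast]
      exact Ideal.mul_mem_left _ _ (Ideal.pow_mem_pow hpm n))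
    simpa using h2
  have hr : Set.range (algebraMap (WittVector p F) A)
      = Set.range fun c : ℕ → F => algebraMap (WittVector p F) A (WittVector.mk p c) := by
    ext a
    constructor
    · rintro ⟨w, rfl⟩
      exact ⟨w.coeff, rfl⟩
    · rintro ⟨c, rfl⟩
      exact ⟨_, rfl⟩
  rw [hr]
  exact (isCompact_range hcont).isClosed

lemma isClosed_span_wittVector (hpm : (p : A) ∈ maximalIdeal A) {X : AddSubgroup A}
    (hX : IsClosed (X : Set A)) :
    IsClosed (Submodule.span (WittVector p F) (X : Set A) : Set A) := by
  refine isClosed_span_of_isClosed (WittVector.teichmuller p : F →* WittVector p F) (fun x => ?_)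
    (fun Y hY h r m hm => ?_) hX
  · simp only [Algebra.smul_def]
    fun_prop
  · rw [Algebra.smul_def]
    refine smul_mem_of_teichmuller hpm (algebraMap (WittVector p F) A) hY (fun x m hm => ?_) r hm
    have := h x m hm
    rwa [Algebra.smul_def] at this

omit [Finite F] [CharP F p] [IsLocalRing A] [TopologicalSpace A] [IsTopologicalRing A]
  [CompactSpace A] [T2Space A] in
lemma constLift_mem_wittSubring (k : Subfield F) (x : k) :
    constLift p (x : F) ∈ wittSubring p F A k :=
  ⟨WittVector.teichmuller p x, by
    simp [constLift, WittVector.map_teichmuller]⟩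

variable {M : Type*} [AddCommGroup M] [Module A M] [TopologicalSpace M] [ContinuousSMul A M]

lemma wittSubring_smul_mem (hpm : (p : A) ∈ maximalIdeal A) (k : Subfield F)
    {X : AddSubgroup M} (hX : IsClosed (X : Set M))
    (h : ∀ x ∈ k, ∀ m ∈ X, constLift p (x : F) (A := A) • m ∈ X) (r : wittSubring p F A k)
    {m : M} (hm : m ∈ X) : r • m ∈ X := by
  obtain ⟨_, w, rfl⟩ := r
  refine smul_mem_of_teichmuller hpm
    ((algebraMap (WittVector p F) A).comp (WittVector.map k.subtype)) hX (fun x m hm => ?_) w hm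
  have := h x x.2 m hm
  rwa [RingHom.comp_apply, WittVector.map_teichmuller]

lemma isClosed_span_wittSubring [IsTopologicalAddGroup M] [CompactSpace M] [T2Space M]
    (hpm : (p : A) ∈ maximalIdeal A) (k : Subfield F) {X : AddSubgroup M} (hX : IsClosed (X : Set M)) :
    IsClosed (Submodule.span (wittSubring p F A k) (X : Set M) : Set M) := by
  let T : k →* wittSubring p F A k :=
    { toFun := fun x => ⟨constLift p (x : F), constLift_mem_wittSubring k x⟩
      map_one' := Subtype.ext (by simp)
      map_mul' := fun x y => Subtype.ext (by simp) }
  refine isClosed_span_of_isClosed T (fun x => ?_) (fun Y hY h r m hm => ?_) hX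
  · exact continuous_const_smul (constLift p (x : F) : A)
  · exact wittSubring_smul_mem hpm k hY (fun x hx m hm => h ⟨x, hx⟩ m hm) r hm

end WittAlgebra

/-! ### The residue map and the Teichmüller section -/

section Residue

open IsLocalRing

variable {p : ℕ} [Fact p.Prime] {F A : Type*} [Field F] [CommRing A]
  [Algebra (WittVector p F) A] {res : A →+* F}

lemma res_constLift (hres : ∀ x : WittVector p F, res (algebraMap (WittVector p F) A x) = x.coeff 0)
    (x : F) : res (constLift p x) = x := by
  simp [constLift, hres, WittVector.teichmuller_coeff_zero]

variable [IsLocalRing A]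

lemma res_eq_zero_iff
    (hres : ∀ x : WittVector p F, res (algebraMap (WittVector p F) A x) = x.coeff 0) {a : A} :
    res a = 0 ↔ a ∈ maximalIdeal A := by
  have hs : Function.Surjective res := fun x => ⟨constLift p x, res_constLift hres x⟩
  have := RingHom.ker_isMaximal_of_surjective res hs
  rw [← RingHom.mem_ker, eq_maximalIdeal this]

lemma natCast_prime_mem_maximalIdeal [CharP F p]
    (hres : ∀ x : WittVector p F, res (algebraMap (WittVector p F) A x) = x.coeff 0) :
    (p : A) ∈ maximalIdeal A := by
  rw [← res_eq_zero_iff hres, map_natCast, CharP.cast_eq_zero]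

lemma isUnit_iff_res_ne_zero
    (hres : ∀ x : WittVector p F, res (algebraMap (WittVector p F) A x) = x.coeff 0) {a : A} :
    IsUnit a ↔ res a ≠ 0 := by
  rw [Ne, res_eq_zero_iff hres, mem_maximalIdeal, mem_nonunits_iff, not_not]

lemma isUnit_two_of_odd [CharP F p] (hp : p ≠ 2)
    (hres : ∀ x : WittVector p F, res (algebraMap (WittVector p F) A x) = x.coeff 0) :
    IsUnit (2 : A) := by
  rw [isUnit_iff_res_ne_zero hres, map_ofNat]
  exact Ring.two_ne_zero (by rwa [ringChar.eq F p])

end Residue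

/-! ### Stability properties of Pink's Lie algebra -/

section PinkAlgebra

open IsLocalRing

variable {A : Type*} [CommRing A]

lemma pinkTheta_add (x y : Matrix (Fin 2) (Fin 2) A) :
    pinkTheta (x + y) = pinkTheta x + pinkTheta y := by
  simp only [pinkTheta, Matrix.trace_add, mul_add, add_smul]
  abel

lemma pinkTheta_sub (x y : Matrix (Fin 2) (Fin 2) A) :
    pinkTheta (x - y) = pinkTheta x - pinkTheta y := by
  simp only [pinkTheta, Matrix.trace_sub, mul_sub, sub_smul]
  abel

lemma pinkTheta_smul (c : A) (x : Matrix (Fin 2) (Fin 2) A) :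
    pinkTheta (c • x) = c • pinkTheta x := by
  simp only [pinkTheta, Matrix.trace_smul, smul_sub, smul_smul, smul_eq_mul]
  congr 2
  ring

lemma pinkTheta_of_trace_eq_zero {x : Matrix (Fin 2) (Fin 2) A} (hx : x.trace = 0) :
    pinkTheta x = x := by
  simp [pinkTheta, hx]

lemma pinkTheta_mul_sub_mul (x y : Matrix (Fin 2) (Fin 2) A) :
    pinkTheta (x * y) - pinkTheta (y * x) = pinkTheta x * pinkTheta y - pinkTheta y * pinkTheta x := by
  rw [← pinkTheta_sub, pinkTheta_of_trace_eq_zero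
    (by rw [Matrix.trace_sub, Matrix.trace_mul_comm, sub_self])]
  simp only [pinkTheta, sub_mul, mul_sub, Matrix.smul_mul, Matrix.mul_smul, one_mul, mul_one]
  rw [smul_comm (Ring.inverse 2 * y.trace)]
  abel

lemma trace_one_fin_two : (1 : Matrix (Fin 2) (Fin 2) A).trace = 2 := by
  simp

lemma trace_pinkTheta (h2 : IsUnit (2 : A)) (x : Matrix (Fin 2) (Fin 2) A) :
    (pinkTheta x).trace = 0 := by
  rw [pinkTheta, Matrix.trace_sub, Matrix.trace_smul, trace_one_fin_two, smul_eq_mul,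
    mul_right_comm, Ring.inverse_mul_cancel _ h2, one_mul, sub_self]

/-- Reduces the scalars tr(xy), for x and y in the image of Θ, to traces of group elements. -/
lemma trace_pinkTheta_mul (h2 : IsUnit (2 : A)) (x y : Matrix (Fin 2) (Fin 2) A) :
    (pinkTheta x * pinkTheta y).trace = (x * y).trace - Ring.inverse 2 * (x.trace * y.trace) := by
  have h := Ring.inverse_mul_cancel _ h2
  simp only [pinkTheta, sub_mul, mul_sub, Matrix.smul_mul, Matrix.mul_smul, one_mul, mul_one,
    Matrix.trace_sub, Matrix.trace_smul, trace_one_fin_two, smul_eq_mul]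
  linear_combination (Ring.inverse 2 * x.trace * y.trace) * h

lemma add_inv_of_det_eq_one {g : GL (Fin 2) A} (hg : g.val.det = 1) :
    g.val + (g⁻¹).val = g.val.trace • (1 : Matrix (Fin 2) (Fin 2) A) := by
  have h : (g⁻¹).val = g.val.adjugate := by
    rw [Matrix.coe_units_inv, Matrix.inv_def, hg, Ring.inverse_one, one_smul]
  rw [h, Matrix.adjugate_fin_two]
  ext i j
  fin_cases i <;> fin_cases j <;> simp [Matrix.trace_fin_two, add_comm]

/-- Cayley–Hamilton for g makes a trace multiple a sum of two values of Θ; for x in the same group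
these are values at group elements. -/
lemma trace_smul_pinkTheta {g : GL (Fin 2) A} (hg : g.val.det = 1) (x : Matrix (Fin 2) (Fin 2) A) :
    g.val.trace • pinkTheta x = pinkTheta (g.val * x) + pinkTheta ((g⁻¹).val * x) := by
  rw [← pinkTheta_add, ← add_mul, add_inv_of_det_eq_one hg, Matrix.smul_mul, one_mul, pinkTheta_smul]

/-- The additive subgroups of `M₂(A)` closed under the operations under which Pink's Lie algebras
are closed. -/
structure PinkClosed (X : AddSubgroup (Matrix (Fin 2) (Fin 2) A)) : Prop where
  bracket : ∀ x ∈ X, ∀ y ∈ X, x * y - y * x ∈ X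
  triple : ∀ x ∈ X, ∀ y ∈ X, ∀ z ∈ X, (x * y).trace • z ∈ X
  half : ∀ x ∈ X, (Ring.inverse 2 : A) • x ∈ X

section

variable {X : AddSubgroup (Matrix (Fin 2) (Fin 2) A)}

lemma PinkClosed.diag_mul (hX : PinkClosed X) {b c : A} (hb : !![0, b; 0, 0] ∈ X)
    (hc : !![0, 0; c, 0] ∈ X) : !![b * c, 0; 0, -(b * c)] ∈ X := by
  convert hX.bracket _ hb _ hc using 1
  ext i j
  fin_cases i <;> fin_cases j <;> simp [mul_comm]

lemma PinkClosed.upper_mul (hX : PinkClosed X) (h2 : IsUnit (2 : A)) {a b : A}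
    (ha : !![a, 0; 0, -a] ∈ X) (hb : !![0, b; 0, 0] ∈ X) : !![0, a * b; 0, 0] ∈ X := by
  convert hX.half _ (hX.bracket _ ha _ hb) using 1
  have h := Ring.inverse_mul_cancel _ h2
  ext i j
  fin_cases i <;> fin_cases j <;> simp
  linear_combination (-(a * b)) * h

/-- The trace of diag(a, -a) diag(b, -b) is 2ab, whence the halving. -/
lemma PinkClosed.diag_triple (hX : PinkClosed X) (h2 : IsUnit (2 : A)) {a b c : A}
    (ha : !![a, 0; 0, -a] ∈ X) (hb : !![b, 0; 0, -b] ∈ X) (hc : !![c, 0; 0, -c] ∈ X) :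
    !![a * b * c, 0; 0, -(a * b * c)] ∈ X := by
  convert hX.half _ (hX.triple _ ha _ hb _ hc) using 1
  have h := Ring.inverse_mul_cancel _ h2
  ext i j
  fin_cases i <;> fin_cases j <;> simp [Matrix.trace_fin_two]
  · linear_combination (-(a * b * c)) * h
  · linear_combination (-(a * b * c)) * h

lemma PinkClosed.span (hX : PinkClosed X) (S : Subring A) :
    PinkClosed (Submodule.span S (X : Set (Matrix (Fin 2) (Fin 2) A))).toAddSubgroup := by
  refine ⟨fun x hx y hy => ?_, fun x hx y hy z hz => ?_, fun x hx => ?_⟩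
  · simp only [Submodule.mem_toAddSubgroup] at hx hy ⊢
    induction hx using Submodule.span_induction with
    | zero => simp
    | add u v _ _ hu hv =>
      convert add_mem hu hv using 1
      rw [add_mul, mul_add]
      abel
    | smul r u _ hu =>
      convert Submodule.smul_mem _ r hu using 1
      rw [Matrix.smul_mul, Matrix.mul_smul, smul_sub]
    | mem u hu =>
      induction hy using Submodule.span_induction with
      | zero => simp
      | add v w _ _ hv hw =>
        convert add_mem hv hw using 1
        rw [add_mul, mul_add]
        abel
      | smul r v _ hv =>
        convert Submodule.smul_mem _ r hv using 1
        rw [Matrix.smul_mul, Matrix.mul_smul, smul_sub]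
      | mem v hv => exact Submodule.subset_span (hX.bracket _ hu _ hv)
  · simp only [Submodule.mem_toAddSubgroup] at hx hy hz ⊢
    induction hx using Submodule.span_induction with
    | zero => simp
    | add u v _ _ hu hv => rw [add_mul, Matrix.trace_add, add_smul]; exact add_mem hu hv
    | smul r u _ hu =>
      rw [Matrix.smul_mul, Matrix.trace_smul, smul_assoc]
      exact Submodule.smul_mem _ r hu
    | mem u hu =>
      induction hy using Submodule.span_induction with
      | zero => simp
      | add v w _ _ hv hw => rw [mul_add, Matrix.trace_add, add_smul]; exact add_mem hv hw
      | smul r v _ hv =>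
        rw [Matrix.mul_smul, Matrix.trace_smul, smul_assoc]
        exact Submodule.smul_mem _ r hv
      | mem v hv =>
        induction hz using Submodule.span_induction with
        | zero => simp
        | add w t _ _ hw ht => rw [smul_add]; exact add_mem hw ht
        | smul r w _ hw => rw [smul_comm]; exact Submodule.smul_mem _ r hw
        | mem w hw => exact Submodule.subset_span (hX.triple _ hu _ hv _ hw)
  · simp only [Submodule.mem_toAddSubgroup] at hx ⊢
    induction hx using Submodule.span_induction with
    | zero => simp
    | add u v _ _ hu hv => rw [smul_add]; exact add_mem hu hv
    | smul r u _ hu => rw [smul_comm]; exact Submodule.smul_mem _ r hu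
    | mem u hu => exact Submodule.subset_span (hX.half _ hu)

end

section Topology

variable [TopologicalSpace A] [IsTopologicalRing A]

lemma closedMul_le {X Y Z : AddSubgroup A} (hZ : IsClosed (Z : Set A))
    (h : ∀ x ∈ X, ∀ y ∈ Y, x * y ∈ Z) : closedMul X Y ≤ Z := by
  refine AddSubgroup.topologicalClosure_minimal _ ((AddSubgroup.closure_le _).mpr ?_) hZ
  rintro _ ⟨x, hx, y, hy, rfl⟩
  exact h x hx y hy

lemma mul_mem_closedMul {X Y : AddSubgroup A} {x y : A} (hx : x ∈ X) (hy : y ∈ Y) :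
    x * y ∈ closedMul X Y :=
  AddSubgroup.le_topologicalClosure _ (AddSubgroup.subset_closure ⟨x, hx, y, hy, rfl⟩)

lemma closedMul_mul_mem {X Y Z T : AddSubgroup A} (hT : IsClosed (T : Set A))
    (h : ∀ x ∈ X, ∀ y ∈ Y, ∀ z ∈ Z, x * y * z ∈ T) :
    ∀ u ∈ closedMul X Y, ∀ z ∈ Z, u * z ∈ T := by
  intro u hu z hz
  have : closedMul X Y ≤ T.comap (AddMonoidHom.mulRight z) :=
    closedMul_le (hT.preimage (continuous_mul_const z)) fun x hx y hy => h x hx y hy z hz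
  exact this hu

lemma isClosed_closedMul (X Y : AddSubgroup A) : IsClosed (closedMul X Y : Set A) :=
  AddSubgroup.isClosed_topologicalClosure _

lemma isClosed_pinkLie (Γ : Subgroup (GL (Fin 2) A)) :
    IsClosed (pinkLie Γ : Set (Matrix (Fin 2) (Fin 2) A)) :=
  AddSubgroup.isClosed_topologicalClosure _

lemma pinkTheta_mem_pinkLie {Γ : Subgroup (GL (Fin 2) A)} {g : GL (Fin 2) A} (hg : g ∈ Γ) :
    pinkTheta g.val ∈ pinkLie Γ :=
  AddSubgroup.le_topologicalClosure _ (AddSubgroup.subset_closure ⟨g, hg, rfl⟩)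

lemma pinkLie_le {Γ : Subgroup (GL (Fin 2) A)} {X : AddSubgroup (Matrix (Fin 2) (Fin 2) A)}
    (hX : IsClosed (X : Set (Matrix (Fin 2) (Fin 2) A))) (h : ∀ g ∈ Γ, pinkTheta g.val ∈ X) :
    pinkLie Γ ≤ X := by
  refine AddSubgroup.topologicalClosure_minimal _ ((AddSubgroup.closure_le _).mpr ?_) hX
  rintro _ ⟨g, hg, rfl⟩
  exact h g hg

lemma pinkLie_le_comap {Γ : Subgroup (GL (Fin 2) A)} {X : AddSubgroup (Matrix (Fin 2) (Fin 2) A)}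
    (hX : IsClosed (X : Set (Matrix (Fin 2) (Fin 2) A)))
    (f : Matrix (Fin 2) (Fin 2) A →+ Matrix (Fin 2) (Fin 2) A) (hf : Continuous f)
    (h : ∀ g ∈ Γ, f (pinkTheta g.val) ∈ X) {x : Matrix (Fin 2) (Fin 2) A} (hx : x ∈ pinkLie Γ) :
    f x ∈ X :=
  pinkLie_le (X := X.comap f) (hX.preimage hf) h hx

variable [IsLocalRing A]

omit [TopologicalSpace A] [IsTopologicalRing A] in
lemma det_eq_one_of_mem_SR1 {g : GL (Fin 2) A} (hg : g ∈ SR1 A) : g.val.det = 1 := by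
  have := hg.1
  have h : Matrix.GeneralLinearGroup.det g = 1 := this
  simpa using congrArg Units.val h

/-- All operations are additive and continuous in each variable, so they need checking only on the
generators Θ(g). There they become identities between values of Θ at products of group elements. -/
theorem pinkClosed_pinkLie [CompactSpace A] [T2Space A] {p : ℕ} (hp : 0 < p) (hodd : Odd p)
    (hpm : (p : A) ∈ maximalIdeal A) (h2 : IsUnit (2 : A)) {Γ : Subgroup (GL (Fin 2) A)} (hΓ : Γ ≤ SR1 A) :
    PinkClosed (pinkLie Γ) := by
  have hcl := isClosed_pinkLie Γ
  have hhalf : ∀ x ∈ pinkLie Γ, (Ring.inverse 2 : A) • x ∈ pinkLie Γ := fun x hx =>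
    half_smul_mem hp hodd hpm (Ring.mul_inverse_cancel _ h2) hcl hx
  have htr : ∀ g ∈ Γ, ∀ x ∈ pinkLie Γ, g.val.trace • x ∈ pinkLie Γ := by
    intro g hg x hx
    refine pinkLie_le_comap hcl (DistribSMul.toAddMonoidHom _ g.val.trace)
      (continuous_const_smul g.val.trace) (fun k hk => ?_) hx
    rw [DistribSMul.toAddMonoidHom_apply, trace_smul_pinkTheta (det_eq_one_of_mem_SR1 (hΓ hg))]
    exact add_mem (pinkTheta_mem_pinkLie (mul_mem hg hk))
      (pinkTheta_mem_pinkLie (mul_mem (inv_mem hg) hk))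
  refine ⟨fun x hx y hy => ?_, fun x hx y hy z hz => ?_, hhalf⟩
  · refine pinkLie_le_comap hcl (AddMonoidHom.mulRight y - AddMonoidHom.mulLeft y)
      (by
        change Continuous fun x => x * y - y * x
        fun_prop) (fun g hg => ?_) hx
    refine pinkLie_le_comap hcl (AddMonoidHom.mulLeft (pinkTheta g.val) -
      AddMonoidHom.mulRight (pinkTheta g.val)) (by
        change Continuous fun x => pinkTheta g.val * x - x * pinkTheta g.val
        fun_prop) (fun k hk => ?_) hy
    change pinkTheta g.val * pinkTheta k.val - pinkTheta k.val * pinkTheta g.val ∈ _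
    rw [← pinkTheta_mul_sub_mul]
    exact sub_mem (pinkTheta_mem_pinkLie (mul_mem hg hk)) (pinkTheta_mem_pinkLie (mul_mem hk hg))
  · let f : Matrix (Fin 2) (Fin 2) A →+ Matrix (Fin 2) (Fin 2) A :=
      { toFun := fun x => (x * y).trace • z
        map_zero' := by simp
        map_add' := fun u v => by rw [add_mul, Matrix.trace_add, add_smul] }
    refine pinkLie_le_comap hcl f (by
        change Continuous fun x => (x * y).trace • z
        fun_prop) (fun g hg => ?_) hx
    let f' : Matrix (Fin 2) (Fin 2) A →+ Matrix (Fin 2) (Fin 2) A :=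
      { toFun := fun y => (pinkTheta g.val * y).trace • z
        map_zero' := by simp
        map_add' := fun u v => by rw [mul_add, Matrix.trace_add, add_smul] }
    refine pinkLie_le_comap hcl f' (by
        change Continuous fun y => (pinkTheta g.val * y).trace • z
        fun_prop) (fun k hk => ?_) hy
    change (pinkTheta g.val * pinkTheta k.val).trace • z ∈ _
    rw [trace_pinkTheta_mul h2, sub_smul, mul_smul, mul_smul]
    exact sub_mem (htr (g * k) (mul_mem hg hk) z hz) (hhalf _ (htr g hg _ (htr k hk z hz)))

end Topology

end PinkAlgebra

/-! ### Representations spanning the matrix algebra are governed by their trace -/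

section Spanning

variable {P k : Type*} [Group P] [Field k]

lemma trace_mul_eq_zero_of_span {r : P →* GL (Fin 2) k}
    (hr : Submodule.span k (Set.range fun g => (r g).val) = ⊤) {T : Matrix (Fin 2) (Fin 2) k}
    (hT : ∀ g, (T * (r g).val).trace = 0) : T = 0 := by
  have h : ∀ Y : Matrix (Fin 2) (Fin 2) k, (T * Y).trace = 0 := by
    intro Y
    have hY : Y ∈ Submodule.span k (Set.range fun g => (r g).val) := hr ▸ Submodule.mem_top
    induction hY using Submodule.span_induction with
    | mem x hx => obtain ⟨g, rfl⟩ := hx; exact hT g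
    | zero => simp
    | add x y _ _ hx hy => rw [mul_add, Matrix.trace_add, hx, hy, add_zero]
    | smul a x _ hx => rw [Matrix.mul_smul, Matrix.trace_smul, hx, smul_zero]
  exact Matrix.ext_iff_trace_mul_right.mpr fun Y => by rw [h, zero_mul, Matrix.trace_zero]

/-- Linear independence of finitely many r(xᵢ) is detected by the traces of r(xᵢ g), which are also
those of r'. So r' has as many independent values as r. -/
lemma span_eq_top_of_trace_eq {r r' : P →* GL (Fin 2) k}
    (hr : Submodule.span k (Set.range fun g => (r g).val) = ⊤)
    (htr : ∀ g, (r g).val.trace = (r' g).val.trace) :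
    Submodule.span k (Set.range fun g => (r' g).val) = ⊤ := by
  obtain ⟨f, hf, -, hli⟩ := Submodule.exists_fun_fin_finrank_span_eq k (Set.range fun g => (r g).val)
  choose x hx using hf
  have hli' : LinearIndependent k fun i => (r' (x i)).val := by
    rw [Fintype.linearIndependent_iff] at hli ⊢
    intro c hc
    refine hli c (trace_mul_eq_zero_of_span hr fun g => ?_)
    have h1 := congrArg (fun T => (T * (r' g).val).trace) hc
    simp only [zero_mul, Matrix.trace_zero, Finset.sum_mul, Matrix.trace_sum, Matrix.smul_mul,
      Matrix.trace_smul] at h1 ⊢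
    rw [← h1]
    refine Finset.sum_congr rfl fun i _ => ?_
    rw [← hx i, ← Units.val_mul, ← map_mul, htr, map_mul, Units.val_mul]
  have htop := hli'.span_eq_top_of_card_eq_finrank' (by rw [Fintype.card_fin, hr, finrank_top])
  rw [eq_top_iff, ← htop]
  exact Submodule.span_mono (by rintro _ ⟨i, rfl⟩; exact ⟨x i, rfl⟩)

/-- Commutation is tested by the nondegenerate trace form on the spanning values; the criterion thus
involves only the trace of r. -/
lemma mem_center_iff_trace {r : P →* GL (Fin 2) k}
    (hr : Submodule.span k (Set.range fun g => (r g).val) = ⊤) (g : P) :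
    r g ∈ Subgroup.center (GL (Fin 2) k) ↔
      ∀ x y, (r (g * x * y)).val.trace = (r (x * g * y)).val.trace := by
  constructor
  · intro h x y
    rw [map_mul, map_mul, map_mul, map_mul, (Subgroup.mem_center_iff.mp h (r x))]
  · intro h
    have hcomm : ∀ x, (r g).val * (r x).val - (r x).val * (r g).val = 0 := fun x =>
      trace_mul_eq_zero_of_span hr fun y => by
        have := h x y
        simp only [map_mul, Units.val_mul] at this
        rw [sub_mul, Matrix.trace_sub, this, sub_self]
    have hall : ∀ Y : Matrix (Fin 2) (Fin 2) k, Y * (r g).val = (r g).val * Y := by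
      intro Y
      have hY : Y ∈ Submodule.span k (Set.range fun g => (r g).val) := hr ▸ Submodule.mem_top
      induction hY using Submodule.span_induction with
      | mem x hx => obtain ⟨y, rfl⟩ := hx; exact (sub_eq_zero.mp (hcomm y)).symm
      | zero => simp
      | add x y _ _ hx hy => rw [add_mul, mul_add, hx, hy]
      | smul a x _ hx => rw [Matrix.smul_mul, Matrix.mul_smul, hx]
    exact Subgroup.mem_center_iff.mpr fun x => Units.ext (hall x.val)

/-- Both projective representations have the same kernel, since the trace determines which elements
are scalar. -/
lemma nonempty_projectiveImage_mulEquiv {r r' : P →* GL (Fin 2) k}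
    (hr : Submodule.span k (Set.range fun g => (r g).val) = ⊤)
    (htr : ∀ g, (r g).val.trace = (r' g).val.trace) :
    Nonempty (projectiveImage r ≃* projectiveImage r') := by
  have hr' := span_eq_top_of_trace_eq hr htr
  have hker : (Matrix.ProjGenLinGroup.mk.comp r).ker = (Matrix.ProjGenLinGroup.mk.comp r').ker := by
    ext g
    rw [MonoidHom.mem_ker, MonoidHom.mem_ker, MonoidHom.comp_apply, MonoidHom.comp_apply,
      Matrix.ProjGenLinGroup.mk_eq_one, Matrix.ProjGenLinGroup.mk_eq_one,
      mem_center_iff_trace hr, mem_center_iff_trace hr']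
    simp only [htr]
  exact ⟨(QuotientGroup.quotientKerEquivRange _).symm.trans
    ((QuotientGroup.quotientMulEquivOfEq hker).trans (QuotientGroup.quotientKerEquivRange _))⟩

lemma span_range_map_eq_top {A : Type*} [CommRing A] {res : A →+* k}
    (hs : Function.Surjective res) {ρ : P →* GL (Fin 2) A}
    (hρ : Submodule.span A (Set.range fun g => (ρ g).val) = ⊤) :
    Submodule.span k (Set.range fun g =>
      (((Matrix.GeneralLinearGroup.map res).comp ρ) g).val) = ⊤ := by
  rw [eq_top_iff]
  intro N _
  choose s hs using hs
  have hN : N = (N.map s).map res := by ext; simp [hs]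
  rw [hN]
  have hY : N.map s ∈ Submodule.span A (Set.range fun g => (ρ g).val) := hρ ▸ Submodule.mem_top
  generalize N.map s = Y at hY
  induction hY using Submodule.span_induction with
  | mem x hx => obtain ⟨g, rfl⟩ := hx; exact Submodule.subset_span ⟨g, rfl⟩
  | zero => simp
  | add x y _ _ hx hy =>
    rw [Matrix.map_add _ (map_add res)]
    exact add_mem hx hy
  | smul a x _ hx =>
    have : (a • x).map res = res a • x.map res := by ext; simp
    rw [this]
    exact Submodule.smul_mem _ _ hx

end Spanning

/-! ### Diagonal elements of a group with dihedral projective image -/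

section DihedralImage

variable {k : Type*} [Field k]

/-- The subgroup generated by a diagonal matrix and scalars. -/
def diagScalar (G : Subgroup (GL (Fin 2) k)) (h : GL (Fin 2) k) : Subgroup (GL (Fin 2) k) :=
  Subgroup.zpowers h ⊔ (Subgroup.center (GL (Fin 2) k) ⊓ G)

variable {G : Subgroup (GL (Fin 2) k)} {h : GL (Fin 2) k}

lemma diagScalar_le (hG : h ∈ G) : diagScalar G h ≤ G :=
  sup_le (by simpa using hG) inf_le_right

lemma exists_zpow_mul_of_mem_diagScalar {g : GL (Fin 2) k} (hg : g ∈ diagScalar G h) :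
    ∃ n : ℤ, ∃ z ∈ Subgroup.center (GL (Fin 2) k), h ^ n * z = g := by
  have : diagScalar G h ≤ Subgroup.zpowers h ⊔ Subgroup.center (GL (Fin 2) k) :=
    sup_le_sup_left inf_le_left _
  obtain ⟨x, hx, z, hz, hxz⟩ := Subgroup.mem_sup_of_normal_right.mp (this hg)
  obtain ⟨n, hn⟩ := Subgroup.mem_zpowers_iff.mp hx
  exact ⟨n, z, hz, by rw [hn, hxz]⟩

variable {lam mu : k}

lemma diag_zpow (h01 : h.val 0 1 = 0) (h10 : h.val 1 0 = 0) (n : ℕ) :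
    (h ^ n).val = !![h.val 0 0 ^ n, 0; 0, h.val 1 1 ^ n] := by
  have hh : h.val = !![h.val 0 0, 0; 0, h.val 1 1] := by
    ext i j; fin_cases i <;> fin_cases j <;> simp [h01, h10]
  induction n with
  | zero => ext i j; fin_cases i <;> fin_cases j <;> simp
  | succ n ih =>
    rw [pow_succ, Units.val_mul, ih]
    conv_lhs => rw [hh]
    ext i j; fin_cases i <;> fin_cases j <;> simp [pow_succ]

lemma diag_mem_center_iff (h01 : h.val 0 1 = 0) (h10 : h.val 1 0 = 0) :
    h ∈ Subgroup.center (GL (Fin 2) k) ↔ h.val 0 0 = h.val 1 1 := by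
  rw [Matrix.GeneralLinearGroup.center_eq_range_scalar]
  constructor
  · rintro ⟨u, rfl⟩
    simp
  · intro he
    have hne : h.val 0 0 ≠ 0 := by
      have := Matrix.GeneralLinearGroup.det_ne_zero h
      rw [Matrix.det_fin_two, h01] at this
      intro h0
      simp [h0] at this
    refine ⟨Units.mk0 _ hne, Units.ext ?_⟩
    ext i j; fin_cases i <;> fin_cases j <;> simp [h01, h10, he]

/-- The class of h generates a subgroup of index 2 in a group of order 2m, so it has order m. A
power of h is scalar exactly when the same power of lam / mu is 1. -/
theorem orderOf_div_eq (hG : h ∈ G)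
    (h01 : h.val 0 1 = 0) (h10 : h.val 1 0 = 0) (h00 : h.val 0 0 = lam) (h11 : h.val 1 1 = mu)
    (hidx : (diagScalar G h).relIndex G = 2) {m : ℕ}
    (e : (G.map Matrix.ProjGenLinGroup.mk : Subgroup PGL(2, k)) ≃* DihedralGroup m) :
    orderOf (lam / mu) = m := by
  have hmu : mu ≠ 0 := by
    have := Matrix.GeneralLinearGroup.det_ne_zero h
    rw [Matrix.det_fin_two, h01, h11] at this
    intro h0
    simp [h0] at this
  set mkk : GL (Fin 2) k →* PGL(2, k) := Matrix.ProjGenLinGroup.mk with hmkk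
  have h1 : (Subgroup.zpowers (mkk h)).relIndex (G.map mkk) = 2 := by
    rw [← Subgroup.relIndex_comap, ← Subgroup.inf_relIndex_right]
    convert hidx using 2
    ext g
    constructor
    · rintro ⟨⟨n, hn⟩, hgG⟩
      have hn' : mkk (h ^ n) = mkk g := by rw [map_zpow]; exact hn
      obtain ⟨z, hz, hzg⟩ := Matrix.ProjGenLinGroup.mk_eq_mk_iff'.mp hn'
      rw [← hzg]
      refine mul_mem (Subgroup.mem_sup_left ⟨n, rfl⟩) (Subgroup.mem_sup_right ⟨hz, ?_⟩)
      have : z = (h ^ n)⁻¹ * g := by rw [← hzg]; group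
      rw [this]
      exact G.mul_mem (G.inv_mem (G.zpow_mem hG n)) hgG
    · intro hg
      refine ⟨?_, diagScalar_le hG hg⟩
      obtain ⟨n, z, hz, rfl⟩ := exists_zpow_mul_of_mem_diagScalar hg
      refine ⟨n, ?_⟩
      change mkk h ^ n = mkk (h ^ n * z)
      rw [map_mul, map_zpow, Matrix.ProjGenLinGroup.mk_eq_one.mpr hz, mul_one]
  have h2 : Nat.card (Subgroup.zpowers (mkk h)) * 2 = 2 * m := by
    have h3 := Subgroup.relIndex_mul_relIndex ⊥ (Subgroup.zpowers (mkk h)) (G.map mkk) bot_le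
      (by rw [Subgroup.zpowers_le]; exact Subgroup.mem_map_of_mem _ hG)
    rw [h1, Subgroup.relIndex_bot_left, Subgroup.relIndex_bot_left, Nat.card_congr e.toEquiv,
      DihedralGroup.nat_card] at h3
    exact h3
  rw [Nat.card_zpowers] at h2
  have h3 : orderOf (mkk h) = m := by omega
  rw [← h3]
  refine orderOf_eq_orderOf_iff.mpr fun n => ?_
  rw [← map_pow, Matrix.ProjGenLinGroup.mk_eq_one, diag_mem_center_iff, div_pow,
    div_eq_one_iff_eq (pow_ne_zero _ hmu)] <;> simp [diag_zpow h01 h10, h00, h11]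

lemma not_commutative_of_dihedral {m : ℕ} (hm : 2 * m > 4)
    (e : (G.map Matrix.ProjGenLinGroup.mk : Subgroup PGL(2, k)) ≃* DihedralGroup m) :
    ¬ ∀ x ∈ G, ∀ y ∈ G, x * y = y * x := by
  intro hc
  refine DihedralGroup.not_commutative (n := m) (by omega) (by omega) ⟨⟨fun a b => ?_⟩⟩
  obtain ⟨⟨_, x, hx, rfl⟩, rfl⟩ := e.surjective a
  obtain ⟨⟨_, y, hy, rfl⟩, rfl⟩ := e.surjective b
  rw [← map_mul, ← map_mul]
  congr 1
  refine Subtype.ext ?_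
  change Matrix.ProjGenLinGroup.mk x * Matrix.ProjGenLinGroup.mk y =
    Matrix.ProjGenLinGroup.mk y * Matrix.ProjGenLinGroup.mk x
  rw [← map_mul, hc x hx y hy, map_mul]

end DihedralImage

/-! ### Scalar and trace-zero parts -/

section Decomposition

open IsLocalRing

variable {A : Type*} [CommRing A]

/-- The scalar part of a matrix. -/
def halfTrace (x : Matrix (Fin 2) (Fin 2) A) : A := Ring.inverse 2 * x.trace

lemma apply_one_one_of_trace_eq_zero {x : Matrix (Fin 2) (Fin 2) A} (hx : x.trace = 0) :
    x 1 1 = -x 0 0 := by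
  rw [Matrix.trace_fin_two] at hx
  linear_combination hx

lemma apply_zero_zero_eq (x : Matrix (Fin 2) (Fin 2) A) :
    x 0 0 = halfTrace x + pinkTheta x 0 0 := by
  simp [halfTrace, pinkTheta]

lemma apply_one_one_eq (h2 : IsUnit (2 : A)) (x : Matrix (Fin 2) (Fin 2) A) :
    x 1 1 = halfTrace x - pinkTheta x 0 0 := by
  have h := apply_one_one_of_trace_eq_zero (trace_pinkTheta h2 x)
  rw [sub_eq_add_neg, ← h]
  simp [halfTrace, pinkTheta]

lemma pinkTheta_apply_zero_one (x : Matrix (Fin 2) (Fin 2) A) : pinkTheta x 0 1 = x 0 1 := by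
  simp [pinkTheta]

lemma pinkTheta_apply_one_zero (x : Matrix (Fin 2) (Fin 2) A) : pinkTheta x 1 0 = x 1 0 := by
  simp [pinkTheta]

/-- Together with uniqueness of square roots, this recovers an element of `SR1 A` from its image
under Θ. -/
lemma halfTrace_sq (h2 : IsUnit (2 : A)) {x : Matrix (Fin 2) (Fin 2) A} (hx : x.det = 1) :
    halfTrace x ^ 2 = 1 + (pinkTheta x 0 0 ^ 2 + pinkTheta x 0 1 * pinkTheta x 1 0) := by
  rw [Matrix.det_fin_two, apply_zero_zero_eq x, apply_one_one_eq h2 x] at hx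
  rw [pinkTheta_apply_zero_one, pinkTheta_apply_one_zero]
  linear_combination hx

lemma pinkTheta_conj {g x : Matrix (Fin 2) (Fin 2) A} {g' : Matrix (Fin 2) (Fin 2) A}
    (h : g' * g = 1) : pinkTheta (g * x * g') = g * pinkTheta x * g' := by
  have h' : g * g' = 1 := mul_eq_one_comm.mp h
  have ht : (g * x * g').trace = x.trace := by
    rw [Matrix.trace_mul_comm, ← mul_assoc, h, one_mul]
  rw [pinkTheta, pinkTheta, ht, mul_sub, sub_mul, Matrix.mul_smul, mul_one, Matrix.smul_mul, h']

section Local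

variable [IsLocalRing A]

lemma apply_sub_one_mem {g : GL (Fin 2) A} (hg : g ∈ SR1 A) (i j : Fin 2) :
    g.val i j - (1 : Matrix (Fin 2) (Fin 2) A) i j ∈ maximalIdeal A := by
  have h : Matrix.GeneralLinearGroup.map (residue A) g = 1 := hg.2
  have h1 : residue A (g.val i j) = (1 : Matrix (Fin 2) (Fin 2) (ResidueField A)) i j :=
    congrArg (fun u : GL (Fin 2) (ResidueField A) => u.val i j) h
  rw [← residue_eq_zero_iff, map_sub, h1]
  fin_cases i <;> fin_cases j <;> simp

lemma halfTrace_sub_one_mem (h2 : IsUnit (2 : A)) {g : GL (Fin 2) A} (hg : g ∈ SR1 A) :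
    halfTrace g.val - 1 ∈ maximalIdeal A := by
  have h0 := apply_sub_one_mem hg 0 0
  have h1 := apply_sub_one_mem hg 1 1
  rw [Matrix.one_apply_eq] at h0 h1
  have := Ideal.mul_mem_left _ (Ring.inverse 2) (add_mem h0 h1)
  convert this using 1
  rw [halfTrace, Matrix.trace_fin_two]
  linear_combination Ring.inverse_mul_cancel _ h2

lemma pinkTheta_apply_mem (h2 : IsUnit (2 : A)) {g : GL (Fin 2) A} (hg : g ∈ SR1 A) (i j : Fin 2) :
    pinkTheta g.val i j ∈ maximalIdeal A := by
  have h := sub_mem (apply_sub_one_mem hg i j)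
    (Ideal.mul_mem_right ((1 : Matrix (Fin 2) (Fin 2) A) i j) _ (halfTrace_sub_one_mem h2 hg))
  convert h using 1
  rw [pinkTheta, Matrix.sub_apply, Matrix.smul_apply, halfTrace, smul_eq_mul]
  ring

lemma SR1_conj_mem {g : GL (Fin 2) A} (hg : g ∈ SR1 A) (x : GL (Fin 2) A) :
    x * g * x⁻¹ ∈ SR1 A :=
  ⟨(inferInstance : (Matrix.GeneralLinearGroup.det.ker : Subgroup (GL (Fin 2) A)).Normal).conj_mem _ hg.1 _,
    (inferInstance : ((Matrix.GeneralLinearGroup.map (residue A)).ker :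
      Subgroup (GL (Fin 2) A)).Normal).conj_mem _ hg.2 _⟩

variable [TopologicalSpace A] [IsTopologicalRing A]

omit [IsLocalRing A] in
lemma conj_mem_pinkLie {Γ : Subgroup (GL (Fin 2) A)} {g : GL (Fin 2) A}
    (hg : ∀ x ∈ Γ, g * x * g⁻¹ ∈ Γ) {x y : Matrix (Fin 2) (Fin 2) A} (hx : x ∈ pinkLie Γ)
    (hy : y * g.val = g.val * x) : y ∈ pinkLie Γ := by
  have hy' : y = g.val * x * (g⁻¹).val := by
    rw [← hy, mul_assoc, ← Units.val_mul, mul_inv_cancel, Units.val_one, mul_one]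
  rw [hy']
  let f : Matrix (Fin 2) (Fin 2) A →+ Matrix (Fin 2) (Fin 2) A :=
    (AddMonoidHom.mulRight (g⁻¹).val).comp (AddMonoidHom.mulLeft g.val)
  refine pinkLie_le_comap (isClosed_pinkLie Γ) f (by
    change Continuous fun x => g.val * x * (g⁻¹).val
    fun_prop) (fun k hk => ?_) hx
  change g.val * pinkTheta k.val * (g⁻¹).val ∈ _
  rw [← pinkTheta_conj (by rw [← Units.val_mul, inv_mul_cancel, Units.val_one]),
    ← Units.val_mul, ← Units.val_mul]
  exact pinkTheta_mem_pinkLie (hg k hk)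

end Local

end Decomposition

/-! ### The subring generated by I and B -/

section StructureRing

variable {A : Type*} [CommRing A] [TopologicalSpace A] [IsTopologicalRing A]

/-- The sum `W 1 + W I + W I² + W B` is a subring if `B² ⊆ I`, `I B ⊆ B` and `I³ ⊆ I`. -/
def structureSubalgebra (W : Type*) [CommRing W] [Algebra W A] (I B : AddSubgroup A)
    (hBB : closedMul B B ≤ I) (hIB : closedMul I B ≤ B)
    (hIII : closedMul (closedMul I I) I ≤ I) (hB : IsClosed (B : Set A)) : Subalgebra W A :=
  Submodule.toSubalgebra (Submodule.span W {(1 : A)} ⊔ Submodule.span W (I : Set A) ⊔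
    Submodule.span W (closedMul I I : Set A) ⊔ Submodule.span W (B : Set A))
    (Submodule.mem_sup_left (Submodule.mem_sup_left (Submodule.mem_sup_left
      (Submodule.subset_span rfl)))) <| by
    simp only [← Submodule.span_union]
    -- The union of 1, I, I² and B is already multiplicatively closed: I³ ⊆ I gives I²I² ⊆ I², and
    -- IB ⊆ B gives I²B ⊆ B.
    have key : ∀ x ∈ ({(1 : A)} ∪ (I : Set A) ∪ (closedMul I I : Set A) ∪ (B : Set A)),
        ∀ y ∈ ({(1 : A)} ∪ (I : Set A) ∪ (closedMul I I : Set A) ∪ (B : Set A)),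
        x * y ∈ ({(1 : A)} ∪ (I : Set A) ∪ (closedMul I I : Set A) ∪ (B : Set A)) := by
      have h1 : ∀ x ∈ I, ∀ y ∈ I, x * y ∈ closedMul I I := fun x hx y hy => mul_mem_closedMul hx hy
      have h2 : ∀ x ∈ closedMul I I, ∀ y ∈ I, x * y ∈ I := fun x hx y hy =>
        hIII (mul_mem_closedMul hx hy)
      have h3 : ∀ x ∈ closedMul I I, ∀ y ∈ closedMul I I, x * y ∈ closedMul I I := by
        intro x hx y hy
        rw [mul_comm]
        refine closedMul_mul_mem (Z := closedMul I I) (isClosed_closedMul I I)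
          (fun a ha b hb c hc => ?_) y hy x hx
        rw [mul_assoc, mul_comm b]
        exact h1 _ ha _ (h2 _ hc _ hb)
      have h4 : ∀ x ∈ I, ∀ y ∈ B, x * y ∈ B := fun x hx y hy => hIB (mul_mem_closedMul hx hy)
      have h5 : ∀ x ∈ closedMul I I, ∀ y ∈ B, x * y ∈ B :=
        closedMul_mul_mem hB fun a ha b hb c hc => by
          rw [mul_assoc]
          exact h4 _ ha _ (h4 _ hb _ hc)
      have h6 : ∀ x ∈ B, ∀ y ∈ B, x * y ∈ I := fun x hx y hy => hBB (mul_mem_closedMul hx hy)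
      rintro x (((rfl | hx) | hx) | hx) y (((rfl | hy) | hy) | hy)
      · exact Or.inl (Or.inl (Or.inl (one_mul _)))
      · rw [one_mul]; exact Or.inl (Or.inl (Or.inr hy))
      · rw [one_mul]; exact Or.inl (Or.inr hy)
      · rw [one_mul]; exact Or.inr hy
      · rw [mul_one]; exact Or.inl (Or.inl (Or.inr hx))
      · exact Or.inl (Or.inr (h1 x hx y hy))
      · rw [mul_comm]; exact Or.inl (Or.inl (Or.inr (h2 y hy x hx)))
      · exact Or.inr (h4 x hx y hy)
      · rw [mul_one]; exact Or.inl (Or.inr hx)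
      · exact Or.inl (Or.inl (Or.inr (h2 x hx y hy)))
      · exact Or.inl (Or.inr (h3 x hx y hy))
      · exact Or.inr (h5 x hx y hy)
      · rw [mul_one]; exact Or.inr hx
      · rw [mul_comm]; exact Or.inr (h4 y hy x hx)
      · rw [mul_comm]; exact Or.inr (h5 y hy x hx)
      · exact Or.inl (Or.inl (Or.inr (h6 x hx y hy)))
    intro x y hx hy
    have := Submodule.mul_mem_mul hx hy
    rw [Submodule.span_mul_span] at this
    refine Submodule.span_mono ?_ this
    rintro _ ⟨a, ha, b, hb, rfl⟩
    exact key a ha b hb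

lemma isClosed_sup_submodule {W M : Type*} [CommRing W] [AddCommGroup M] [Module W M]
    [TopologicalSpace M] [IsTopologicalAddGroup M] [CompactSpace M] [T2Space M]
    {X Y : Submodule W M} (hX : IsClosed (X : Set M)) (hY : IsClosed (Y : Set M)) :
    IsClosed ((X ⊔ Y : Submodule W M) : Set M) := by
  rw [Submodule.coe_sup]
  exact (hX.isCompact.add hY.isCompact).isClosed

lemma isClosed_structureSubalgebra {p : ℕ} [Fact p.Prime] {F : Type*} [Field F] [Finite F] [CharP F p]
    [Algebra (WittVector p F) A] [IsLocalRing A] [CompactSpace A] [T2Space A]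
    (hpm : (p : A) ∈ IsLocalRing.maximalIdeal A) (I B : AddSubgroup A)
    (hI : IsClosed (I : Set A)) (hB : IsClosed (B : Set A)) (hBB hIB hIII) :
    IsClosed (structureSubalgebra (WittVector p F) I B hBB hIB hIII hB : Set A) := by
  refine isClosed_sup_submodule (isClosed_sup_submodule (isClosed_sup_submodule ?_ ?_) ?_) ?_
  · convert isClosed_range_algebraMap_wittVector (F := F) hpm
    ext a
    simp [Submodule.mem_span_singleton, Algebra.smul_def]
  · exact isClosed_span_wittVector hpm hI
  · exact isClosed_span_wittVector hpm (isClosed_closedMul I I)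
  · exact isClosed_span_wittVector hpm hB

end StructureRing

/-! ### Splitting into diagonal, upper and lower components -/

section Assembly

open IsLocalRing

variable {p : ℕ} [Fact p.Prime] {F A : Type*} [Field F] [CommRing A] [Algebra (WittVector p F) A]
  {res : A →+* F}

/-- A Witt vector over k with nonzero residue is a unit, so the divisions needed for the splitting
stay inside W(k). -/
lemma exists_inv_mem_wittSubring [CharP F p]
    (hres : ∀ x : WittVector p F, res (algebraMap (WittVector p F) A x) = x.coeff 0)
    (k : Subfield F) {a : A} (ha : a ∈ wittSubring p F A k) (h0 : res a ≠ 0) :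
    ∃ b ∈ wittSubring p F A k, b * a = 1 := by
  obtain ⟨w, rfl⟩ := ha
  have hw : w.coeff 0 ≠ 0 := by
    intro h
    rw [RingHom.comp_apply, hres, WittVector.map_coeff, h, map_zero] at h0
    exact h0 rfl
  obtain ⟨u, rfl⟩ := WittVector.isUnit_of_coeff_zero_ne_zero w hw
  refine ⟨_, ⟨(u⁻¹ : (WittVector p k)ˣ), rfl⟩, ?_⟩
  rw [← map_mul, Units.inv_mul, map_one]

/-- The linear map `a ↦ diag(a, -a)`. -/
def diagMap (R A : Type*) [CommRing R] [CommRing A] [Algebra R A] :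
    A →ₗ[R] Matrix (Fin 2) (Fin 2) A where
  toFun a := !![a, 0; 0, -a]
  map_add' a b := by ext i j; fin_cases i <;> fin_cases j <;> simp [add_comm]
  map_smul' r a := by ext i j; fin_cases i <;> fin_cases j <;> simp

/-- The linear map sending `b` to the matrix with upper right entry `b`. -/
def upperMap (R A : Type*) [CommRing R] [CommRing A] [Algebra R A] :
    A →ₗ[R] Matrix (Fin 2) (Fin 2) A where
  toFun b := !![0, b; 0, 0]
  map_add' a b := by ext i j; fin_cases i <;> fin_cases j <;> simp
  map_smul' r a := by ext i j; fin_cases i <;> fin_cases j <;> simp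

/-- A subgroup stable under `S`, a conjugation of ratio `ξ` with `ξ² ≠ 1` and an antidiagonal
conjugation decomposes. -/
theorem exists_eq_traceZero_of_conj {S : Subring A} (X : Submodule S (Matrix (Fin 2) (Fin 2) A))
    (htr : ∀ x ∈ X, x.trace = 0)
    {ξ ξ' : A} (hξS : ξ ∈ S) (hξ'S : ξ' ∈ S) (hξξ' : ξ * ξ' = 1)
    {e : A} (heS : e ∈ S) (he : e * ((ξ - ξ') * (ξ - 1)) = 1)
    {α β : A} (hα : ξ * β = α) (hconj : ∀ x ∈ X, ∀ y, y * !![α, 0; 0, β] = !![α, 0; 0, β] * x → y ∈ X)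
    {b c r r' : A} (hrS : r ∈ S) (hr'S : r' ∈ S) (hrr' : r * r' = 1) (hr : r * c = b)
    (hanti : ∀ x ∈ X, ∀ y, y * !![0, b; c, 0] = !![0, b; c, 0] * x → y ∈ X) :
    (X : Set (Matrix (Fin 2) (Fin 2) A)) =
      traceZero (X.comap (diagMap S A)) (X.comap (upperMap S A)) ∧
    ∀ u : A, !![0, 0; u, 0] ∈ X ↔ !![0, u; 0, 0] ∈ X := by
  have hsm : ∀ s ∈ S, ∀ x ∈ X, s • x ∈ X := fun s hs x hx => X.smul_mem (⟨s, hs⟩ : S) hx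
  -- Conjugation by diag(α, β), an operator T with eigenvalues 1, ξ and ξ'.
  have hT : ∀ x ∈ X, !![x 0 0, ξ * x 0 1; ξ' * x 1 0, x 1 1] ∈ X := by
    intro x hx
    refine hconj x hx _ ?_
    rw [← hα]
    ext i j; fin_cases i <;> fin_cases j <;> simp [Matrix.mul_apply, Fin.sum_univ_two]
    · ring
    · ring
    · linear_combination (β * x 1 0) * hξξ'
    · ring
  -- Spectral projections: T - 1 kills the diagonal, then T - ξ' keeps only the upper entry and T -
  -- ξ only the lower one. The factors `e` and `e * ξ` invert the resulting scalars.
  have hup : ∀ x ∈ X, !![0, x 0 1; 0, 0] ∈ X ∧ !![0, 0; x 1 0, 0] ∈ X := by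
    intro x hx
    have hy := sub_mem (hT x hx) hx
    set y := !![x 0 0, ξ * x 0 1; ξ' * x 1 0, x 1 1] - x with hydef
    have y00 : y 0 0 = 0 := by simp [hydef]
    have y11 : y 1 1 = 0 := by simp [hydef]
    have y01 : y 0 1 = (ξ - 1) * x 0 1 := by simp [hydef]; ring
    have y10 : y 1 0 = (ξ' - 1) * x 1 0 := by simp [hydef]; ring
    have hTy := hT y hy
    constructor
    · convert hsm e heS _ (sub_mem hTy (hsm ξ' hξ'S y hy)) using 1
      ext i j; fin_cases i <;> fin_cases j <;> simp [y00, y11, y01]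
      linear_combination (-(x 0 1)) * he
    · convert hsm (e * ξ) (mul_mem heS hξS) _ (sub_mem hTy (hsm ξ hξS y hy)) using 1
      ext i j; fin_cases i <;> fin_cases j <;> simp [y00, y11, y10]
      linear_combination (-(x 1 0)) * he + (x 1 0 * e * (ξ - ξ')) * hξξ'
  have hlow : ∀ u : A, !![0, 0; u, 0] ∈ X ↔ !![0, u; 0, 0] ∈ X := by
    intro u
    constructor
    · intro hu
      have h1 : !![0, r * u; 0, 0] ∈ X := by
        refine hanti _ hu _ ?_
        ext i j; fin_cases i <;> fin_cases j <;> simp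
        linear_combination u * hr
      convert hsm r' hr'S _ h1 using 1
      ext i j; fin_cases i <;> fin_cases j <;> simp
      linear_combination (-u) * hrr'
    · intro hu
      have h1 : !![0, 0; r' * u, 0] ∈ X := by
        refine hanti _ hu _ ?_
        ext i j; fin_cases i <;> fin_cases j <;> simp
        rw [← hr]
        linear_combination (u * c) * hrr'
      convert hsm r hrS _ h1 using 1
      ext i j; fin_cases i <;> fin_cases j <;> simp
      linear_combination (-u) * hrr'
  refine ⟨?_, hlow⟩
  ext x
  constructor
  · intro hx
    have h11 := apply_one_one_of_trace_eq_zero (htr x hx)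
    obtain ⟨h1, h2⟩ := hup x hx
    have h3 : !![x 0 0, 0; 0, -x 0 0] ∈ X := by
      convert sub_mem (sub_mem hx h1) h2 using 1
      ext i j; fin_cases i <;> fin_cases j <;> simp [h11]
    refine ⟨htr x hx, h3, ?_, h1, (hlow _).mp h2⟩
    rw [h11]
    exact neg_mem (show x 0 0 ∈ X.comap (diagMap S A) from h3)
  · rintro ⟨ht, h1, -, h3, h4⟩
    have h11 := apply_one_one_of_trace_eq_zero ht
    have h1' : !![x 0 0, 0; 0, -x 0 0] ∈ X := h1
    have h4' := (hlow _).mpr h4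
    change x ∈ X
    convert add_mem (add_mem h1' (show !![0, x 0 1; 0, 0] ∈ X from h3)) h4' using 1
    ext i j; fin_cases i <;> fin_cases j <;> simp [h11]

end Assembly

/-! ### Roots of unity in subfields; entries of elements of the Lie algebra -/

section Structure

open IsLocalRing

/-- The units of k already exhaust the at most |k| - 1 roots of unity of this order in F. -/
lemma mem_subfield_of_pow_card_sub_one_eq_one {F : Type*} [Field F] [Finite F] (k : Subfield F) {x : F}
    (hx : x ^ (Nat.card k - 1) = 1) : x ∈ k := by
  classical
  have := Fintype.ofFinite k
  have hq : 0 < Nat.card k - 1 := Nat.sub_pos_of_lt Finite.one_lt_card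
  let S : Finset F := Finset.univ.image fun u : kˣ => ((u : k) : F)
  let T : Finset F := (Polynomial.nthRoots (Nat.card k - 1) (1 : F)).toFinset
  have hST : S ⊆ T := by
    intro y hy
    obtain ⟨u, -, rfl⟩ := Finset.mem_image.mp hy
    rw [Multiset.mem_toFinset, Polynomial.mem_nthRoots hq, Nat.card_eq_fintype_card]
    have := FiniteField.pow_card_sub_one_eq_one (u : k) u.ne_zero
    exact_mod_cast congrArg (Subtype.val) this
  have hS : S.card = Nat.card k - 1 := by
    rw [Finset.card_image_of_injective, Finset.card_univ, ← Nat.card_eq_fintype_card, Nat.card_units]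
    exact Subtype.val_injective.comp Units.val_injective
  have hT : T.card ≤ Nat.card k - 1 :=
    (Multiset.toFinset_card_le _).trans (Polynomial.card_nthRoots _ _)
  have hxT : x ∈ T := by
    rw [Multiset.mem_toFinset, Polynomial.mem_nthRoots hq, hx]
  rw [← Finset.eq_of_subset_of_card_le hST (hT.trans hS.ge)] at hxT
  obtain ⟨u, -, rfl⟩ := Finset.mem_image.mp hxT
  exact (u : k).2

/-- The intersection of a subfield with the powers of an element of order `m`. -/
lemma exists_pow_mem_subfield {F : Type*} [Field F] [Finite F] {x : F} {m : ℕ} (hm : 0 < m)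
    (hx : orderOf x = m) (k : Subfield F) (hk : 2 < Nat.gcd m (Nat.card k - 1)) :
    ∃ n : ℕ, x ^ n ∈ k ∧ (x ^ n) ^ 2 ≠ 1 := by
  have hd : Nat.gcd m (Nat.card k - 1) ∣ m := Nat.gcd_dvd_left _ _
  have ho := orderOf_pow_orderOf_div (x := x) (n := Nat.gcd m (Nat.card k - 1))
    (by rw [hx]; exact hm.ne') (by rw [hx]; exact hd)
  -- The chosen power has order exactly the gcd: it divides |k| - 1, which puts the power in k, and
  -- exceeds 2, so the square is not 1.
  refine ⟨orderOf x / Nat.gcd m (Nat.card k - 1),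
    mem_subfield_of_pow_card_sub_one_eq_one k (orderOf_dvd_iff_pow_eq_one.mp ?_),
    fun h => ?_⟩
  · rw [ho]; exact Nat.gcd_dvd_right _ _
  · have h2 := orderOf_dvd_iff_pow_eq_one.mpr h
    rw [ho] at h2
    exact absurd (Nat.le_of_dvd two_pos h2) (by omega)


section

variable {A : Type*} [CommRing A] [IsLocalRing A] [TopologicalSpace A] [IsTopologicalRing A]

lemma isClosed_setOf_trace_eq_zero [T2Space A] [CompactSpace A] :
    IsClosed {x : Matrix (Fin 2) (Fin 2) A | x.trace = 0 ∧ ∀ i j, x i j ∈ maximalIdeal A} := by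
  have h : {x : Matrix (Fin 2) (Fin 2) A | x.trace = 0 ∧ ∀ i j, x i j ∈ maximalIdeal A} =
      {x | x.trace = 0} ∩ ⋂ i, ⋂ j, (fun x : Matrix (Fin 2) (Fin 2) A => x i j) ⁻¹'
        (maximalIdeal A : Set A) := by
    ext x
    simp
  rw [h]
  refine (isClosed_eq (by fun_prop) continuous_const).inter ?_
  refine isClosed_iInter fun i => isClosed_iInter fun j => ?_
  exact isClosed_maximalIdeal_of_compact.preimage (by fun_prop : Continuous
    fun x : Matrix (Fin 2) (Fin 2) A => x i j)

lemma trace_eq_zero_and_mem_of_mem_pinkLie [T2Space A] [CompactSpace A] (h2 : IsUnit (2 : A))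
    {Γ : Subgroup (GL (Fin 2) A)} (hΓ : Γ ≤ SR1 A) {x : Matrix (Fin 2) (Fin 2) A}
    (hx : x ∈ pinkLie Γ) : x.trace = 0 ∧ ∀ i j, x i j ∈ maximalIdeal A := by
  let Z : AddSubgroup (Matrix (Fin 2) (Fin 2) A) :=
    { carrier := {x | x.trace = 0 ∧ ∀ i j, x i j ∈ maximalIdeal A}
      add_mem' := fun {x y} hx hy =>
        ⟨by rw [Matrix.trace_add, hx.1, hy.1, add_zero], fun i j => add_mem (hx.2 i j) (hy.2 i j)⟩
      zero_mem' := ⟨by simp, fun i j => by simp⟩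
      neg_mem' := fun {x} hx =>
        ⟨by rw [Matrix.trace_neg, hx.1, neg_zero], fun i j => neg_mem (hx.2 i j)⟩ }
  exact pinkLie_le (X := Z) isClosed_setOf_trace_eq_zero
    (fun g hg => ⟨trace_pinkTheta h2 _, pinkTheta_apply_mem h2 (hΓ hg)⟩) hx

omit [IsLocalRing A] in
lemma conj_mem_span_pinkLie {Γ : Subgroup (GL (Fin 2) A)} (S : Subring A) {g : GL (Fin 2) A}
    (hg : ∀ x ∈ Γ, g * x * g⁻¹ ∈ Γ) {x y : Matrix (Fin 2) (Fin 2) A}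
    (hx : x ∈ Submodule.span S (pinkLie Γ : Set (Matrix (Fin 2) (Fin 2) A)))
    (hy : y * g.val = g.val * x) :
    y ∈ Submodule.span S (pinkLie Γ : Set (Matrix (Fin 2) (Fin 2) A)) := by
  have hy' : y = g.val * x * (g⁻¹).val := by
    rw [← hy, mul_assoc, ← Units.val_mul, mul_inv_cancel, Units.val_one, mul_one]
  rw [hy']
  clear hy hy'
  induction hx using Submodule.span_induction with
  | mem x hx =>
    refine Submodule.subset_span (conj_mem_pinkLie hg hx ?_)
    rw [mul_assoc, ← Units.val_mul, inv_mul_cancel, Units.val_one, mul_one]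
  | zero => simp
  | add x z _ _ hx hz => rw [mul_add, add_mul]; exact add_mem hx hz
  | smul r x _ hx => rw [Matrix.mul_smul, Matrix.smul_mul]; exact Submodule.smul_mem _ r hx

end

/-- The trace of an element of `GL₂(A)` in terms of a constant matrix and an element of
`SR¹` with entries in `C`. -/
lemma trace_constLift_mul_mem {p : ℕ} [Fact p.Prime] {F A : Type*} [Field F] [CommRing A]
    [Algebra (WittVector p F) A] (C : Subalgebra (WittVector p F) A) (h2 : IsUnit (2 : A))
    {h : Matrix (Fin 2) (Fin 2) F}
    {x : Matrix (Fin 2) (Fin 2) A}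
    (hs : halfTrace x ∈ C) (hx : ∀ i j, pinkTheta x i j ∈ C) :
    (h.map (constLift p (A := A)) * x).trace ∈ C := by
  have hτ : ∀ y : F, constLift p (A := A) y ∈ C := fun y => C.algebraMap_mem _
  rw [Matrix.trace_fin_two, Matrix.mul_apply, Matrix.mul_apply, Fin.sum_univ_two, Fin.sum_univ_two]
  simp only [Matrix.map_apply]
  rw [apply_zero_zero_eq x, apply_one_one_eq h2 x, ← pinkTheta_apply_zero_one x,
    ← pinkTheta_apply_one_zero x]
  exact add_mem (add_mem (mul_mem (hτ _) (add_mem hs (hx 0 0))) (mul_mem (hτ _) (hx 1 0)))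
    (add_mem (mul_mem (hτ _) (hx 0 1)) (mul_mem (hτ _) (sub_mem hs (hx 0 0))))

end Structure

/-! ### The structure theorem -/

section StructureTheorem

open IsLocalRing

variable {p : ℕ} [Fact p.Prime] {F A : Type*} [Field F] [Finite F] [CharP F p] [CommRing A]
  [IsLocalRing A] [TopologicalSpace A] [IsTopologicalRing A] [CompactSpace A] [T2Space A]
  [Algebra (WittVector p F) A] {res : A →+* F}
  {P : Type*} [Group P] [TopologicalSpace P] {ρbar : P →* GL (Fin 2) F} {t : P → A} {d : P →* A}
  {ρ : P →* GL (Fin 2) A}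

omit [Finite F] [CharP F p] [TopologicalSpace A] [IsTopologicalRing A] [CompactSpace A] [T2Space A] in
lemma mem_SR1_of_map_eq_one
    (hres : ∀ x : WittVector p F, res (algebraMap (WittVector p F) A x) = x.coeff 0)
    {g : GL (Fin 2) A} (hdet : g.val.det = 1) (hg : Matrix.GeneralLinearGroup.map res g = 1) :
    g ∈ SR1 A := by
  refine ⟨?_, ?_⟩
  · exact Units.ext hdet
  · refine Units.ext ?_
    ext i j
    have h : res (g.val i j) = (1 : Matrix (Fin 2) (Fin 2) F) i j :=
      congrArg (fun u : GL (Fin 2) F => u.val i j) hg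
    have h' : residue A (g.val i j) = (1 : Matrix (Fin 2) (Fin 2) (ResidueField A)) i j := by
      have h1 : g.val i j - (1 : Matrix (Fin 2) (Fin 2) A) i j ∈ maximalIdeal A := by
        rw [← res_eq_zero_iff hres, map_sub, h]
        fin_cases i <;> fin_cases j <;> simp
      rw [← residue_eq_zero_iff, map_sub, sub_eq_zero] at h1
      rw [h1]
      fin_cases i <;> fin_cases j <;> simp
    exact h'

-- ρ(g) is a constant matrix times some γ reducing to 1. Determinants are Teichmüller lifts, so det
-- γ, having residue 1, equals 1. The half-trace of γ is a square root of an element of C, and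
-- closedness of C puts it in C.
omit [Finite F] [TopologicalSpace P] in
lemma trace_mem_structureSubalgebra (hp : p ≠ 2)
    (hres : ∀ x : WittVector p F, res (algebraMap (WittVector p F) A x) = x.coeff 0)
    (hconst : ∀ g, ∃ x : F, d g = constLift p x) (hdet : ∀ g, (ρ g).val.det = d g)
    (hmem : ∀ x ∈ residualImage res ρ, ∃ g : P, (ρ g).val = x.val.map (constLift p (A := A)))
    (C : Subalgebra (WittVector p F) A) (hC : IsClosed (C : Set A))
    (hL : ∀ x ∈ lieAlg ρ, ∀ i j, x i j ∈ C) (g : P) : (ρ g).val.trace ∈ C := by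
  have hpm := natCast_prime_mem_maximalIdeal hres
  have h2 : IsUnit (2 : A) := isUnit_two_of_odd hp hres
  have hodd : Odd p := (Fact.out : p.Prime).odd_of_ne_two hp
  obtain ⟨g', hg'⟩ := hmem (Matrix.GeneralLinearGroup.map res (ρ g)) ⟨g, rfl⟩
  have hmap : Matrix.GeneralLinearGroup.map res (ρ g') = Matrix.GeneralLinearGroup.map res (ρ g) := by
    refine Units.ext ?_
    ext i j
    change res ((ρ g').val i j) = res ((ρ g).val i j)
    rw [hg']
    exact res_constLift hres _
  have hmap1 : Matrix.GeneralLinearGroup.map res (ρ (g'⁻¹ * g)) = 1 := by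
    rw [map_mul, map_mul, map_inv, map_inv, hmap, inv_mul_cancel]
  have hdet1 : (ρ (g'⁻¹ * g)).val.det = 1 := by
    obtain ⟨x, hx⟩ := hconst (g'⁻¹ * g)
    have h1 : res (ρ (g'⁻¹ * g)).val.det = 1 := by
      rw [RingHom.map_det]
      exact (congrArg (fun u : GL (Fin 2) F => u.val.det) hmap1).trans Matrix.det_one
    rw [hdet, hx, res_constLift hres] at h1
    rw [hdet, hx, h1, map_one]
  have hSR := mem_SR1_of_map_eq_one hres hdet1 hmap1
  have hΘ : pinkTheta (ρ (g'⁻¹ * g)).val ∈ lieAlg ρ := pinkTheta_mem_pinkLie ⟨⟨_, rfl⟩, hSR⟩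
  have hC' := hL _ hΘ
  have hs : halfTrace (ρ (g'⁻¹ * g)).val ∈ C := by
    set x := (ρ (g'⁻¹ * g)).val with hx
    have hu : pinkTheta x 0 0 ^ 2 + pinkTheta x 0 1 * pinkTheta x 1 0 ∈ maximalIdeal A :=
      add_mem (Ideal.pow_mem_of_mem _ (pinkTheta_apply_mem h2 hSR 0 0) 2 two_pos)
        (Ideal.mul_mem_left _ _ (pinkTheta_apply_mem h2 hSR 1 0))
    obtain ⟨y, hyC, hy2, hy1⟩ := exists_sqrt_mem_of_isClosed (Fact.out : p.Prime).pos hodd hpm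
      C.toSubmonoid hC hu
      (show _ ∈ C from
        add_mem (one_mem C) (add_mem (pow_mem (hC' 0 0) 2) (mul_mem (hC' 0 1) (hC' 1 0))))
    rw [← halfTrace_sq h2 hdet1] at hy2
    rw [← eq_of_sq_eq_sq h2 hy2 hy1 (halfTrace_sub_one_mem h2 hSR)]
    exact hyC
  have hg : (ρ g).val = (ρ g').val * (ρ (g'⁻¹ * g)).val := by
    rw [← Units.val_mul, ← map_mul, mul_inv_cancel_left]
  rw [hg, hg']
  exact trace_constLift_mul_mem C h2 hs hC'

/-- The structure of the Lie algebra of a well adapted representation. -/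
theorem exists_lieAlg_eq_traceZero (hp : p ≠ 2)
    (hres : ∀ x : WittVector p F, res (algebraMap (WittVector p F) A x) = x.coeff 0)
    (hps : IsConstDetPseudoDeformation p res ρbar t d) {m : ℕ} (hm : 2 * m > 4)
    (he : Nonempty (projectiveImage ρbar ≃* DihedralGroup m)) (hρ : IsTDRepresentation t d ρ)
    (hw : IsWellAdapted p res ρ) :
    2 < Nat.gcd m (Nat.card F - 1) ∧
      ∀ Fq : Subfield F, 2 < Nat.gcd m (Nat.card Fq - 1) →
        ∃ I B : Submodule (wittSubring p F A Fq) A,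
          IsClosed (I : Set A) ∧ IsClosed (B : Set A) ∧
          (I : Set A) ⊆ IsLocalRing.maximalIdeal A ∧ (B : Set A) ⊆ IsLocalRing.maximalIdeal A ∧
          (Submodule.span (wittSubring p F A Fq) (lieAlg ρ : Set (Matrix (Fin 2) (Fin 2) A)) :
            Set (Matrix (Fin 2) (Fin 2) A)) = traceZero I B ∧
          StructureConditions (WittVector p F) I.toAddSubgroup B.toAddSubgroup := by
  have hpm := natCast_prime_mem_maximalIdeal hres
  have h2 : IsUnit (2 : A) := isUnit_two_of_odd hp hres
  have hodd : Odd p := (Fact.out : p.Prime).odd_of_ne_two hp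
  have hp0 : 0 < p := (Fact.out : p.Prime).pos
  have hsurj : Function.Surjective res := fun x => ⟨constLift p x, res_constLift hres x⟩
  set r : P →* GL (Fin 2) F := (Matrix.GeneralLinearGroup.map res).comp ρ with hr
  obtain ⟨τ, hτ⟩ : ∃ τ : F →* A, τ = constLift p := ⟨_, rfl⟩
  have hτ0 : τ 0 = 0 := by rw [hτ]; simp [constLift]
  have htr : ∀ g, (r g).val.trace = (ρbar g).val.trace := by
    intro g
    rw [← hps.residual_trace, ← hρ.trace_eq, Matrix.trace_fin_two, Matrix.trace_fin_two, map_add]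
    rfl
  -- The reduction of ρ and `ρbar` are only known to share their trace; this is enough to transport
  -- the dihedral hypothesis.
  obtain ⟨e1⟩ := nonempty_projectiveImage_mulEquiv (span_range_map_eq_top hsurj hρ.span_eq) htr
  obtain ⟨e2⟩ := he
  have hmapmk : (residualImage res ρ).map Matrix.ProjGenLinGroup.mk = projectiveImage r :=
    MonoidHom.map_range _ _
  have e : (((residualImage res ρ).map Matrix.ProjGenLinGroup.mk : Subgroup PGL(2, F)))
      ≃* DihedralGroup m := ((MulEquiv.subgroupCongr hmapmk).trans e1).trans e2
  obtain ⟨g₀, lam, mu, ⟨hne, h01, h10, h00, h11⟩, hidx⟩ := hw.adapted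
  set h := Matrix.GeneralLinearGroup.map res (ρ g₀) with hh
  have hhG : h ∈ residualImage res ρ := ⟨g₀, rfl⟩
  have hh01 : h.val 0 1 = 0 := by change res ((ρ g₀).val 0 1) = 0; rw [h01, map_zero]
  have hh10 : h.val 1 0 = 0 := by change res ((ρ g₀).val 1 0) = 0; rw [h10, map_zero]
  have hord : orderOf (lam / mu) = m := orderOf_div_eq hhG hh01 hh10 h00 h11 hidx e
  have hdeth := Matrix.GeneralLinearGroup.det_ne_zero h
  rw [Matrix.det_fin_two, hh01, show h.val 0 0 = lam from h00, show h.val 1 1 = mu from h11,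
    zero_mul, sub_zero] at hdeth
  have hmu : mu ≠ 0 := right_ne_zero_of_mul hdeth
  have hlam : lam ≠ 0 := left_ne_zero_of_mul hdeth
  refine ⟨?_, fun Fq hFq => ?_⟩
  -- lam / mu has order m in the multiplicative group of F, so the gcd is m itself.
  · have hdvd : m ∣ Nat.card F - 1 := by
      rw [← hord]
      refine orderOf_dvd_of_pow_eq_one ?_
      have := Fintype.ofFinite F
      rw [Nat.card_eq_fintype_card]
      exact FiniteField.pow_card_sub_one_eq_one _ (div_ne_zero hlam hmu)
    rw [Nat.gcd_eq_left hdvd]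
    omega
  -- A power of h is used instead of h so that the ratio of the diagonal entries lies in `Fq`.
  obtain ⟨n, hξ, hξ2⟩ := exists_pow_mem_subfield (by omega) hord Fq hFq
  set ξ := (lam / mu) ^ n with hξdef
  have hξ0 : ξ ≠ 0 := pow_ne_zero _ (div_ne_zero hlam hmu)
  obtain ⟨g₁, hg₁⟩ := hw.const_mem (h ^ n) (pow_mem hhG n)
  obtain ⟨x, hxG, hx00, hx11, hxbc⟩ := hw.antidiagonal (not_commutative_of_dihedral hm e)
  obtain ⟨g₂, hg₂⟩ := hw.const_mem x hxG
  set S := wittSubring p F A Fq with hS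
  set Γ := ρ.range ⊓ SR1 A with hΓ
  set X := Submodule.span S (lieAlg ρ : Set (Matrix (Fin 2) (Fin 2) A)) with hX
  have hτS : ∀ y ∈ Fq, τ y ∈ S := fun y hy => hτ ▸ constLift_mem_wittSubring Fq ⟨y, hy⟩
  have hconj : ∀ g, ∀ x ∈ X, ∀ y, y * (ρ g).val = (ρ g).val * x → y ∈ X := by
    intro g x hx y hy
    refine conj_mem_span_pinkLie S (g := ρ g) (fun z hz => Subgroup.mem_inf.mpr ⟨?_,
      SR1_conj_mem hz.2 _⟩) hx hy
    exact ρ.range.mul_mem (ρ.range.mul_mem ⟨g, rfl⟩ hz.1) (ρ.range.inv_mem ⟨g, rfl⟩)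
  have hXm : ∀ x ∈ X, x.trace = 0 ∧ ∀ i j, x i j ∈ maximalIdeal A := by
    intro x hx
    induction hx using Submodule.span_induction with
    | mem x hx => exact trace_eq_zero_and_mem_of_mem_pinkLie h2 inf_le_right hx
    | zero => simp
    | add x y _ _ hx hy =>
      exact ⟨by rw [Matrix.trace_add, hx.1, hy.1, add_zero], fun i j => add_mem (hx.2 i j) (hy.2 i j)⟩
    | smul s x _ hx =>
      refine ⟨by rw [Matrix.trace_smul, hx.1, smul_zero], fun i j => ?_⟩
      exact Ideal.mul_mem_left _ (s : A) (hx.2 i j)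
  have : CompactSpace (Matrix (Fin 2) (Fin 2) A) :=
    inferInstanceAs (CompactSpace (Fin 2 → Fin 2 → A))
  have hXc : IsClosed (X : Set (Matrix (Fin 2) (Fin 2) A)) :=
    isClosed_span_wittSubring hpm Fq (isClosed_pinkLie Γ)
  have hbc0 : x.val 0 1 ≠ 0 ∧ x.val 1 0 ≠ 0 := by
    have := Matrix.GeneralLinearGroup.det_ne_zero x
    rw [Matrix.det_fin_two, hx00, zero_mul, zero_sub, neg_ne_zero] at this
    exact ⟨left_ne_zero_of_mul this, right_ne_zero_of_mul this⟩
  -- Both factors have nonzero residue because ξ² ≠ 1.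
  obtain ⟨u, huS, hu⟩ := exists_inv_mem_wittSubring hres Fq (a := (τ ξ - τ ξ⁻¹) * (τ ξ - 1))
    (mul_mem (sub_mem (hτS _ hξ) (hτS _ (inv_mem hξ))) (sub_mem (hτS _ hξ) (one_mem _))) (by
      rw [map_mul, map_sub, map_sub, map_one, hτ, res_constLift hres, res_constLift hres]
      refine mul_ne_zero (fun h0 => hξ2 ?_) (fun h0 => hξ2 ?_)
      · rw [sub_eq_zero] at h0
        rw [sq]
        nth_rewrite 2 [h0]
        exact mul_inv_cancel₀ hξ0
      · rw [sub_eq_zero.mp h0, one_pow])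
  obtain ⟨hXeq, hlow⟩ := exists_eq_traceZero_of_conj X (fun x hx => (hXm x hx).1)
    (ξ := τ ξ) (ξ' := τ ξ⁻¹) (hτS _ hξ) (hτS _ (inv_mem hξ))
    (by rw [← map_mul, mul_inv_cancel₀ hξ0, map_one]) huS hu
    (α := τ (lam ^ n)) (β := τ (mu ^ n))
    (by rw [← map_mul, hξdef, div_pow, div_mul_cancel₀ _ (pow_ne_zero _ hmu)])
    (fun x hx y hy => hconj g₁ x hx y (by
      rw [hg₁, ← hτ, diag_zpow hh01 hh10, show h.val 0 0 = lam from h00, show h.val 1 1 = mu from h11]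
      convert hy using 2 <;>
      · ext i j; fin_cases i <;> fin_cases j <;> simp [hτ0]))
    (b := τ (x.val 0 1)) (c := τ (x.val 1 0)) (r := τ (x.val 0 1 * (x.val 1 0)⁻¹))
    (r' := τ (x.val 0 1 * (x.val 1 0)⁻¹)⁻¹) (hτS _ ((bot_le : (⊥ : Subfield F) ≤ Fq) hxbc))
    (hτS _ (inv_mem ((bot_le : (⊥ : Subfield F) ≤ Fq) hxbc)))
    (by rw [← map_mul, mul_inv_cancel₀ (mul_ne_zero hbc0.1 (inv_ne_zero hbc0.2)), map_one])
    (by rw [← map_mul, inv_mul_cancel_right₀ hbc0.2])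
    (fun z hz y hy => hconj g₂ z hz y (by
      rw [hg₂, ← hτ]
      convert hy using 2 <;>
      · ext i j; fin_cases i <;> fin_cases j <;> simp [hτ0, hx00, hx11]))
  have hPink : PinkClosed X.toAddSubgroup :=
    (pinkClosed_pinkLie hp0 hodd hpm h2 inf_le_right).span S
  have hIc : IsClosed ((X.comap (diagMap S A) : Submodule S A) : Set A) := by
    refine hXc.preimage (?_ : Continuous fun a : A => !![a, 0; 0, -a])
    refine continuous_matrix fun i j => ?_
    fin_cases i <;> fin_cases j <;> simp <;> fun_prop
  have hBc : IsClosed ((X.comap (upperMap S A) : Submodule S A) : Set A) := by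
    refine hXc.preimage (?_ : Continuous fun a : A => !![0, a; 0, 0])
    refine continuous_matrix fun i j => ?_
    fin_cases i <;> fin_cases j <;> simp <;> fun_prop
  set I := X.comap (diagMap S A) with hI
  set B := X.comap (upperMap S A) with hB
  have hBB : closedMul B.toAddSubgroup B.toAddSubgroup ≤ I.toAddSubgroup :=
    closedMul_le hIc fun b hb c hc => hPink.diag_mul hb ((hlow c).mpr hc)
  have hIB : closedMul I.toAddSubgroup B.toAddSubgroup ≤ B.toAddSubgroup :=
    closedMul_le hBc fun a ha b hb => hPink.upper_mul h2 ha hb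
  have hIII : closedMul (closedMul I.toAddSubgroup I.toAddSubgroup) I.toAddSubgroup
      ≤ I.toAddSubgroup :=
    closedMul_le hIc <| closedMul_mul_mem hIc fun a ha b hb c hc => hPink.diag_triple h2 ha hb hc
  refine ⟨I, B, hIc, hBc, fun a ha => (hXm _ ha).2 0 0, fun b hb => (hXm _ hb).2 0 1, hXeq,
    hBB, hIB, hIII, ?_⟩
  -- The last condition holds because this closed subalgebra contains the entries of L, hence every
  -- trace, and the traces generate A topologically.
  have hCc := isClosed_structureSubalgebra (F := F) hpm I.toAddSubgroup B.toAddSubgroup hIc hBc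
    hBB hIB hIII
  set C := structureSubalgebra (WittVector p F) I.toAddSubgroup B.toAddSubgroup hBB hIB hIII hBc
    with hC
  have hIC : ∀ a ∈ I, a ∈ C := fun a ha => Submodule.mem_sup_left (Submodule.mem_sup_left
    (Submodule.mem_sup_right (Submodule.subset_span ha)))
  have hBC : ∀ a ∈ B, a ∈ C := fun a ha => Submodule.mem_sup_right (Submodule.subset_span ha)
  have hLC : ∀ x ∈ lieAlg ρ, ∀ i j, x i j ∈ C := by
    intro x hx i j
    have hxX : x ∈ (X : Set (Matrix (Fin 2) (Fin 2) A)) := Submodule.subset_span hx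
    rw [hXeq] at hxX
    obtain ⟨-, a1, a2, a3, a4⟩ := hxX
    fin_cases i <;> fin_cases j
    · exact hIC _ a1
    · exact hBC _ a3
    · exact hBC _ a4
    · exact hIC _ a2
  have hle : Algebra.adjoin (WittVector p F) (Set.range t) ≤ C := by
    refine Algebra.adjoin_le ?_
    rintro _ ⟨g, rfl⟩
    rw [← hρ.trace_eq]
    exact trace_mem_structureSubalgebra hp hres hps.const_det hρ.det_eq hw.const_mem C hCc hLC g
  rw [eq_top_iff]
  intro a _
  have : a ∈ closure (C : Set A) := (hps.generated.mono hle) a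
  rw [hCc.closure_eq] at this
  exact this

end StructureTheorem

/-! ### The Eakin–Nagata theorem, after Formanek -/

section Formanek

variable {R A : Type*} [CommRing R] [CommRing A] [Algebra R A] [Module.Finite R A]

/-- The key step of Formanek's proof of the Eakin–Nagata theorem. -/
lemma isNoetherian_of_isNoetherian_quotient
    (h : ∀ b : Ideal A, b ≠ ⊥ → IsNoetherian R (A ⧸ b)) : IsNoetherian R A := by
  obtain ⟨s, hs⟩ := Module.Finite.fg_top (R := R) (M := A)
  -- N is in Q when A/N is still faithful over the image of R in A; a maximal such N is wanted.
  let Q : Set (Submodule R A) := {N | ∀ r : R, (∀ x ∈ s, r • x ∈ N) → algebraMap R A r = 0}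
  have hall : ∀ (N : Submodule R A) (r : R), (∀ x ∈ s, r • x ∈ N) → ∀ x, r • x ∈ N := by
    intro N r hr x
    have : (⊤ : Submodule R A) ≤ N.comap (LinearMap.lsmul R A r) := by
      rw [← hs, Submodule.span_le]
      exact hr
    exact this (Submodule.mem_top (x := x))
  have hbot : (⊥ : Submodule R A) ∈ Q := by
    intro r hr
    have := hall ⊥ r hr 1
    rwa [Submodule.mem_bot, Algebra.smul_def, mul_one] at this
  obtain ⟨N, -, hN⟩ := zorn_le_nonempty₀ Q (fun c hc hchain y hy => by
    refine ⟨sSup c, fun r hr => ?_, fun z hz => le_sSup hz⟩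
    have hdir : DirectedOn (· ≤ ·) c := hchain.directedOn
    -- Only the finitely many generators in s are tested, so the union of a chain stays in Q.
    have hfin : ∀ u : Finset A, u ⊆ s → ∃ N ∈ c, ∀ x ∈ u, r • x ∈ N := by
      classical
      intro u
      induction u using Finset.induction_on with
      | empty => exact fun _ => ⟨y, hy, by simp⟩
      | insert a u _ ih =>
        intro hu
        obtain ⟨N1, hN1, h1⟩ := ih ((Finset.subset_insert a u).trans hu)
        obtain ⟨N2, hN2, h2⟩ := (Submodule.mem_sSup_of_directed ⟨y, hy⟩ hdir).mp
          (hr a (hu (Finset.mem_insert_self a u)))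
        obtain ⟨N3, hN3, h13, h23⟩ := hdir N1 hN1 N2 hN2
        refine ⟨N3, hN3, fun x hx => ?_⟩
        rcases Finset.mem_insert.mp hx with rfl | hx
        · exact h23 h2
        · exact h13 (h1 x hx)
    obtain ⟨N, hN, hNr⟩ := hfin s subset_rfl
    exact hc hN r hNr) ⊥ hbot
  -- A submodule strictly above N contains rA for some r nonzero in A. It is finitely generated
  -- because rA is, and because A/rA is noetherian by hypothesis.
  have hquot : IsNoetherian R (A ⧸ N) := by
    refine ⟨fun K => ?_⟩
    by_cases hK : K.comap N.mkQ = N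
    · have : K = ⊥ := by
        rw [← Submodule.map_comap_eq_of_surjective N.mkQ_surjective K, hK, Submodule.mkQ_map_self]
      rw [this]
      exact Submodule.fg_bot
    have hle : N ≤ K.comap N.mkQ := Submodule.le_comap_mkQ N K
    have hnQ : K.comap N.mkQ ∉ Q := fun hQ => hK (le_antisymm (hN.2 hQ hle) hle)
    simp only [Q, Set.mem_ofPred_eq, not_forall] at hnQ
    obtain ⟨r, hr, hr0⟩ := hnQ
    have hb : IsNoetherian R (A ⧸ Ideal.span {algebraMap R A r}) :=
      h _ (by rwa [Ne, Ideal.span_singleton_eq_bot])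
    have hfg : (K.comap N.mkQ).FG := by
      refine Submodule.fg_of_fg_map_of_fg_inf_ker
        (Ideal.Quotient.mkₐ R (Ideal.span {algebraMap R A r})).toLinearMap
        (IsNoetherian.noetherian _) ?_
      have : K.comap N.mkQ ⊓ LinearMap.ker
          (Ideal.Quotient.mkₐ R (Ideal.span {algebraMap R A r})).toLinearMap
          = LinearMap.range (LinearMap.lsmul R A r) := by
        refine le_antisymm ?_ ?_
        · rintro x ⟨-, hx⟩
          have hx : Ideal.Quotient.mk _ x = 0 := hx
          rw [Ideal.Quotient.eq_zero_iff_mem, Ideal.mem_span_singleton'] at hx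
          obtain ⟨a, rfl⟩ := hx
          exact ⟨a, by simp [Algebra.smul_def, mul_comm]⟩
        · rintro _ ⟨a, rfl⟩
          refine ⟨hall _ r hr a, ?_⟩
          change Ideal.Quotient.mk _ (r • a) = 0
          rw [Ideal.Quotient.eq_zero_iff_mem, Ideal.mem_span_singleton', Algebra.smul_def]
          exact ⟨a, mul_comm _ _⟩
      rw [this]
      exact Submodule.fg_top _ |>.mp (Module.Finite.range _).fg_top
    rw [← Submodule.map_comap_eq_of_surjective N.mkQ_surjective K]
    exact hfg.map _
  -- R/ker f embeds in a finite power of the noetherian module A/N. By faithfulness ker f acts as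
  -- zero on A, so A is a quotient of a finite power of R/ker f.
  let f : R →ₗ[R] (s → A ⧸ N) := LinearMap.pi fun x => N.mkQ.comp (LinearMap.toSpanSingleton R A x)
  have hker : LinearMap.ker f ≤ LinearMap.ker (Algebra.linearMap R A) := by
    intro r hr
    refine hN.1 r fun x hx => ?_
    have := congrFun (show f r = 0 from hr) ⟨x, hx⟩
    exact (Submodule.Quotient.mk_eq_zero N).mp this
  have h1 : IsNoetherian R (R ⧸ LinearMap.ker f) :=
    isNoetherian_of_linearEquiv f.quotKerEquivRange.symm
  let e : (R ⧸ LinearMap.ker f) →ₗ[R] A := (LinearMap.ker f).liftQ (Algebra.linearMap R A) hker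
  let Φ : (s → R ⧸ LinearMap.ker f) →ₗ[R] A :=
    ∑ x : s, ((LinearMap.mulRight R (x : A)).comp e).comp (LinearMap.proj x)
  refine isNoetherian_of_surjective (f := Φ) ?_
  rw [eq_top_iff, ← hs, Submodule.span_le]
  intro x hx
  classical
  refine ⟨Pi.single ⟨x, hx⟩ (Submodule.Quotient.mk 1), ?_⟩
  simp only [Φ, LinearMap.sum_apply, LinearMap.comp_apply, LinearMap.proj_apply]
  rw [Finset.sum_eq_single ⟨x, hx⟩]
  · have h1 : e (Submodule.Quotient.mk 1) = 1 :=
      ((LinearMap.ker f).liftQ_apply _ _).trans (map_one (algebraMap R A))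
    rw [Pi.single_eq_same, h1, LinearMap.mulRight_apply, one_mul]
  · intro b _ hb
    rw [Pi.single_eq_of_ne hb]
    simp
  · simp

/-- Noetherian induction on the ideals of A reduces to the case where every proper quotient is
already noetherian over R. Nothing is assumed about R itself. -/
theorem isNoetherian_of_isNoetherianRing_of_finite [IsNoetherianRing A] : IsNoetherian R A := by
  suffices h : ∀ a : Ideal A, IsNoetherian R (A ⧸ a) by
    have := h ⊥
    exact isNoetherian_of_linearEquiv (AlgEquiv.quotientBot R A).toLinearEquiv
  intro a
  induction a using IsNoetherian.induction with
  | hgt a ih =>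
    refine isNoetherian_of_isNoetherian_quotient fun b hb => ?_
    have hlt : a < b.comap (Ideal.Quotient.mk a) := by
      refine lt_of_le_of_ne (fun x hx => ?_) fun heq => hb ?_
      · rw [Ideal.mem_comap, Ideal.Quotient.eq_zero_iff_mem.mpr hx]
        exact zero_mem b
      · rw [← Ideal.map_comap_of_surjective _ Ideal.Quotient.mk_surjective b, ← heq,
          Ideal.map_quotient_self]
    have := ih _ hlt
    let g : (A ⧸ b.comap (Ideal.Quotient.mk a)) →ₐ[R] ((A ⧸ a) ⧸ b) :=
      Ideal.Quotient.liftₐ _ ((Ideal.Quotient.mkₐ R b).comp (Ideal.Quotient.mkₐ R a))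
        fun x hx => Ideal.Quotient.eq_zero_iff_mem.mpr hx
    refine isNoetherian_of_surjective (f := g.toLinearMap) (LinearMap.range_eq_top.mpr ?_)
    intro y
    obtain ⟨y, rfl⟩ := Ideal.Quotient.mk_surjective y
    obtain ⟨y, rfl⟩ := Ideal.Quotient.mk_surjective y
    exact ⟨Ideal.Quotient.mk _ y, rfl⟩

end Formanek

/-! ### Finite generation of the pair (I, B) over a noetherian ring -/

section Generation

open IsLocalRing Topology

variable {W A : Type*} [CommRing W] [CommRing A] [Algebra W A]

/-- The multiplicative conditions on the pair `(I, B)`, for closed submodules. -/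
structure IsPinkPair [TopologicalSpace A] (I B : Submodule W A) : Prop where
  isClosed_left : IsClosed (I : Set A)
  isClosed_right : IsClosed (B : Set A)
  sq_mem : ∀ b ∈ B, ∀ c ∈ B, b * c ∈ I
  mul_mem : ∀ a ∈ I, ∀ b ∈ B, a * b ∈ B
  cube_mem : ∀ a ∈ I, ∀ b ∈ I, ∀ c ∈ I, a * b * c ∈ I

lemma StructureConditions.isPinkPair [TopologicalSpace A] [IsTopologicalRing A] {I B : Submodule W A}
    (hI : IsClosed (I : Set A)) (hB : IsClosed (B : Set A))
    (h : StructureConditions W I.toAddSubgroup B.toAddSubgroup) : IsPinkPair I B where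
  isClosed_left := hI
  isClosed_right := hB
  sq_mem _ hb _ hc := h.sq_B_le (mul_mem_closedMul hb hc)
  mul_mem _ ha _ hb := h.I_mul_B_le (mul_mem_closedMul ha hb)
  cube_mem _ ha _ hb _ hc := h.cube_I_le (mul_mem_closedMul (mul_mem_closedMul ha hb) hc)

/-- The elements of `A` whose multiplications preserve `I` and `B`. -/
def multiplierSubalgebra (I B : Submodule W A) : Subalgebra W A where
  carrier := {r | (∀ a ∈ I, r * a ∈ I) ∧ ∀ b ∈ B, r * b ∈ B}
  mul_mem' := fun {r s} hr hs => ⟨fun a ha => mul_assoc r s a ▸ hr.1 _ (hs.1 a ha),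
    fun b hb => mul_assoc r s b ▸ hr.2 _ (hs.2 b hb)⟩
  add_mem' := fun {r s} hr hs => ⟨fun a ha => add_mul r s a ▸ add_mem (hr.1 _ ha) (hs.1 a ha),
    fun b hb => add_mul r s b ▸ add_mem (hr.2 _ hb) (hs.2 b hb)⟩
  algebraMap_mem' := fun w => ⟨fun a ha => Algebra.smul_def w a ▸ I.smul_mem w ha,
    fun b hb => Algebra.smul_def w b ▸ B.smul_mem w hb⟩

section

variable [TopologicalSpace A] {I B : Submodule W A}

lemma isClosed_multiplierSubalgebra [IsTopologicalRing A] (hI : IsClosed (I : Set A))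
    (hB : IsClosed (B : Set A)) : IsClosed (multiplierSubalgebra I B : Set A) := by
  have : (multiplierSubalgebra I B : Set A) =
      (⋂ a ∈ I, (· * a) ⁻¹' (I : Set A)) ∩ ⋂ b ∈ B, (· * b) ⁻¹' (B : Set A) := by
    ext r
    simp [multiplierSubalgebra]
  rw [this]
  exact (isClosed_biInter fun a _ => hI.preimage (continuous_mul_const a)).inter
    (isClosed_biInter fun b _ => hB.preimage (continuous_mul_const b))

lemma IsPinkPair.mul_mem_multiplier_left (h : IsPinkPair I B) {a b : A} (ha : a ∈ I) (hb : b ∈ I) :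
    a * b ∈ multiplierSubalgebra I B :=
  ⟨fun c hc => h.cube_mem a ha b hb c hc,
    fun c hc => mul_assoc a b c ▸ h.mul_mem a ha _ (h.mul_mem b hb c hc)⟩

lemma IsPinkPair.mul_mem_multiplier_right (h : IsPinkPair I B) {b c : A} (hb : b ∈ B) (hc : c ∈ B) :
    b * c ∈ multiplierSubalgebra I B :=
  ⟨fun a ha => by
    rw [mul_assoc, mul_comm c]
    exact h.sq_mem b hb _ (h.mul_mem a ha c hc), fun a ha => h.mul_mem _ (h.sq_mem b hb c hc) a ha⟩

/-- The ring on the left depends only on S and T, yet acts on every Pink pair containing them. This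
allows generators of one pair to be compared with another pair. -/
lemma IsPinkPair.topologicalClosure_adjoin_le [IsTopologicalRing A] (h : IsPinkPair I B)
    {S T : Set A} (hS : S ⊆ I) (hT : T ⊆ B) :
    (Algebra.adjoin W ((fun x => x ^ 2) '' (S ∪ T))).topologicalClosure ≤
      multiplierSubalgebra I B := by
  refine Subalgebra.topologicalClosure_minimal (Algebra.adjoin_le ?_)
    (isClosed_multiplierSubalgebra h.isClosed_left h.isClosed_right)
  rintro _ ⟨x, hx | hx, rfl⟩
  · change x ^ 2 ∈ _
    rw [sq]
    exact h.mul_mem_multiplier_left (hS hx) (hS hx)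
  · change x ^ 2 ∈ _
    rw [sq]
    exact h.mul_mem_multiplier_right (hT hx) (hT hx)

end

variable {p : ℕ} [Fact p.Prime] {F A : Type*} [Field F] [Finite F] [CharP F p] [CommRing A]
  [IsLocalRing A] [TopologicalSpace A] [IsTopologicalRing A] [CompactSpace A] [T2Space A]
  [Algebra (WittVector p F) A] {res : A →+* F} [IsNoetherianRing A]
  {I B : Submodule (WittVector p F) A}

/-- Nakayama: modulo 𝔪² the summand I² disappears, and the constant part of an element of 𝔪 is a
multiple of p. -/
lemma maximalIdeal_le_span
    (hres : ∀ x : WittVector p F, res (algebraMap (WittVector p F) A x) = x.coeff 0)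
    (hIm : (I : Set A) ⊆ maximalIdeal A) (hBm : (B : Set A) ⊆ maximalIdeal A)
    (h : StructureConditions (WittVector p F) I.toAddSubgroup B.toAddSubgroup) :
    maximalIdeal A ≤ Ideal.span ({(p : A)} ∪ (I ∪ B : Set A)) := by
  refine Submodule.le_of_le_smul_of_le_jacobson_bot (IsNoetherian.noetherian _)
    (IsLocalRing.maximalIdeal_le_jacobson _) fun g hg => ?_
  have hgt : g ∈ (⊤ : Submodule (WittVector p F) A) := trivial
  rw [← h.sum_eq] at hgt
  obtain ⟨x, hx, b, hb, rfl⟩ := Submodule.mem_sup.mp hgt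
  obtain ⟨y, hy, q, hq, rfl⟩ := Submodule.mem_sup.mp hx
  obtain ⟨z, hz, i, hi, rfl⟩ := Submodule.mem_sup.mp hy
  obtain ⟨w, rfl⟩ := Submodule.mem_span_singleton.mp hz
  have hi : i ∈ I := by rwa [show (I.toAddSubgroup : Set A) = (I : Set A) from rfl,
    Submodule.span_eq] at hi
  have hb : b ∈ B := by rwa [show (B.toAddSubgroup : Set A) = (B : Set A) from rfl,
    Submodule.span_eq] at hb
  have hqm : q ∈ maximalIdeal A * maximalIdeal A := by
    refine (Submodule.span_le (p := (maximalIdeal A * maximalIdeal A).restrictScalars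
      (WittVector p F))).mpr ?_ hq
    exact closedMul_le (Z := (maximalIdeal A * maximalIdeal A).toAddSubgroup)
      (show IsClosed ((maximalIdeal A * maximalIdeal A : Ideal A) : Set A) from
        IsNoetherianRing.isClosed_ideal _) fun x hx y hy => Ideal.mul_mem_mul (hIm hx) (hIm hy)
  have hw : w • (1 : A) ∈ Ideal.span ({(p : A)} ∪ (I ∪ B : Set A)) := by
    have h1 : algebraMap _ A w ∈ maximalIdeal A := by
      have h2 := sub_mem (sub_mem (sub_mem hg (hBm hb)) (Ideal.mul_le_left hqm)) (hIm hi)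
      rwa [add_sub_cancel_right, add_sub_cancel_right, add_sub_cancel_right,
        ← Algebra.algebraMap_eq_smul_one] at h2
    rw [← res_eq_zero_iff hres, hres, ← WittVector.mem_span_p_iff_coeff_zero_eq_zero,
      Ideal.mem_span_singleton] at h1
    obtain ⟨v, rfl⟩ := h1
    rw [Algebra.smul_def, map_mul, map_natCast, mul_one]
    exact Ideal.mul_mem_right _ _ (Ideal.subset_span (Or.inl rfl))
  have h3 : w • (1 : A) + i + b ∈ Ideal.span ({(p : A)} ∪ (I ∪ B : Set A)) :=
    add_mem (add_mem hw (Ideal.subset_span (Or.inr (Or.inl hi))))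
      (Ideal.subset_span (Or.inr (Or.inr hb)))
  rw [add_right_comm, smul_eq_mul]
  exact Submodule.add_mem_sup h3 hqm

-- N contains the constants and generators of 𝔪, so N + 𝔪ᵏ = A for every k by induction; hence N is
-- dense as well as closed.
omit [Finite F] [IsNoetherianRing A] in
lemma eq_top_of_isClosed_of_maximalIdeal_le_span
    (hres : ∀ x : WittVector p F, res (algebraMap (WittVector p F) A x) = x.coeff 0)
    (N : Subalgebra (WittVector p F) A) (hN : IsClosed (N : Set A)) {T : Set A} (hT : T ⊆ N)
    (hm : Ideal.span T = maximalIdeal A) : N = ⊤ := by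
  have hpm := natCast_prime_mem_maximalIdeal hres
  have key : ∀ k : ℕ, ∀ a : A, ∃ n ∈ N, a - n ∈ maximalIdeal A ^ k := by
    intro k
    induction k with
    | zero => exact fun a => ⟨0, zero_mem N, by simp⟩
    | succ k ih =>
      have hmax : ∀ c ∈ Ideal.span T, ∃ n ∈ N, c - n ∈ maximalIdeal A ^ (k + 1) := by
        intro c hc
        induction hc using Submodule.span_induction with
        | mem c hc => exact ⟨c, hT hc, by simp⟩
        | zero => exact ⟨0, zero_mem N, by simp⟩
        | add c c' _ _ h h' =>
          obtain ⟨n, hn, h⟩ := h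
          obtain ⟨n', hn', h'⟩ := h'
          exact ⟨n + n', add_mem hn hn', by rw [add_sub_add_comm]; exact add_mem h h'⟩
        | smul a c hc h =>
          obtain ⟨n, hn, h⟩ := h
          obtain ⟨a', ha', h'⟩ := ih a
          have hnm : n ∈ maximalIdeal A := by
            have hc : c ∈ maximalIdeal A := hm ▸ hc
            have := sub_mem hc (Ideal.pow_le_self (Nat.succ_ne_zero k) h)
            rwa [sub_sub_cancel] at this
          -- The error is a(c - n) + (a - a')n, in 𝔪ᵏ⁺¹ because n is in 𝔪.
          refine ⟨a' * n, mul_mem ha' hn, ?_⟩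
          have := add_mem (Ideal.mul_mem_left _ a h) (Ideal.mul_mem_mul h' hnm)
          convert this using 1
          rw [smul_eq_mul]
          ring
      intro a
      obtain ⟨n, hn, h⟩ := hmax (a - constLift p (res a)) (by
        have h1 : a - constLift p (res a) ∈ maximalIdeal A := by
          rw [← res_eq_zero_iff hres, map_sub, res_constLift hres, sub_self]
        rwa [hm])
      refine ⟨constLift p (res a) + n, add_mem (N.algebraMap_mem _) hn, ?_⟩
      rwa [← sub_sub]
  rw [eq_top_iff]
  intro a _
  have : a ∈ closure (N : Set A) := by
    rw [mem_closure_iff_nhds]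
    intro U hU
    have hU' : {x | a - x ∈ U} ∈ 𝓝 (0 : A) := by
      have : ContinuousAt (fun x => a - x) 0 := by fun_prop
      exact this (show U ∈ 𝓝 (a - 0) by rwa [sub_zero])
    obtain ⟨k, hk⟩ := exists_maximalIdeal_pow_subset (Fact.out : p.Prime).pos hpm hU'
    obtain ⟨n, hn, h⟩ := key k a
    refine ⟨n, ?_, hn⟩
    have := hk h
    simpa using this
  rwa [hN.closure_eq] at this

-- The elements of G are integral over R, so R[G] is a finite R-module, hence compact and closed;
-- containing p and G it is all of A. Thus A is finite over R, and Eakin–Nagata applies.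
omit [Finite F] in
lemma isNoetherian_of_sq_mem
    (hres : ∀ x : WittVector p F, res (algebraMap (WittVector p F) A x) = x.coeff 0)
    (R : Subalgebra (WittVector p F) A) (hRc : IsClosed (R : Set A)) {G : Set A} (hG : G.Finite)
    (hGR : ∀ x ∈ G, x ^ 2 ∈ R) (hspan : Ideal.span ({(p : A)} ∪ G) = maximalIdeal A) :
    IsNoetherian R A := by
  have : CompactSpace R := isCompact_iff_compactSpace.mp hRc.isCompact
  have : ContinuousSMul R A := ⟨by
    change Continuous fun x : R × A => (x.1 : A) * x.2
    fun_prop⟩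
  have hNfg : (Subalgebra.toSubmodule (Algebra.adjoin R G)).FG := by
    refine fg_adjoin_of_finite hG fun x hx => IsIntegral.of_pow two_pos ?_
    exact isIntegral_algebraMap (R := R) (x := ⟨x ^ 2, hGR x hx⟩)
  have hNc : IsClosed (Algebra.adjoin R G : Set A) := (Submodule.isCompact_of_fg hNfg).isClosed
  have hNtop : (Algebra.adjoin R G).restrictScalars (WittVector p F) = ⊤ := by
    refine eq_top_of_isClosed_of_maximalIdeal_le_span hres _ hNc ?_ hspan
    rintro x (rfl | hx)
    · exact natCast_mem (Algebra.adjoin R G) p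
    · exact Algebra.subset_adjoin (R := R) hx
  have hfin : Module.Finite R A := ⟨by
    have : Subalgebra.toSubmodule (Algebra.adjoin R G) = ⊤ := by
      rw [eq_top_iff]
      intro x _
      have : x ∈ (Algebra.adjoin R G).restrictScalars (WittVector p F) := hNtop ▸ trivial
      exact this
    rwa [this] at hNfg⟩
  exact isNoetherian_of_isNoetherianRing_of_finite

/-- If `A` is noetherian, a pair satisfying the structure conditions is generated by finitely many
elements. -/
theorem exists_finset_generators
    (hres : ∀ x : WittVector p F, res (algebraMap (WittVector p F) A x) = x.coeff 0)
    (hIc : IsClosed (I : Set A)) (hBc : IsClosed (B : Set A))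
    (hIm : (I : Set A) ⊆ maximalIdeal A) (hBm : (B : Set A) ⊆ maximalIdeal A)
    (h : StructureConditions (WittVector p F) I.toAddSubgroup B.toAddSubgroup) :
    ∃ S T : Finset A, (S : Set A) ⊆ I ∧ (T : Set A) ⊆ B ∧
      ∀ I' B' : Submodule (WittVector p F) A, IsPinkPair I' B' → (S : Set A) ⊆ I' →
        (T : Set A) ⊆ B' → I ≤ I' ∧ B ≤ B' := by
  classical
  have hpm := natCast_prime_mem_maximalIdeal hres
  have hspan : Ideal.span ({(p : A)} ∪ (I ∪ B : Set A)) = maximalIdeal A := by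
    refine le_antisymm (Ideal.span_le.mpr ?_) (maximalIdeal_le_span hres hIm hBm h)
    rintro x (rfl | hx | hx)
    exacts [hpm, hIm hx, hBm hx]
  obtain ⟨G, hG, hGspan⟩ := (Submodule.fg_span_iff_fg_span_finset_subset _).mp
    (show (Ideal.span ({(p : A)} ∪ (I ∪ B : Set A))).FG from IsNoetherian.noetherian _)
  let S₀ := G.filter (· ∈ I)
  let T₀ := G.filter (· ∈ B)
  have hS₀ : (S₀ : Set A) ⊆ I := fun x hx => (Finset.mem_filter.mp hx).2
  have hT₀ : (T₀ : Set A) ⊆ B := fun x hx => (Finset.mem_filter.mp hx).2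
  let R := (Algebra.adjoin (WittVector p F)
    ((fun x => x ^ 2) '' (S₀ ∪ T₀ : Set A))).topologicalClosure
  have hnoeth : IsNoetherian R A := by
    refine isNoetherian_of_sq_mem hres R (Subalgebra.isClosed_topologicalClosure _)
      (S₀.finite_toSet.union T₀.finite_toSet) (fun x hx => Subalgebra.le_topologicalClosure _
        (Algebra.subset_adjoin ⟨x, hx, rfl⟩)) (le_antisymm ?_ ?_)
    · rw [← hspan]
      exact Ideal.span_mono (Set.union_subset_union_right _ (Set.union_subset_union hS₀ hT₀))
    · rw [← hspan, show Ideal.span _ = _ from hGspan, Submodule.span_le]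
      intro x hx
      refine Submodule.subset_span ?_
      rcases hG hx with rfl | hxI | hxB
      · exact Or.inl rfl
      · exact Or.inr (Or.inl (Finset.mem_filter.mpr ⟨hx, hxI⟩))
      · exact Or.inr (Or.inr (Finset.mem_filter.mpr ⟨hx, hxB⟩))
  have hpair := h.isPinkPair hIc hBc
  have hR : R ≤ multiplierSubalgebra I B := hpair.topologicalClosure_adjoin_le hS₀ hT₀
  -- I and B are submodules of the noetherian R-module A, so finitely many elements generate them
  -- over R.
  let IR : Submodule R A :=
    { I.toAddSubgroup with smul_mem' := fun r a ha => (hR r.2).1 a ha }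
  let BR : Submodule R A :=
    { B.toAddSubgroup with smul_mem' := fun r b hb => (hR r.2).2 b hb }
  obtain ⟨S₁, hS₁⟩ := hnoeth.noetherian IR
  obtain ⟨T₁, hT₁⟩ := hnoeth.noetherian BR
  refine ⟨S₀ ∪ S₁, T₀ ∪ T₁, ?_, ?_, fun I' B' h' hS hT => ?_⟩
  · rw [Finset.coe_union]
    exact Set.union_subset hS₀ fun x hx => show x ∈ IR from hS₁ ▸ Submodule.subset_span hx
  · rw [Finset.coe_union]
    exact Set.union_subset hT₀ fun x hx => show x ∈ BR from hT₁ ▸ Submodule.subset_span hx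
  rw [Finset.coe_union, Set.union_subset_iff] at hS hT
  have hR' : R ≤ multiplierSubalgebra I' B' := h'.topologicalClosure_adjoin_le hS.1 hT.1
  let IR' : Submodule R A :=
    { I'.toAddSubgroup with smul_mem' := fun r a ha => (hR' r.2).1 a ha }
  let BR' : Submodule R A :=
    { B'.toAddSubgroup with smul_mem' := fun r b hb => (hR' r.2).2 b hb }
  have h1 : IR ≤ IR' := hS₁ ▸ Submodule.span_le.mpr hS.2
  have h2 : BR ≤ BR' := hT₁ ▸ Submodule.span_le.mpr hT.2
  exact ⟨fun x hx => h1 hx, fun x hx => h2 hx⟩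

end Generation

/-! ### Monomial matrices with constant entries -/

section Monomial

variable {F A : Type*} [Field F] [CommRing A]

/-- The diagonal matrix `diag(τ x, τ y)`. -/
def diagGL (τ : F →* A) (x y : Fˣ) : GL (Fin 2) A where
  val := !![τ x, 0; 0, τ y]
  inv := !![τ (x⁻¹ : Fˣ), 0; 0, τ (y⁻¹ : Fˣ)]
  val_inv := by
    rw [Matrix.mul_fin_two]
    simp only [mul_zero, zero_mul, add_zero, zero_add, ← map_mul, Units.mul_inv, map_one,
      Matrix.one_fin_two]
  inv_val := by
    rw [Matrix.mul_fin_two]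
    simp only [mul_zero, zero_mul, add_zero, zero_add, ← map_mul, Units.inv_mul, map_one,
      Matrix.one_fin_two]

/-- The antidiagonal matrix with entries `τ x` and `τ y`. -/
def antidiagGL (τ : F →* A) (x y : Fˣ) : GL (Fin 2) A where
  val := !![0, τ x; τ y, 0]
  inv := !![0, τ (y⁻¹ : Fˣ); τ (x⁻¹ : Fˣ), 0]
  val_inv := by
    rw [Matrix.mul_fin_two]
    simp only [mul_zero, zero_mul, add_zero, zero_add, ← map_mul, Units.mul_inv, map_one,
      Matrix.one_fin_two]
  inv_val := by
    rw [Matrix.mul_fin_two]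
    simp only [mul_zero, zero_mul, add_zero, zero_add, ← map_mul, Units.inv_mul, map_one,
      Matrix.one_fin_two]

variable (τ : F →* A) (x y z w : Fˣ)

lemma diagGL_mul_diagGL : diagGL τ x y * diagGL τ z w = diagGL τ (x * z) (y * w) :=
  Units.ext (by simp [diagGL])

lemma diagGL_mul_antidiagGL : diagGL τ x y * antidiagGL τ z w = antidiagGL τ (x * z) (y * w) :=
  Units.ext (by simp [diagGL, antidiagGL])

lemma antidiagGL_mul_diagGL : antidiagGL τ x y * diagGL τ z w = antidiagGL τ (x * w) (y * z) :=
  Units.ext (by simp [diagGL, antidiagGL])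

lemma antidiagGL_mul_antidiagGL : antidiagGL τ x y * antidiagGL τ z w = diagGL τ (x * w) (y * z) :=
  Units.ext (by simp [diagGL, antidiagGL])

lemma diagGL_one : diagGL τ 1 1 = 1 :=
  Units.ext (by simp [diagGL, Matrix.one_fin_two])

/-- The group of monomial matrices with entries in the image of `τ`. -/
def monomialSubgroup : Subgroup (GL (Fin 2) A) where
  carrier := {g | (∃ x y, g = diagGL τ x y) ∨ ∃ x y, g = antidiagGL τ x y}
  mul_mem' := by
    rintro _ _ (⟨x, y, rfl⟩ | ⟨x, y, rfl⟩) (⟨z, w, rfl⟩ | ⟨z, w, rfl⟩)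
    · exact Or.inl ⟨_, _, diagGL_mul_diagGL τ x y z w⟩
    · exact Or.inr ⟨_, _, diagGL_mul_antidiagGL τ x y z w⟩
    · exact Or.inr ⟨_, _, antidiagGL_mul_diagGL τ x y z w⟩
    · exact Or.inl ⟨_, _, antidiagGL_mul_antidiagGL τ x y z w⟩
  one_mem' := Or.inl ⟨1, 1, (diagGL_one τ).symm⟩
  inv_mem' := by
    rintro _ (⟨x, y, rfl⟩ | ⟨x, y, rfl⟩)
    · exact Or.inl ⟨x⁻¹, y⁻¹, inv_eq_of_mul_eq_one_right (by
        rw [diagGL_mul_diagGL, mul_inv_cancel, mul_inv_cancel, diagGL_one])⟩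
    · exact Or.inr ⟨y⁻¹, x⁻¹, inv_eq_of_mul_eq_one_right (by
        rw [antidiagGL_mul_antidiagGL, mul_inv_cancel, mul_inv_cancel, diagGL_one])⟩

lemma diagGL_mem_monomialSubgroup : diagGL τ x y ∈ monomialSubgroup τ := Or.inl ⟨x, y, rfl⟩

lemma antidiagGL_mem_monomialSubgroup : antidiagGL τ x y ∈ monomialSubgroup τ := Or.inr ⟨x, y, rfl⟩

lemma finite_monomialSubgroup [Finite F] : (monomialSubgroup τ : Set (GL (Fin 2) A)).Finite := by
  refine ((Set.finite_range fun q : Fˣ × Fˣ => diagGL τ q.1 q.2).union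
    (Set.finite_range fun q : Fˣ × Fˣ => antidiagGL τ q.1 q.2)).subset ?_
  rintro g (⟨x, y, rfl⟩ | ⟨x, y, rfl⟩)
  · exact Or.inl ⟨(x, y), rfl⟩
  · exact Or.inr ⟨(x, y), rfl⟩

lemma map_diagGL {A' : Type*} [CommRing A'] (f : A →+* A') :
    Matrix.GeneralLinearGroup.map f (diagGL τ x y) = diagGL ((f : A →* A').comp τ) x y := by
  refine Units.ext ?_
  ext i j
  fin_cases i <;> fin_cases j <;> simp [diagGL]

lemma map_antidiagGL {A' : Type*} [CommRing A'] (f : A →+* A') :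
    Matrix.GeneralLinearGroup.map f (antidiagGL τ x y) = antidiagGL ((f : A →* A').comp τ) x y := by
  refine Units.ext ?_
  ext i j
  fin_cases i <;> fin_cases j <;> simp [antidiagGL]

variable {τ}

/-- If the group of units contains a non-trivial element, the diagonal matrices and the antidiagonal
matrices with constant entries span. -/
lemma span_eq_top_of_monomial {P : Type*} [Group P] {ρ : P →* GL (Fin 2) A}
    (h : monomialSubgroup τ ≤ ρ.range) {ζ : Fˣ} (hζ : IsUnit (τ ζ - 1)) :
    Submodule.span A (Set.range fun g => (ρ g).val) = ⊤ := by
  set N := Submodule.span A (Set.range fun g => (ρ g).val) with hN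
  have hmem : ∀ g ∈ monomialSubgroup τ, g.val ∈ N := fun g hg => by
    obtain ⟨q, rfl⟩ := h hg
    exact Submodule.subset_span ⟨q, rfl⟩
  obtain ⟨v, hv⟩ := hζ.exists_left_inv
  -- Differences such as diag(ζ, 1) - diag(1, 1) are τ ζ - 1 times a matrix unit, and v inverts τ ζ
  -- - 1.
  have key : ∀ g ∈ monomialSubgroup τ, ∀ g' ∈ monomialSubgroup τ, ∀ a : A,
      (a * v) • (g.val - g'.val) ∈ N := fun g hg g' hg' a =>
    N.smul_mem _ (sub_mem (hmem g hg) (hmem g' hg'))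
  rw [eq_top_iff]
  intro M _
  have h1 := key _ (diagGL_mem_monomialSubgroup τ ζ 1) _ (diagGL_mem_monomialSubgroup τ 1 1) (M 0 0)
  have h2 := key _ (diagGL_mem_monomialSubgroup τ 1 ζ) _ (diagGL_mem_monomialSubgroup τ 1 1) (M 1 1)
  have h3 := key _ (antidiagGL_mem_monomialSubgroup τ ζ 1) _
    (antidiagGL_mem_monomialSubgroup τ 1 1) (M 0 1)
  have h4 := key _ (antidiagGL_mem_monomialSubgroup τ 1 ζ) _
    (antidiagGL_mem_monomialSubgroup τ 1 1) (M 1 0)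
  convert add_mem (add_mem h1 h2) (add_mem h3 h4) using 1
  ext i j
  fin_cases i <;> fin_cases j <;> simp [diagGL, antidiagGL, mul_assoc, hv]

end Monomial

/-! ### The projective image of the monomial group -/

section Dihedral

variable (F : Type*) [Field F] [Finite F]

lemma diagGL_mem_center_iff {F : Type*} [Field F] (x y : Fˣ) :
    diagGL (MonoidHom.id F) x y ∈ Subgroup.center (GL (Fin 2) F) ↔ x = y := by
  rw [diag_mem_center_iff (by simp [diagGL]) (by simp [diagGL])]
  simp [diagGL, Units.ext_iff]

lemma mk_diagGL_eq {F : Type*} [Field F] (x y : Fˣ) :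
    (Matrix.ProjGenLinGroup.mk (diagGL (MonoidHom.id F) x y) : PGL(2, F)) =
      Matrix.ProjGenLinGroup.mk (diagGL (MonoidHom.id F) (x * y⁻¹) 1) := by
  refine Matrix.ProjGenLinGroup.mk_eq_mk_iff'.mpr ⟨diagGL (MonoidHom.id F) y⁻¹ y⁻¹, ?_, ?_⟩
  · exact (diagGL_mem_center_iff _ _).mpr rfl
  · rw [diagGL_mul_diagGL, mul_inv_cancel]

lemma mk_antidiagGL_eq {F : Type*} [Field F] (x y : Fˣ) :
    (Matrix.ProjGenLinGroup.mk (antidiagGL (MonoidHom.id F) x y) : PGL(2, F)) =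
      Matrix.ProjGenLinGroup.mk (antidiagGL (MonoidHom.id F) 1 (y * x⁻¹)) := by
  refine Matrix.ProjGenLinGroup.mk_eq_mk_iff'.mpr ⟨diagGL (MonoidHom.id F) x⁻¹ x⁻¹, ?_, ?_⟩
  · exact (diagGL_mem_center_iff _ _).mpr rfl
  · rw [antidiagGL_mul_diagGL, mul_inv_cancel]

/-- The image in `PGL₂(F)` of the group of monomial matrices is dihedral. -/
lemma exists_mulEquiv_dihedralGroup :
    Nonempty ((monomialSubgroup (MonoidHom.id F)).map Matrix.ProjGenLinGroup.mk ≃*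
      DihedralGroup (Nat.card Fˣ)) := by
  let φ : Multiplicative (ZMod (Nat.card Fˣ)) ≃* Fˣ := zmodCyclicMulEquiv inferInstance
  let ψ : ZMod (Nat.card Fˣ) → Fˣ := fun i => φ (Multiplicative.ofAdd i)
  have hadd : ∀ i j, ψ (i + j) = ψ i * ψ j := fun i j => by
    simp only [ψ, ofAdd_add, map_mul]
  have hsub : ∀ i j, ψ (i - j) = ψ i * (ψ j)⁻¹ := fun i j => by
    simp only [ψ, ofAdd_sub, map_mul, map_inv, div_eq_mul_inv]
  have hψ : Function.Bijective ψ := φ.bijective.comp Multiplicative.ofAdd.bijective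
  have hψ0 : ψ 0 = 1 := map_one φ
  let d := fun x : Fˣ => (Matrix.ProjGenLinGroup.mk (diagGL (MonoidHom.id F) x 1) : PGL(2, F))
  let a := fun x : Fˣ => (Matrix.ProjGenLinGroup.mk (antidiagGL (MonoidHom.id F) 1 x) : PGL(2, F))
  have hdd : ∀ x y, d x * d y = d (x * y) := fun x y => by
    simp only [d, ← map_mul, diagGL_mul_diagGL, mul_one]
  have hda : ∀ x y, d x * a y = a (y * x⁻¹) := fun x y => by
    simp only [d, a, ← map_mul, diagGL_mul_antidiagGL, mul_one, one_mul]
    rw [mk_antidiagGL_eq]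
  have had : ∀ x y, a x * d y = a (x * y) := fun x y => by
    simp only [d, a, ← map_mul, antidiagGL_mul_diagGL, mul_one]
  have haa : ∀ x y, a x * a y = d (y * x⁻¹) := fun x y => by
    simp only [d, a, ← map_mul, antidiagGL_mul_antidiagGL, mul_one, one_mul]
    rw [mk_diagGL_eq]
  -- Scaling one entry to 1 parametrizes diagonal and antidiagonal classes by Fˣ. Putting the 1 in
  -- the lower right, respectively upper right, corner makes the products match the rules of
  -- `DihedralGroup`.
  let f : DihedralGroup (Nat.card Fˣ) →* PGL(2, F) :=
    { toFun := fun g => match g with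
        | .r i => d (ψ i)
        | .sr i => a (ψ i)
      map_one' := by
        change d (ψ 0) = 1
        simp only [hψ0, d, diagGL_one, map_one]
      map_mul' := by
        rintro (i | i) (j | j)
        · rw [DihedralGroup.r_mul_r]
          simp only [hdd, hadd]
        · rw [DihedralGroup.r_mul_sr]
          simp only [hda, hsub]
        · rw [DihedralGroup.sr_mul_r]
          simp only [had, hadd]
        · rw [DihedralGroup.sr_mul_sr]
          simp only [haa, hsub] }
  have hinj : Function.Injective f := by
    rw [injective_iff_map_eq_one]
    rintro (i | i) hi
    · have h1 := Matrix.ProjGenLinGroup.mk_eq_one.mp hi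
      rw [diagGL_mem_center_iff, ← hψ0] at h1
      rw [hψ.1 h1]
      rfl
    · have h1 := Matrix.ProjGenLinGroup.mk_eq_one.mp hi
      rw [Matrix.GeneralLinearGroup.mem_center_iff_val_mem_range_scalar] at h1
      obtain ⟨c, hc⟩ := h1
      have := congrFun (congrFun hc 0) 1
      simp [antidiagGL] at this
  have hrange : f.range = (monomialSubgroup (MonoidHom.id F)).map Matrix.ProjGenLinGroup.mk := by
    ext g
    constructor
    · rintro ⟨i | i, rfl⟩
      · exact ⟨_, diagGL_mem_monomialSubgroup _ (ψ i) 1, rfl⟩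
      · exact ⟨_, antidiagGL_mem_monomialSubgroup _ 1 (ψ i), rfl⟩
    · rintro ⟨_, ⟨x, y, rfl⟩ | ⟨x, y, rfl⟩, rfl⟩
      · obtain ⟨i, hi⟩ := hψ.2 (x * y⁻¹)
        refine ⟨.r i, ?_⟩
        change d (ψ i) = _
        rw [hi]
        exact (mk_diagGL_eq x y).symm
      · obtain ⟨i, hi⟩ := hψ.2 (y * x⁻¹)
        refine ⟨.sr i, ?_⟩
        change a (ψ i) = _
        rw [hi]
        exact (mk_antidiagGL_eq x y).symm
  exact ⟨((MonoidHom.ofInjective hinj).trans (MulEquiv.subgroupCongr hrange)).symm⟩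

end Dihedral

/-! ### Irreducibility from spanning -/

section Irreducible

lemma isIrreducible_of_span_eq_top {k P : Type*} [Field k] [Group P] {r : P →* GL (Fin 2) k}
    (h : Submodule.span k (Set.range fun g => (r g).val) = ⊤) :
    (toRepresentation r).IsIrreducible where
  exists_pair_ne := ⟨⊥, ⊤, fun h => by
    have h1 : (fun _ => 1 : Fin 2 → k) ∈ (⊥ : Subrepresentation (toRepresentation r)).toSubmodule :=
      h ▸ Submodule.mem_top
    exact one_ne_zero (congrFun (show (fun _ => 1 : Fin 2 → k) = 0 from h1) 0)⟩
  eq_bot_or_eq_top N := by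
    by_cases hN : N.toSubmodule = ⊥
    · exact Or.inl (Subrepresentation.toSubmodule_injective hN)
    refine Or.inr (Subrepresentation.toSubmodule_injective ?_)
    obtain ⟨v, hv, hv0⟩ := Submodule.exists_mem_ne_zero_of_ne_bot hN
    obtain ⟨i, hi⟩ := Function.ne_iff.mp hv0
    have hall : ∀ M : Matrix (Fin 2) (Fin 2) k, M.mulVec v ∈ N.toSubmodule := by
      intro M
      have hM : M ∈ Submodule.span k (Set.range fun g => (r g).val) := h ▸ Submodule.mem_top
      induction hM using Submodule.span_induction with
      | mem x hx => obtain ⟨g, rfl⟩ := hx; exact N.apply_mem_toSubmodule g hv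
      | zero => rw [Matrix.zero_mulVec]; exact zero_mem _
      | add x y _ _ hx hy => rw [Matrix.add_mulVec]; exact add_mem hx hy
      | smul c x _ hx => rw [Matrix.smul_mulVec]; exact Submodule.smul_mem _ c hx
    refine eq_top_iff.mpr fun w _ => ?_
    -- The matrix whose only nonzero column is the i-th, equal to w / v i, sends v to w.
    convert hall (Matrix.of fun a b => if b = i then w a / v i else 0)
    ext a
    simp [Matrix.mulVec, dotProduct, div_mul_cancel₀ _ hi]

end Irreducible

/-! ### The group attached to a pair (I, B) -/

section PinkGroup

open IsLocalRing

variable {A : Type*} [CommRing A]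

/-- This product formula and its two companions express Θ(xy) through Θ(x), Θ(y) and the
half-traces. Closure of `pinkGroup` under products thus needs only that half-traces preserve I and
B. -/
lemma pinkTheta_mul_apply_zero_zero (h2 : IsUnit (2 : A)) (x y : Matrix (Fin 2) (Fin 2) A) :
    pinkTheta (x * y) 0 0 = halfTrace x * pinkTheta y 0 0 + halfTrace y * pinkTheta x 0 0 +
      Ring.inverse 2 * (pinkTheta x 0 1 * pinkTheta y 1 0 - pinkTheta x 1 0 * pinkTheta y 0 1) := by
  have h := Ring.inverse_mul_cancel _ h2
  simp only [pinkTheta, halfTrace, Matrix.trace_fin_two, Matrix.mul_apply, Fin.sum_univ_two,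
    Matrix.sub_apply, Matrix.smul_apply, Matrix.one_apply_eq, smul_eq_mul, mul_one,
    Matrix.one_apply_ne zero_ne_one, Matrix.one_apply_ne one_ne_zero, mul_zero, sub_zero]
  linear_combination (-(x 0 1 * y 1 0 + x 0 0 * y 0 0 * (1 - Ring.inverse 2) - Ring.inverse 2 *
    (x 0 0 * y 1 1 + x 1 1 * y 0 0 + x 1 1 * y 1 1))) * h

lemma pinkTheta_mul_apply_zero_one (h2 : IsUnit (2 : A)) (x y : Matrix (Fin 2) (Fin 2) A) :
    pinkTheta (x * y) 0 1 = halfTrace x * pinkTheta y 0 1 + halfTrace y * pinkTheta x 0 1 +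
      (pinkTheta x 0 0 * pinkTheta y 0 1 - pinkTheta y 0 0 * pinkTheta x 0 1) := by
  rw [pinkTheta_apply_zero_one, Matrix.mul_apply, Fin.sum_univ_two, apply_zero_zero_eq x,
    apply_one_one_eq h2 y, ← pinkTheta_apply_zero_one x, ← pinkTheta_apply_zero_one y]
  ring

lemma pinkTheta_mul_apply_one_zero (h2 : IsUnit (2 : A)) (x y : Matrix (Fin 2) (Fin 2) A) :
    pinkTheta (x * y) 1 0 = halfTrace x * pinkTheta y 1 0 + halfTrace y * pinkTheta x 1 0 +
      (pinkTheta y 0 0 * pinkTheta x 1 0 - pinkTheta x 0 0 * pinkTheta y 1 0) := by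
  rw [pinkTheta_apply_one_zero, Matrix.mul_apply, Fin.sum_univ_two, apply_zero_zero_eq y,
    apply_one_one_eq h2 x, ← pinkTheta_apply_one_zero x, ← pinkTheta_apply_one_zero y]
  ring

lemma pinkTheta_inv (h2 : IsUnit (2 : A)) {g : GL (Fin 2) A} (hg : g.val.det = 1) :
    pinkTheta (g⁻¹).val = -pinkTheta g.val := by
  have h := congrArg pinkTheta (add_inv_of_det_eq_one hg)
  rw [pinkTheta_add, pinkTheta_smul] at h
  have h1 : pinkTheta (1 : Matrix (Fin 2) (Fin 2) A) = 0 := by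
    rw [pinkTheta, trace_one_fin_two, Ring.inverse_mul_cancel _ h2, one_smul, sub_self]
  rw [h1, smul_zero] at h
  exact (neg_eq_of_add_eq_zero_right h).symm

lemma mem_SR1_iff [IsLocalRing A] {g : GL (Fin 2) A} : g ∈ SR1 A ↔
    g.val.det = 1 ∧ ∀ i j, g.val i j - (1 : Matrix (Fin 2) (Fin 2) A) i j ∈ maximalIdeal A := by
  refine ⟨fun h => ⟨det_eq_one_of_mem_SR1 h, apply_sub_one_mem h⟩, fun h => ⟨Units.ext h.1, ?_⟩⟩
  refine Units.ext ?_
  ext i j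
  have h1 := h.2 i j
  rw [← residue_eq_zero_iff, map_sub, sub_eq_zero] at h1
  refine h1.trans ?_
  fin_cases i <;> fin_cases j <;> simp

variable [TopologicalSpace A] [IsTopologicalRing A]

lemma continuous_pinkTheta :
    Continuous (pinkTheta : Matrix (Fin 2) (Fin 2) A → Matrix (Fin 2) (Fin 2) A) := by
  unfold pinkTheta
  fun_prop

variable [IsLocalRing A] [CompactSpace A] [T2Space A]

lemma isClosed_SR1 : IsClosed (SR1 A : Set (GL (Fin 2) A)) := by
  have h : (SR1 A : Set (GL (Fin 2) A)) = {g | g.val.det = 1} ∩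
      ⋂ i, ⋂ j, {g | g.val i j - (1 : Matrix (Fin 2) (Fin 2) A) i j ∈ maximalIdeal A} := by
    ext g
    simp [mem_SR1_iff]
  rw [h]
  have hv : Continuous fun g : GL (Fin 2) A => g.val := Units.continuous_val
  refine (isClosed_eq (by fun_prop) continuous_const).inter ?_
  refine isClosed_iInter fun i => isClosed_iInter fun j => ?_
  exact isClosed_maximalIdeal_of_compact.preimage (by fun_prop : Continuous
    fun g : GL (Fin 2) A => g.val i j - (1 : Matrix (Fin 2) (Fin 2) A) i j)

variable {p : ℕ} {W : Type*} [CommRing W] [Algebra W A] {I B : Submodule W A}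

/-- The conditions on an element of `SR¹` that say that its image under `Θ` has diagonal entries in
`I` and off-diagonal entries in `B`. -/
structure IsPinkElement (I B : Submodule W A) (g : GL (Fin 2) A) : Prop where
  mem_SR1 : g ∈ SR1 A
  apply_zero_zero : pinkTheta g.val 0 0 ∈ I
  apply_zero_one : pinkTheta g.val 0 1 ∈ B
  apply_one_zero : pinkTheta g.val 1 0 ∈ B

/-- a² and bc multiply I and B into themselves. The multipliers form a closed submonoid, which
contains the square root because it is a limit of powers. -/
lemma IsPinkPair.sqrt_mem (h : IsPinkPair I B) (hp : 0 < p) (hodd : Odd p)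
    (hpm : (p : A) ∈ maximalIdeal A) (hIm : (I : Set A) ⊆ maximalIdeal A)
    {a b c : A} (ha : a ∈ I) (hb : b ∈ B) (hc : c ∈ B) :
    ∃ s ∈ multiplierSubalgebra I B, s ^ 2 = 1 + (a ^ 2 + b * c) ∧ s - 1 ∈ maximalIdeal A := by
  refine exists_sqrt_mem_of_isClosed hp hodd hpm (multiplierSubalgebra I B).toSubmonoid
    (isClosed_multiplierSubalgebra h.isClosed_left h.isClosed_right)
    (add_mem (Ideal.pow_mem_of_mem _ (hIm ha) 2 two_pos) (hIm (h.sq_mem b hb c hc))) ?_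
  refine (show _ ∈ multiplierSubalgebra I B from add_mem (one_mem _) (add_mem ?_ ?_))
  · rw [sq]
    exact h.mul_mem_multiplier_left ha ha
  · exact h.mul_mem_multiplier_right hb hc

lemma IsPinkElement.halfTrace_mem {g : GL (Fin 2) A} (hg : IsPinkElement I B g)
    (h : IsPinkPair I B) (hp : 0 < p) (hodd : Odd p) (hpm : (p : A) ∈ maximalIdeal A)
    (h2 : IsUnit (2 : A)) (hIm : (I : Set A) ⊆ maximalIdeal A) :
    halfTrace g.val ∈ multiplierSubalgebra I B := by
  obtain ⟨s, hs, hs2, hs1⟩ := h.sqrt_mem hp hodd hpm hIm hg.apply_zero_zero hg.apply_zero_one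
    hg.apply_one_zero
  rw [← halfTrace_sq h2 (det_eq_one_of_mem_SR1 hg.mem_SR1)] at hs2
  rwa [← eq_of_sq_eq_sq h2 hs2 hs1 (halfTrace_sub_one_mem h2 hg.mem_SR1)]

/-- The subgroup of `SR¹` of the elements whose image under `Θ` has diagonal entries in `I` and
off-diagonal entries in `B`. -/
def pinkGroup (h : IsPinkPair I B) (hp : 0 < p) (hodd : Odd p) (hpm : (p : A) ∈ maximalIdeal A)
    (h2 : IsUnit (2 : A)) (hIm : (I : Set A) ⊆ maximalIdeal A) : Subgroup (GL (Fin 2) A) where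
  carrier := {g | IsPinkElement I B g}
  one_mem' := by
    have h1 : pinkTheta (1 : Matrix (Fin 2) (Fin 2) A) = 0 := by
      rw [pinkTheta, trace_one_fin_two, Ring.inverse_mul_cancel _ h2, one_smul, sub_self]
    exact ⟨one_mem _, by simp [h1], by simp [h1], by simp [h1]⟩
  inv_mem' := by
    intro g hg
    have h1 := pinkTheta_inv h2 (det_eq_one_of_mem_SR1 hg.mem_SR1)
    exact ⟨inv_mem hg.mem_SR1, h1 ▸ neg_mem hg.apply_zero_zero, h1 ▸ neg_mem hg.apply_zero_one,
      h1 ▸ neg_mem hg.apply_one_zero⟩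
  mul_mem' := by
    intro x y hx hy
    have hsx := hx.halfTrace_mem h hp hodd hpm h2 hIm
    have hsy := hy.halfTrace_mem h hp hodd hpm h2 hIm
    refine ⟨mul_mem hx.mem_SR1 hy.mem_SR1, ?_, ?_, ?_⟩
    · rw [Units.val_mul, pinkTheta_mul_apply_zero_zero h2]
      refine add_mem (add_mem (hsx.1 _ hy.apply_zero_zero) (hsy.1 _ hx.apply_zero_zero)) ?_
      exact half_smul_mem (X := I.toAddSubgroup) hp hodd hpm (Ring.mul_inverse_cancel _ h2)
        h.isClosed_left (sub_mem (h.sq_mem _ hx.apply_zero_one _ hy.apply_one_zero)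
          (h.sq_mem _ hx.apply_one_zero _ hy.apply_zero_one))
    · rw [Units.val_mul, pinkTheta_mul_apply_zero_one h2]
      exact add_mem (add_mem (hsx.2 _ hy.apply_zero_one) (hsy.2 _ hx.apply_zero_one))
        (sub_mem (h.mul_mem _ hx.apply_zero_zero _ hy.apply_zero_one)
          (h.mul_mem _ hy.apply_zero_zero _ hx.apply_zero_one))
    · rw [Units.val_mul, pinkTheta_mul_apply_one_zero h2]
      exact add_mem (add_mem (hsx.2 _ hy.apply_one_zero) (hsy.2 _ hx.apply_one_zero))
        (sub_mem (h.mul_mem _ hy.apply_zero_zero _ hx.apply_one_zero)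
          (h.mul_mem _ hx.apply_zero_zero _ hy.apply_one_zero))

section

variable (h : IsPinkPair I B) (hp : 0 < p) (hodd : Odd p) (hpm : (p : A) ∈ maximalIdeal A)
    (h2 : IsUnit (2 : A)) (hIm : (I : Set A) ⊆ maximalIdeal A)

lemma isClosed_pinkGroup : IsClosed (pinkGroup h hp hodd hpm h2 hIm : Set (GL (Fin 2) A)) := by
  have hΘ : ∀ i j, Continuous fun g : GL (Fin 2) A => pinkTheta g.val i j := fun i j =>
    (continuous_pinkTheta.comp Units.continuous_val).matrix_elem i j
  have : (pinkGroup h hp hodd hpm h2 hIm : Set (GL (Fin 2) A)) = (SR1 A : Set (GL (Fin 2) A)) ∩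
      ((fun g : GL (Fin 2) A => pinkTheta g.val 0 0) ⁻¹' I ∩
      ((fun g : GL (Fin 2) A => pinkTheta g.val 0 1) ⁻¹' B ∩
      (fun g : GL (Fin 2) A => pinkTheta g.val 1 0) ⁻¹' B)) :=
    Set.ext fun g => ⟨fun hg => ⟨hg.1, hg.2, hg.3, hg.4⟩, fun hg => ⟨hg.1, hg.2.1, hg.2.2.1, hg.2.2.2⟩⟩
  rw [this]
  exact isClosed_SR1.inter ((h.isClosed_left.preimage (hΘ 0 0)).inter
    ((h.isClosed_right.preimage (hΘ 0 1)).inter (h.isClosed_right.preimage (hΘ 1 0))))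

/-- Every matrix in `(I B; B I)⁰` is in the image of `Θ`. -/
lemma exists_mem_pinkGroup (hBm : (B : Set A) ⊆ maximalIdeal A) {a b c : A} (ha : a ∈ I)
    (hb : b ∈ B) (hc : c ∈ B) :
    ∃ g ∈ pinkGroup h hp hodd hpm h2 hIm, pinkTheta g.val = !![a, b; c, -a] := by
  obtain ⟨s, hs, hs2, hs1⟩ := h.sqrt_mem hp hodd hpm hIm ha hb hc
  -- The choice of s makes the determinant s² - a² - bc equal to 1.
  let g : GL (Fin 2) A :=
    { val := !![s + a, b; c, s - a]
      inv := !![s - a, -b; -c, s + a]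
      val_inv := by
        ext i j
        fin_cases i <;> fin_cases j <;> simp [Matrix.mul_apply, Fin.sum_univ_two] <;>
          first | linear_combination hs2 | ring1
      inv_val := by
        ext i j
        fin_cases i <;> fin_cases j <;> simp [Matrix.mul_apply, Fin.sum_univ_two] <;>
          first | linear_combination hs2 | ring }
  have hΘ : pinkTheta g.val = !![a, b; c, -a] := by
    have hh := Ring.inverse_mul_cancel _ h2
    ext i j
    fin_cases i <;> fin_cases j <;> simp [pinkTheta, g] <;> linear_combination (-s) * hh
  refine ⟨g, ⟨mem_SR1_iff.mpr ⟨?_, fun i j => ?_⟩, ?_, ?_, ?_⟩, hΘ⟩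
  · rw [Matrix.det_fin_two]
    simp only [g, Matrix.of_apply, Matrix.cons_val', Matrix.cons_val_zero, Matrix.cons_val_one,
      Matrix.cons_val_fin_one]
    linear_combination hs2
  · have ham := hIm ha
    have hbm := hBm hb
    have hcm := hBm hc
    fin_cases i <;> fin_cases j <;> simp [g]
    · rw [add_sub_right_comm]
      exact add_mem hs1 ham
    · exact hbm
    · exact hcm
    · rw [sub_right_comm]
      exact sub_mem hs1 ham
  all_goals rw [hΘ]
  · simpa using ha
  · simpa using hb
  · simpa using hc

end

end PinkGroup

/-! ### Products with a normalizing subgroup -/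

section MulSubgroup

variable {G : Type*} [Group G]

/-- The product `D Γ` of a subgroup `Γ` and a subgroup `D` normalizing it. -/
def mulSubgroup (D Γ : Subgroup G) (hn : ∀ d ∈ D, ∀ g ∈ Γ, d * g * d⁻¹ ∈ Γ) : Subgroup G where
  carrier := {g | ∃ d ∈ D, d⁻¹ * g ∈ Γ}
  one_mem' := ⟨1, one_mem D, by simp⟩
  mul_mem' := by
    rintro g g' ⟨d, hd, hg⟩ ⟨d', hd', hg'⟩
    refine ⟨d * d', mul_mem hd hd', ?_⟩
    have := mul_mem (hn d'⁻¹ (inv_mem hd') _ hg) hg'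
    convert this using 1
    group
  inv_mem' := by
    rintro g ⟨d, hd, hg⟩
    refine ⟨d⁻¹, inv_mem hd, ?_⟩
    convert hn d hd _ (inv_mem hg) using 1
    group

lemma isClosed_mulSubgroup [TopologicalSpace G] [ContinuousMul G] {D Γ : Subgroup G}
    (hn : ∀ d ∈ D, ∀ g ∈ Γ, d * g * d⁻¹ ∈ Γ) (hD : (D : Set G).Finite) (hΓ : IsClosed (Γ : Set G)) :
    IsClosed (mulSubgroup D Γ hn : Set G) := by
  have : (mulSubgroup D Γ hn : Set G) = ⋃ d ∈ (D : Set G), (d⁻¹ * ·) ⁻¹' (Γ : Set G) := by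
    ext g
    simp only [Set.mem_iUnion, Set.mem_preimage, SetLike.mem_coe, exists_prop]
    rfl
  rw [this]
  exact hD.isClosed_biUnion fun d _ => hΓ.preimage (continuous_const_mul d⁻¹)

end MulSubgroup

/-! ### Trace and determinant of a representation -/

section PseudoRep

variable {A P : Type*} [CommRing A] [Group P]

/-- The determinant of a representation, with values in the multiplicative monoid of the ring. -/
def detHom (ρ : P →* GL (Fin 2) A) : P →* A :=
  (Matrix.detMonoidHom : Matrix (Fin 2) (Fin 2) A →* A).comp ((Units.coeHom _).comp ρ)

lemma isPseudoRep_trace (ρ : P →* GL (Fin 2) A) :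
    IsPseudoRep (fun g => (ρ g).val.trace) (detHom ρ) where
  central x y := by
    rw [map_mul, map_mul, Units.val_mul, Units.val_mul, Matrix.trace_mul_comm]
  map_one := by
    rw [map_one, Units.val_one, trace_one_fin_two]
  identity x y := by
    -- With the adjugate in place of the inverse, the identity becomes a polynomial identity in the
    -- entries.
    have h : (detHom ρ y) • (ρ y⁻¹).val = (ρ y).val.adjugate := by
      have h1 : (ρ y).val.adjugate * (ρ y).val = detHom ρ y • 1 := Matrix.adjugate_mul _
      have h2 : (ρ y).val * (ρ y⁻¹).val = 1 := by
        rw [← Units.val_mul, ← map_mul, mul_inv_cancel, map_one, Units.val_one]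
      have h3 := congrArg (· * (ρ y⁻¹).val) h1
      simp only [mul_assoc, h2, mul_one, Matrix.smul_mul, one_mul] at h3
      exact h3.symm
    rw [map_mul, map_mul, Units.val_mul, Units.val_mul, ← smul_eq_mul (detHom ρ y),
      ← Matrix.trace_smul, ← Matrix.mul_smul, h, Matrix.adjugate_fin_two]
    simp [Matrix.trace_fin_two, Matrix.mul_apply]
    ring

lemma monomialSubgroup_le_range_map {F A' : Type*} [Field F] [CommRing A'] {τ : F →* A}
    {ρ : P →* GL (Fin 2) A} (h : monomialSubgroup τ ≤ ρ.range) (f : A →+* A') :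
    monomialSubgroup ((f : A →* A').comp τ) ≤ ((Matrix.GeneralLinearGroup.map f).comp ρ).range := by
  rintro _ (⟨x, y, rfl⟩ | ⟨x, y, rfl⟩)
  · obtain ⟨g, hg⟩ := h (diagGL_mem_monomialSubgroup τ x y)
    exact ⟨g, by rw [MonoidHom.comp_apply, hg, map_diagGL]⟩
  · obtain ⟨g, hg⟩ := h (antidiagGL_mem_monomialSubgroup τ x y)
    exact ⟨g, by rw [MonoidHom.comp_apply, hg, map_antidiagGL]⟩

end PseudoRep

/-! ### Conjugation by constant monomial matrices -/

section Normalization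

open IsLocalRing

variable {p : ℕ} [Fact p.Prime] {F A : Type*} [Field F] [CommRing A] [Algebra (WittVector p F) A]

lemma constLift_mul_mem (N : Submodule (WittVector p F) A) (x : F) {a : A} (ha : a ∈ N) :
    constLift p x * a ∈ N := by
  have := N.smul_mem (WittVector.teichmuller p x) ha
  rwa [Algebra.smul_def] at this

variable [IsLocalRing A] {I B : Submodule (WittVector p F) A}

/-- Diagonal matrices scale the off-diagonal entries by constants; antidiagonal ones also exchange
them and negate the diagonal. I and B are W(F)-modules, so both conditions persist. -/
lemma IsPinkElement.conj (h2 : IsUnit (2 : A)) {d : GL (Fin 2) A}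
    (hd : d ∈ monomialSubgroup (constLift p (F := F) (A := A))) {g : GL (Fin 2) A}
    (hg : IsPinkElement I B g) : IsPinkElement I B (d * g * d⁻¹) := by
  have hΘ : pinkTheta (d * g * d⁻¹).val = d.val * pinkTheta g.val * (d⁻¹).val := by
    rw [Units.val_mul, Units.val_mul,
      pinkTheta_conj (by rw [← Units.val_mul, inv_mul_cancel, Units.val_one])]
  have h11 := apply_one_one_of_trace_eq_zero (trace_pinkTheta h2 g.val)
  have hI : ∀ x : Fˣ, constLift p (x : F) * pinkTheta g.val 0 0 * constLift p ((x⁻¹ : Fˣ) : F) ∈ I := by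
    intro x
    rw [mul_comm]
    exact constLift_mul_mem I _ (constLift_mul_mem I _ hg.apply_zero_zero)
  have hB : ∀ x y : F, ∀ b ∈ B, constLift p x * b * constLift p y ∈ B := by
    intro x y b hb
    rw [mul_comm]
    exact constLift_mul_mem B _ (constLift_mul_mem B _ hb)
  refine ⟨SR1_conj_mem hg.mem_SR1 d, ?_, ?_, ?_⟩ <;> rw [hΘ] <;>
    obtain ⟨x, y, rfl⟩ | ⟨x, y, rfl⟩ := hd
  · convert hI x using 1
    simp [diagGL, Matrix.mul_apply, Matrix.vecMul, dotProduct, Fin.sum_univ_two]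
  · convert neg_mem (hI x) using 1
    simp [antidiagGL, Matrix.mul_apply, Matrix.vecMul, dotProduct, Fin.sum_univ_two, h11]
  · convert hB x (y⁻¹ : Fˣ) _ hg.apply_zero_one using 1
    simp [diagGL, Matrix.mul_apply, Matrix.vecMul, dotProduct, Fin.sum_univ_two]
  · convert hB x (y⁻¹ : Fˣ) _ hg.apply_one_zero using 1
    simp [antidiagGL, Matrix.mul_apply, Matrix.vecMul, dotProduct, Fin.sum_univ_two]
  · convert hB y (x⁻¹ : Fˣ) _ hg.apply_one_zero using 1
    simp [diagGL, Matrix.mul_apply, Matrix.vecMul, dotProduct, Fin.sum_univ_two]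
  · convert hB y (x⁻¹ : Fˣ) _ hg.apply_zero_one using 1
    simp [antidiagGL, Matrix.mul_apply, Matrix.vecMul, dotProduct, Fin.sum_univ_two]

lemma map_eq_one_of_mem_SR1 {res : A →+* F}
    (hres : ∀ x : WittVector p F, res (algebraMap (WittVector p F) A x) = x.coeff 0)
    {g : GL (Fin 2) A} (hg : g ∈ SR1 A) : Matrix.GeneralLinearGroup.map res g = 1 := by
  refine Units.ext ?_
  ext i j
  have h := (res_eq_zero_iff hres).mpr (apply_sub_one_mem hg i j)
  rw [map_sub, sub_eq_zero] at h
  refine h.trans ?_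
  fin_cases i <;> fin_cases j <;> simp

omit [IsLocalRing A] in
lemma coe_comp_constLift {res : A →+* F}
    (hres : ∀ x : WittVector p F, res (algebraMap (WittVector p F) A x) = x.coeff 0) :
    (res : A →* F).comp (constLift p) = MonoidHom.id F :=
  MonoidHom.ext fun x => res_constLift hres x

/-- The Teichmüller lift is a section of the residue map, so a constant matrix is determined by its
reduction. -/
lemma eq_one_of_mem_monomialSubgroup_of_mem_SR1 {res : A →+* F}
    (hres : ∀ x : WittVector p F, res (algebraMap (WittVector p F) A x) = x.coeff 0)
    {d : GL (Fin 2) A} (hd : d ∈ monomialSubgroup (constLift p (F := F) (A := A)))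
    (hd1 : d ∈ SR1 A) : d = 1 := by
  have h := map_eq_one_of_mem_SR1 hres hd1
  obtain ⟨x, y, rfl⟩ | ⟨x, y, rfl⟩ := hd
  · rw [map_diagGL, coe_comp_constLift hres] at h
    have h0 := congrArg (fun u : GL (Fin 2) F => u.val 0 0) h
    have h1 := congrArg (fun u : GL (Fin 2) F => u.val 1 1) h
    simp only [diagGL, MonoidHom.id_apply, Units.val_one, Matrix.one_apply_eq, Matrix.of_apply,
      Matrix.cons_val', Matrix.cons_val_zero, Matrix.cons_val_one, Matrix.cons_val_fin_one,
      Units.val_eq_one] at h0 h1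
    rw [h0, h1, diagGL_one]
  · rw [map_antidiagGL, coe_comp_constLift hres] at h
    have h0 := congrArg (fun u : GL (Fin 2) F => u.val 0 1) h
    simp [antidiagGL] at h0

variable [TopologicalSpace A] [IsTopologicalRing A] [CompactSpace A] [T2Space A]

omit [Fact p.Prime] in
lemma totallyDisconnectedSpace_GL (hp : 0 < p) (hpm : (p : A) ∈ maximalIdeal A) :
    TotallyDisconnectedSpace (GL (Fin 2) A) := by
  have := totallyDisconnectedSpace_of_compact hp hpm
  have h : TotallyDisconnectedSpace (Matrix (Fin 2) (Fin 2) A) :=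
    inferInstanceAs (TotallyDisconnectedSpace (Fin 2 → Fin 2 → A))
  exact ⟨isTotallyDisconnected_of_image (f := Units.val) Units.continuous_val.continuousOn
    Units.val_injective (isTotallyDisconnected_of_totallyDisconnectedSpace _)⟩

end Normalization

/-! ### Topological finite generation implies Mazur's condition -/

section PFiniteness

variable {P : Type*} [Group P] [TopologicalSpace P] [IsTopologicalGroup P]

/-- An open subgroup H has finite index, so by Schreier its intersection with a dense finitely
generated subgroup is finitely generated. That intersection is dense in H, and its image is dense in
the quotient. -/
lemma TopologicallyFG.pFiniteness [CompactSpace P] (p : ℕ) (h : TopologicallyFG P) :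
    PFiniteness p P := by
  intro H hH
  obtain ⟨S, hS, hd⟩ := h
  let Q := Subgroup.closure S
  have hQ : Group.FG Q := (Group.fg_iff_subgroup_fg _).mpr ⟨hS.toFinset, by rw [hS.coe_toFinset]⟩
  have : Finite (P ⧸ H) := Subgroup.quotient_finite_of_isOpen H hH
  have : H.FiniteIndex := Subgroup.finiteIndex_of_finite_quotient
  have hfg : Group.FG (H.subgroupOf Q) := Subgroup.fg_of_index_ne_zero _
  let f : H.subgroupOf Q →* H :=
    { toFun := fun x => ⟨x.1.1, x.2⟩
      map_one' := rfl
      map_mul' := fun _ _ => rfl }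
  let q := QuotientGroup.mk' (proPKernel p H)
  obtain ⟨T, hT⟩ := (Group.fg_iff_subgroup_fg _).mp (Group.fg_range (q.comp f))
  refine ⟨T, T.finite_toSet, ?_⟩
  rw [hT]
  have h1 : Dense (Subtype.val ⁻¹' (Q : Set P) : Set H) := hd.preimage hH.isOpenMap_subtype_val
  have h2 := (QuotientGroup.mk_surjective (s := proPKernel p H)).denseRange.dense_image
    QuotientGroup.continuous_mk h1
  refine h2.mono ?_
  rintro _ ⟨x, hx, rfl⟩
  exact ⟨⟨⟨x.1, hx⟩, x.2⟩, rfl⟩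

lemma topologicallyFG_topologicalClosure {S : Set P} (hS : S.Finite) :
    TopologicallyFG (Subgroup.closure S).topologicalClosure := by
  set Q := (Subgroup.closure S).topologicalClosure with hQ
  have hSQ : S ⊆ Q := Subgroup.subset_closure.trans (Subgroup.le_topologicalClosure _)
  refine ⟨Subtype.val ⁻¹' S, hS.preimage Subtype.val_injective.injOn, ?_⟩
  have h1 : (Subgroup.closure (Subtype.val ⁻¹' S : Set Q)).map Q.subtype = Subgroup.closure S := by
    rw [MonoidHom.map_closure]
    congr 1
    exact Subtype.image_preimage_val (Q : Set P) S ▸ Set.inter_eq_right.mpr hSQ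
  refine Subtype.dense_iff.mpr fun x hx => ?_
  have h2 : Subtype.val '' (Subgroup.closure (Subtype.val ⁻¹' S : Set Q) : Set Q) =
      (Subgroup.closure S : Set P) := by
    rw [← h1]
    rfl
  exact (congrArg closure h2).ge hx

end PFiniteness

/-! ### Construction of the group -/

section Construction

open IsLocalRing

variable {p : ℕ} [Fact p.Prime] {F A : Type*} [Field F] [Finite F] [CharP F p] [CommRing A]
  [IsLocalRing A] [TopologicalSpace A] [IsTopologicalRing A] [CompactSpace A] [T2Space A]
  [Algebra (WittVector p F) A] {res : A →+* F} {I B : Submodule (WittVector p F) A}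

/-- X need not be a W(F)-module. The elements whose Teichmüller multiples all map into X do form a
closed subgroup stable under Teichmüller representatives, hence under W(F). -/
lemma apply_smul_mem_of_constLift (hpm : (p : A) ∈ maximalIdeal A)
    {f : A →+ Matrix (Fin 2) (Fin 2) A} (hf : Continuous f)
    {X : AddSubgroup (Matrix (Fin 2) (Fin 2) A)} (hX : IsClosed (X : Set (Matrix (Fin 2) (Fin 2) A)))
    {a : A} (ha : ∀ x : F, f (constLift p x * a) ∈ X) (w : WittVector p F) : f (w • a) ∈ X := by
  let Y : AddSubgroup A :=
    { carrier := {c | ∀ x : F, f (constLift p x * c) ∈ X}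
      add_mem' := fun {c c'} hc hc' x => by rw [mul_add, map_add]; exact add_mem (hc x) (hc' x)
      zero_mem' := fun x => by rw [mul_zero, map_zero]; exact zero_mem X
      neg_mem' := fun {c} hc x => by rw [mul_neg, map_neg]; exact neg_mem (hc x) }
  have hY : IsClosed (Y : Set A) := by
    have : (Y : Set A) = ⋂ x : F, (fun c => f (constLift p x * c)) ⁻¹' X := by
      ext c
      simp only [Set.mem_iInter]
      rfl
    rw [this]
    exact isClosed_iInter fun x => hX.preimage (hf.comp (continuous_const_mul _))
  have h := smul_mem_of_teichmuller hpm (algebraMap (WittVector p F) A) hY (fun x m hm y => by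
    have := hm (y * x)
    rwa [map_mul (constLift p), mul_assoc] at this) w (m := a) ha 1
  rwa [map_one, one_mul, smul_eq_mul, ← Algebra.smul_def] at h

/-- The elements all of whose `W`-multiples are mapped into `X` by `f`. -/
def scalarPreimage {R M : Type*} [CommRing R] [AddCommGroup M] [Algebra R A] (f : A →+ M)
    (X : AddSubgroup M) : Submodule R A where
  carrier := {a | ∀ w : R, f (w • a) ∈ X}
  add_mem' := fun {a b} ha hb w => by rw [smul_add, map_add]; exact add_mem (ha w) (hb w)
  zero_mem' := fun w => by rw [smul_zero, map_zero]; exact zero_mem X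
  smul_mem' := fun v a ha w => by rw [smul_smul]; exact ha _

omit [Finite F] [CharP F p] [IsLocalRing A] [CompactSpace A] [T2Space A] in
lemma isClosed_scalarPreimage {f : A →+ Matrix (Fin 2) (Fin 2) A} (hf : Continuous f)
    {X : AddSubgroup (Matrix (Fin 2) (Fin 2) A)} (hX : IsClosed (X : Set (Matrix (Fin 2) (Fin 2) A))) :
    IsClosed (scalarPreimage (R := WittVector p F) f X : Set A) := by
  have : (scalarPreimage (R := WittVector p F) f X : Set A) =
      ⋂ w : WittVector p F, (fun a => f (algebraMap _ A w * a)) ⁻¹' X := by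
    ext a
    simp only [Set.mem_iInter, Set.mem_preimage, ← Algebra.smul_def]
    rfl
  rw [this]
  exact isClosed_iInter fun w => hX.preimage (hf.comp (continuous_const_mul _))

omit [IsLocalRing A] [CompactSpace A] [T2Space A] in
lemma continuous_diagMap : Continuous (diagMap A A : A → Matrix (Fin 2) (Fin 2) A) := by
  change Continuous fun a : A => !![a, 0; 0, -a]
  refine continuous_matrix fun i j => ?_
  fin_cases i <;> fin_cases j <;> simp <;> fun_prop

omit [IsLocalRing A] [IsTopologicalRing A] [CompactSpace A] [T2Space A] in
lemma continuous_upperMap : Continuous (upperMap A A : A → Matrix (Fin 2) (Fin 2) A) := by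
  change Continuous fun a : A => !![0, a; 0, 0]
  refine continuous_matrix fun i j => ?_
  fin_cases i <;> fin_cases j <;> simp <;> fun_prop

section Monomial

variable {X : AddSubgroup (Matrix (Fin 2) (Fin 2) A)}

omit [Finite F] [CharP F p] [IsLocalRing A] [TopologicalSpace A] [IsTopologicalRing A]
  [CompactSpace A] [T2Space A] in
lemma diagGL_conj_upper_mem
    (hconj : ∀ d ∈ monomialSubgroup (constLift p (F := F) (A := A)), ∀ x ∈ X, ∀ y,
      y * d.val = d.val * x → y ∈ X) {b : A} (hb : !![0, b; 0, 0] ∈ X) (x : F) :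
    !![0, constLift p x * b; 0, 0] ∈ X := by
  rcases eq_or_ne x 0 with rfl | hx
  · have : constLift p (0 : F) (A := A) = 0 := by simp [constLift]
    rw [this, zero_mul]
    convert zero_mem X
    ext i j; fin_cases i <;> fin_cases j <;> rfl
  · refine hconj _ (diagGL_mem_monomialSubgroup _ (Units.mk0 x hx) 1) _ hb _ ?_
    ext i j; fin_cases i <;> fin_cases j <;> simp [diagGL, Matrix.mul_apply, Fin.sum_univ_two]

omit [Finite F] [CharP F p] [IsLocalRing A] [TopologicalSpace A] [IsTopologicalRing A]
  [CompactSpace A] [T2Space A] in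
lemma antidiagGL_conj_lower_mem
    (hconj : ∀ d ∈ monomialSubgroup (constLift p (F := F) (A := A)), ∀ x ∈ X, ∀ y,
      y * d.val = d.val * x → y ∈ X) {b : A} (hb : !![0, b; 0, 0] ∈ X) :
    !![0, 0; b, 0] ∈ X := by
  refine hconj _ (antidiagGL_mem_monomialSubgroup _ 1 1) _ hb _ ?_
  ext i j; fin_cases i <;> fin_cases j <;> simp [antidiagGL, Matrix.mul_apply, Fin.sum_univ_two]

-- In each product the Witt scalar can be attached to one factor, after which Pink's operations on X
-- apply. Conjugation by the antidiagonal matrix turns an upper entry into a lower one.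
omit [Finite F] [CharP F p] [IsLocalRing A] [CompactSpace A] [T2Space A] in
lemma isPinkPair_scalarPreimage (hX : IsClosed (X : Set (Matrix (Fin 2) (Fin 2) A)))
    (hPink : PinkClosed X) (h2 : IsUnit (2 : A))
    (hconj : ∀ d ∈ monomialSubgroup (constLift p (F := F) (A := A)), ∀ x ∈ X, ∀ y,
      y * d.val = d.val * x → y ∈ X) :
    IsPinkPair (scalarPreimage (R := WittVector p F) (diagMap A A).toAddMonoidHom X)
      (scalarPreimage (R := WittVector p F) (upperMap A A).toAddMonoidHom X) where
  isClosed_left := isClosed_scalarPreimage continuous_diagMap hX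
  isClosed_right := isClosed_scalarPreimage continuous_upperMap hX
  sq_mem b hb c hc w := by
    rw [← smul_mul_assoc]
    have hc1 : !![0, c; 0, 0] ∈ X := by
      have := hc 1
      rwa [one_smul] at this
    exact hPink.diag_mul (hb w) (antidiagGL_conj_lower_mem hconj hc1)
  mul_mem a ha b hb w := by
    rw [← smul_mul_assoc]
    have hb1 : !![0, b; 0, 0] ∈ X := by
      have := hb 1
      rwa [one_smul] at this
    exact hPink.upper_mul h2 (ha w) hb1
  cube_mem a ha b hb c hc w := by
    rw [← smul_mul_assoc, ← smul_mul_assoc]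
    have hb1 := hb 1
    have hc1 := hc 1
    rw [one_smul] at hb1 hc1
    exact hPink.diag_triple h2 (ha w) hb1 hc1

omit [Finite F] [CharP F p] [IsLocalRing A] [TopologicalSpace A] [IsTopologicalRing A]
  [CompactSpace A] [T2Space A] in
lemma mem_of_traceZero (hconj : ∀ d ∈ monomialSubgroup (constLift p (F := F) (A := A)), ∀ x ∈ X, ∀ y,
      y * d.val = d.val * x → y ∈ X)
    (hI : I ≤ scalarPreimage (diagMap A A).toAddMonoidHom X)
    (hB : B ≤ scalarPreimage (upperMap A A).toAddMonoidHom X) {x : Matrix (Fin 2) (Fin 2) A}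
    (hx : x ∈ traceZero (I : Set A) B) : x ∈ X := by
  obtain ⟨ht, h1, -, h2, h3⟩ := hx
  have h1 := hI h1 1
  have h2 := hB h2 1
  have h3 := hB h3 1
  rw [one_smul] at h1 h2 h3
  have h11 := apply_one_one_of_trace_eq_zero ht
  convert add_mem (add_mem h1 h2) (antidiagGL_conj_lower_mem hconj h3) using 1
  ext i j; fin_cases i <;> fin_cases j <;> simp [h11, diagMap, upperMap]

end Monomial

/-- There is a closed subgroup between the monomial matrices and the group of all products of a
monomial matrix and an element of `pinkGroup` whose Lie algebra contains `(I B; B I)⁰`; if `A` is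
noetherian it can be chosen topologically finitely generated. -/
theorem exists_subgroup_traceZero_subset (hp : p ≠ 2)
    (hres : ∀ x : WittVector p F, res (algebraMap (WittVector p F) A x) = x.coeff 0)
    (hIc : IsClosed (I : Set A)) (hBc : IsClosed (B : Set A))
    (hIm : (I : Set A) ⊆ maximalIdeal A) (hBm : (B : Set A) ⊆ maximalIdeal A)
    (hcond : StructureConditions (WittVector p F) I.toAddSubgroup B.toAddSubgroup) :
    ∃ P : Subgroup (GL (Fin 2) A), IsClosed (P : Set (GL (Fin 2) A)) ∧
      monomialSubgroup (constLift p (F := F) (A := A)) ≤ P ∧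
      (∀ g ∈ P, ∃ d ∈ monomialSubgroup (constLift p (F := F) (A := A)),
        IsPinkElement I B (d⁻¹ * g)) ∧
      traceZero (I : Set A) B ⊆ pinkLie (P ⊓ SR1 A) ∧
      (IsNoetherianRing A → TopologicallyFG P) := by
  have hpm := natCast_prime_mem_maximalIdeal hres
  have h2 : IsUnit (2 : A) := isUnit_two_of_odd hp hres
  have hodd : Odd p := (Fact.out : p.Prime).odd_of_ne_two hp
  have hp0 : 0 < p := (Fact.out : p.Prime).pos
  have h := hcond.isPinkPair hIc hBc
  let D := monomialSubgroup (constLift p (F := F) (A := A))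
  let Γ := pinkGroup h hp0 hodd hpm h2 hIm
  have hn : ∀ d ∈ D, ∀ g ∈ Γ, d * g * d⁻¹ ∈ Γ := fun d hd g hg => IsPinkElement.conj h2 hd hg
  have hGc : IsClosed (mulSubgroup D Γ hn : Set (GL (Fin 2) A)) :=
    isClosed_mulSubgroup hn (finite_monomialSubgroup _) (isClosed_pinkGroup h hp0 hodd hpm h2 hIm)
  have hDG : D ≤ mulSubgroup D Γ hn := fun d hd => ⟨d, hd, by
    rw [inv_mul_cancel]
    exact one_mem Γ⟩
  have hΓG : Γ ≤ mulSubgroup D Γ hn := fun g hg => ⟨1, one_mem D, by rwa [inv_one, one_mul]⟩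
  have hΓSR : Γ ≤ SR1 A := fun g hg => IsPinkElement.mem_SR1 hg
  have hex : ∀ x ∈ traceZero (I : Set A) B, ∃ g ∈ Γ, pinkTheta g.val = x := by
    rintro x ⟨ht, h1, -, h3, h4⟩
    obtain ⟨g, hg, hΘ⟩ := exists_mem_pinkGroup h hp0 hodd hpm h2 hIm hBm h1 h3 h4
    refine ⟨g, hg, hΘ.trans ?_⟩
    rw [← apply_one_one_of_trace_eq_zero ht]
    exact (Matrix.eta_fin_two x).symm
  -- Finite generation is only asked for noetherian A; otherwise the full product DΓ serves.
  by_cases hA : IsNoetherianRing A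
  · obtain ⟨S, T, hS, hT, hST⟩ := exists_finset_generators hres hIc hBc hIm hBm hcond
    choose! γ hγ hΘ using hex
    have hdiag : ∀ a ∈ I, diagMap A A a ∈ traceZero (I : Set A) B := fun a ha =>
      ⟨by simp [diagMap], by simpa [diagMap] using ha, by simpa [diagMap] using ha,
        by simp [diagMap], by simp [diagMap]⟩
    have hupper : ∀ b ∈ B, upperMap A A b ∈ traceZero (I : Set A) B := fun b hb =>
      ⟨by simp [upperMap, Matrix.trace_fin_two], by simp [upperMap], by simp [upperMap],
        by simpa [upperMap] using hb, by simp [upperMap]⟩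
    -- Conjugation by D acts on diagonal matrices only by signs, so the Teichmüller multiples of S
    -- are put in by hand. Those of T arise by conjugation.
    let Y : Set (Matrix (Fin 2) (Fin 2) A) :=
      ((fun q : F × A => diagMap A A (constLift p q.1 * q.2)) '' (Set.univ ×ˢ (S : Set A))) ∪
        upperMap A A '' T
    have hY : Y.Finite := ((Set.finite_univ.prod S.finite_toSet).image _).union
      (T.finite_toSet.image _)
    have hYL : Y ⊆ traceZero (I : Set A) B := by
      rintro _ (⟨⟨x, a⟩, ⟨-, ha⟩, rfl⟩ | ⟨b, hb, rfl⟩)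
      · exact hdiag _ (constLift_mul_mem I x (hS ha))
      · exact hupper _ (hT hb)
    let Z : Set (GL (Fin 2) A) := D ∪ γ '' Y
    let P := (Subgroup.closure Z).topologicalClosure
    have hZP : Z ⊆ P := Subgroup.subset_closure.trans (Subgroup.le_topologicalClosure _)
    have hDP : D ≤ P := fun d hd => hZP (Or.inl hd)
    have hPG : P ≤ mulSubgroup D Γ hn := by
      refine Subgroup.topologicalClosure_minimal _ ((Subgroup.closure_le _).mpr ?_) hGc
      rintro _ (hd | ⟨y, hy, rfl⟩)
      · exact hDG hd
      · exact hΓG (hγ y (hYL hy))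
    refine ⟨P, Subgroup.isClosed_topologicalClosure _, hDP, fun g hg => hPG hg, ?_, fun _ =>
      topologicallyFG_topologicalClosure ((finite_monomialSubgroup _).union (hY.image _))⟩
    have hXc := isClosed_pinkLie (P ⊓ SR1 A)
    have hYX : ∀ y ∈ Y, y ∈ pinkLie (P ⊓ SR1 A) := by
      intro y hy
      rw [← hΘ y (hYL hy)]
      exact pinkTheta_mem_pinkLie ⟨hZP (Or.inr ⟨y, hy, rfl⟩), hΓSR (hγ y (hYL hy))⟩
    have hconj : ∀ d ∈ D, ∀ x ∈ pinkLie (P ⊓ SR1 A), ∀ y, y * d.val = d.val * x →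
        y ∈ pinkLie (P ⊓ SR1 A) := fun d hd x hx y hy =>
      conj_mem_pinkLie (fun g hg => Subgroup.mem_inf.mpr
        ⟨P.mul_mem (P.mul_mem (hDP hd) hg.1) (P.inv_mem (hDP hd)), SR1_conj_mem hg.2 d⟩) hx hy
    -- The scalar preimages of the Lie algebra of P form a Pink pair containing S and T, hence
    -- contain I and B.
    obtain ⟨hI', hB'⟩ := hST _ _ (isPinkPair_scalarPreimage hXc
      (pinkClosed_pinkLie hp0 hodd hpm h2 inf_le_right) h2 hconj)
      (fun a ha => apply_smul_mem_of_constLift hpm continuous_diagMap hXc fun x =>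
        hYX _ (Or.inl ⟨(x, a), ⟨trivial, ha⟩, rfl⟩))
      (fun b hb => apply_smul_mem_of_constLift hpm continuous_upperMap hXc fun x =>
        diagGL_conj_upper_mem hconj (hYX _ (Or.inr ⟨b, hb, rfl⟩)) x)
    exact fun x hx => mem_of_traceZero hconj hI' hB' hx
  · refine ⟨mulSubgroup D Γ hn, hGc, hDG, fun g hg => hg, fun x hx => ?_, fun h => absurd h hA⟩
    obtain ⟨g, hg, rfl⟩ := hex x hx
    exact pinkTheta_mem_pinkLie ⟨hΓG hg, hΓSR hg⟩

end Construction

/-! ### Verification that the group realizes the pair (I, B) -/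

section Optimality

open IsLocalRing

variable {p : ℕ} [Fact p.Prime] {F A : Type*} [Field F] [Finite F] [CharP F p] [CommRing A]
  [IsLocalRing A] [TopologicalSpace A] [IsTopologicalRing A] [CompactSpace A] [T2Space A]
  [Algebra (WittVector p F) A] {res : A →+* F} {I B : Submodule (WittVector p F) A}

/-- The submodule `(I B; B I)⁰`. -/
def traceZeroSubmodule {R A : Type*} [CommRing R] [CommRing A] [Algebra R A] (I B : Submodule R A) :
    Submodule R (Matrix (Fin 2) (Fin 2) A) where
  carrier := traceZero I B
  add_mem' := fun {x y} hx hy => ⟨by rw [Matrix.trace_add, hx.1, hy.1, add_zero],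
    add_mem hx.2.1 hy.2.1, add_mem hx.2.2.1 hy.2.2.1, add_mem hx.2.2.2.1 hy.2.2.2.1,
    add_mem hx.2.2.2.2 hy.2.2.2.2⟩
  zero_mem' := ⟨by simp, by simp, by simp, by simp, by simp⟩
  smul_mem' := fun w x hx => ⟨by rw [Matrix.trace_smul, hx.1, smul_zero],
    I.smul_mem w hx.2.1, I.smul_mem w hx.2.2.1, B.smul_mem w hx.2.2.2.1, B.smul_mem w hx.2.2.2.2⟩

omit [Finite F] [CharP F p] [IsLocalRing A] [CompactSpace A] in
lemma isClosed_traceZero (hI : IsClosed (I : Set A)) (hB : IsClosed (B : Set A)) :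
    IsClosed (traceZero (I : Set A) B) := by
  have hc : ∀ i j, Continuous fun x : Matrix (Fin 2) (Fin 2) A => x i j := fun i j => by fun_prop
  have h0 : IsClosed {x : Matrix (Fin 2) (Fin 2) A | x.trace = 0} :=
    isClosed_eq (by fun_prop) continuous_const
  exact h0.inter ((hI.preimage (hc 0 0)).inter ((hI.preimage (hc 1 1)).inter
    ((hB.preimage (hc 0 1)).inter (hB.preimage (hc 1 0)))))

omit [Finite F] [IsLocalRing A] [TopologicalSpace A] [IsTopologicalRing A] [CompactSpace A]
  [T2Space A] in
lemma exists_inv_algebraMap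
    (hres : ∀ x : WittVector p F, res (algebraMap (WittVector p F) A x) = x.coeff 0)
    {ζ : Fˣ} (hζ : ζ ≠ 1) :
    ∃ v : WittVector p F, algebraMap _ A v * (constLift p (ζ : F) - 1) = 1 := by
  let w : WittVector p F := WittVector.teichmuller p (ζ : F) - 1
  have hw : w.coeff 0 ≠ 0 := by
    rw [← hres, map_sub, map_sub, map_one, map_one, hres, WittVector.teichmuller_coeff_zero,
      sub_ne_zero]
    exact fun h => hζ (Units.ext h)
  obtain ⟨u, hu⟩ := WittVector.isUnit_of_coeff_zero_ne_zero w hw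
  refine ⟨(u⁻¹ : (WittVector p F)ˣ), ?_⟩
  have h1 : (constLift p (ζ : F) - 1 : A) = algebraMap _ A w := by
    rw [map_sub, map_one]
    rfl
  rw [h1, ← hu, ← map_mul, Units.inv_mul, map_one]

-- Minus the lift of -1 and 1 are both square roots of 1 congruent to 1. The sign occurs in
-- determinants of antidiagonal matrices.
omit [Finite F] [CharP F p] [TopologicalSpace A] [IsTopologicalRing A] [CompactSpace A]
  [T2Space A] in
lemma constLift_neg_one (h2 : IsUnit (2 : A))
    (hres : ∀ x : WittVector p F, res (algebraMap (WittVector p F) A x) = x.coeff 0) :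
    constLift p (-1 : F) = (-1 : A) := by
  have h1 : -constLift p (-1 : F) = (1 : A) := by
    refine eq_of_sq_eq_sq h2 ?_ ?_ ?_
    · rw [neg_sq, ← map_pow, neg_one_sq, map_one, one_pow]
    · rw [← res_eq_zero_iff hres, map_sub, map_neg, res_constLift hres, map_one, neg_neg, sub_self]
    · rw [sub_self]
      exact zero_mem _
  rw [← h1, neg_neg]

section Subgroup

variable {P : Subgroup (GL (Fin 2) A)}

omit [Finite F] [IsLocalRing A] [TopologicalSpace A] [IsTopologicalRing A] [CompactSpace A]
  [T2Space A] in
/-- The entries of the elements of a group containing the monomial matrices are in the algebra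
generated by the traces. -/
lemma apply_mem_of_trace_mem {C : Subalgebra (WittVector p F) A}
    (hres : ∀ x : WittVector p F, res (algebraMap (WittVector p F) A x) = x.coeff 0)
    (hD : monomialSubgroup (constLift p (F := F) (A := A)) ≤ P) {ζ : Fˣ} (hζ : ζ ≠ 1)
    (hC : ∀ g ∈ P, g.val.trace ∈ C) {g : GL (Fin 2) A} (hg : g ∈ P) (i j : Fin 2) :
    g.val i j ∈ C := by
  obtain ⟨v, hv⟩ := exists_inv_algebraMap hres hζ
  have key : ∀ d ∈ monomialSubgroup (constLift p (F := F) (A := A)),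
      ∀ d' ∈ monomialSubgroup (constLift p (F := F) (A := A)),
      algebraMap _ A v * ((d.val * g.val).trace - (d'.val * g.val).trace) ∈ C :=
    fun d hd d' hd' => mul_mem (C.algebraMap_mem v)
      (sub_mem (hC _ (mul_mem (hD hd) hg)) (hC _ (mul_mem (hD hd') hg)))
  fin_cases i <;> fin_cases j
  · convert key _ (diagGL_mem_monomialSubgroup _ ζ 1) _ (diagGL_mem_monomialSubgroup _ 1 1) using 1
    simp [diagGL, Matrix.trace_fin_two, Matrix.vecMul, dotProduct]
    linear_combination (-(g.val 0 0)) * hv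
  · convert key _ (antidiagGL_mem_monomialSubgroup _ 1 ζ) _
      (antidiagGL_mem_monomialSubgroup _ 1 1) using 1
    simp [antidiagGL, Matrix.trace_fin_two, Matrix.vecMul, dotProduct]
    linear_combination (-(g.val 0 1)) * hv
  · convert key _ (antidiagGL_mem_monomialSubgroup _ ζ 1) _
      (antidiagGL_mem_monomialSubgroup _ 1 1) using 1
    simp [antidiagGL, Matrix.trace_fin_two, Matrix.vecMul, dotProduct]
    linear_combination (-(g.val 1 0)) * hv
  · convert key _ (diagGL_mem_monomialSubgroup _ 1 ζ) _ (diagGL_mem_monomialSubgroup _ 1 1) using 1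
    simp [diagGL, Matrix.trace_fin_two, Matrix.vecMul, dotProduct]
    linear_combination (-(g.val 1 1)) * hv

-- If dγ lies in SR¹ then so does d, and a constant monomial matrix in SR¹ is 1. So P ∩ SR¹ consists
-- of Pink elements, which bounds the Lie algebra from above.
omit [Finite F] [CharP F p] [CompactSpace A] in
lemma lieAlg_subtype_eq (h2 : IsUnit (2 : A))
    (hres : ∀ x : WittVector p F, res (algebraMap (WittVector p F) A x) = x.coeff 0)
    (hI : IsClosed (I : Set A)) (hB : IsClosed (B : Set A))
    (hP : ∀ g ∈ P, ∃ d ∈ monomialSubgroup (constLift p (F := F) (A := A)),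
      IsPinkElement I B (d⁻¹ * g))
    (hL : traceZero (I : Set A) B ⊆ pinkLie (P ⊓ SR1 A)) :
    (lieAlg P.subtype : Set (Matrix (Fin 2) (Fin 2) A)) = traceZero (I : Set A) B := by
  rw [lieAlg, Subgroup.range_subtype]
  refine Set.Subset.antisymm ?_ hL
  refine pinkLie_le (X := (traceZeroSubmodule I B).toAddSubgroup) (isClosed_traceZero hI hB) ?_
  intro g hg
  obtain ⟨d, hd, hdg⟩ := hP g hg.1
  have h1 : d = 1 := by
    refine eq_one_of_mem_monomialSubgroup_of_mem_SR1 hres hd ?_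
    have := (SR1 A).mul_mem hg.2 ((SR1 A).inv_mem hdg.mem_SR1)
    rwa [mul_inv_rev, inv_inv, mul_inv_cancel_left] at this
  rw [h1, inv_one, one_mul] at hdg
  have ht := trace_pinkTheta h2 g.val
  refine ⟨ht, hdg.apply_zero_zero, ?_, hdg.apply_zero_one, hdg.apply_one_zero⟩
  rw [apply_one_one_of_trace_eq_zero ht]
  exact neg_mem hdg.apply_zero_zero

-- The closed algebra of traces contains the entries of P, because they are combinations of traces
-- of products with monomial matrices. It then contains the entries of the Lie algebra, hence I, B
-- and the whole sum.
omit [Finite F] in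
lemma dense_adjoin_range_trace (hp : p ≠ 2)
    (hres : ∀ x : WittVector p F, res (algebraMap (WittVector p F) A x) = x.coeff 0)
    (hD : monomialSubgroup (constLift p (F := F) (A := A)) ≤ P) {ζ : Fˣ} (hζ : ζ ≠ 1)
    (hL : traceZero (I : Set A) B ⊆ pinkLie (P ⊓ SR1 A))
    (hcond : StructureConditions (WittVector p F) I.toAddSubgroup B.toAddSubgroup) :
    Dense (Algebra.adjoin (WittVector p F) (Set.range fun g : P => g.val.val.trace) : Set A) := by
  have hpm := natCast_prime_mem_maximalIdeal hres
  have h2 : IsUnit (2 : A) := isUnit_two_of_odd hp hres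
  have hodd : Odd p := (Fact.out : p.Prime).odd_of_ne_two hp
  have hp0 : 0 < p := (Fact.out : p.Prime).pos
  let C := (Algebra.adjoin (WittVector p F)
    (Set.range fun g : P => g.val.val.trace)).topologicalClosure
  have hCc : IsClosed (C : Set A) := Subalgebra.isClosed_topologicalClosure _
  have hCt : ∀ g ∈ P, g.val.trace ∈ C := fun g hg =>
    Subalgebra.le_topologicalClosure _ (Algebra.subset_adjoin ⟨⟨g, hg⟩, rfl⟩)
  have hCe : ∀ g ∈ P, ∀ i j, g.val i j ∈ C := fun g hg i j =>
    apply_mem_of_trace_mem hres hD hζ hCt hg i j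
  let X : AddSubgroup (Matrix (Fin 2) (Fin 2) A) :=
    { carrier := {x | ∀ i j, x i j ∈ C}
      add_mem' := fun {x y} hx hy i j => add_mem (hx i j) (hy i j)
      zero_mem' := fun i j => zero_mem C
      neg_mem' := fun {x} hx i j => neg_mem (hx i j) }
  have hX : IsClosed (X : Set (Matrix (Fin 2) (Fin 2) A)) := by
    have : (X : Set (Matrix (Fin 2) (Fin 2) A)) = ⋂ i, ⋂ j, (fun x => x i j) ⁻¹' (C : Set A) := by
      ext x
      simp only [Set.mem_iInter]
      rfl
    rw [this]
    exact isClosed_iInter fun i => isClosed_iInter fun j => hCc.preimage (by fun_prop)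
  have hLX : pinkLie (P ⊓ SR1 A) ≤ X := by
    refine pinkLie_le hX fun g hg i j => ?_
    have h1 : Ring.inverse 2 * g.val.trace ∈ C :=
      half_smul_mem (X := C.toSubmodule.toAddSubgroup) hp0 hodd hpm (Ring.mul_inverse_cancel _ h2)
        hCc (hCt g hg.1)
    have h3 : (1 : Matrix (Fin 2) (Fin 2) A) i j ∈ C := by
      rw [Matrix.one_apply]
      split_ifs
      exacts [one_mem C, zero_mem C]
    exact sub_mem (hCe g hg.1 i j) (mul_mem h1 h3)
  have hIC : ∀ a ∈ I, a ∈ C := by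
    intro a ha
    have : !![a, 0; 0, -a] ∈ traceZero (I : Set A) B :=
      ⟨by simp, by simpa using ha, by simpa using ha, by simp, by simp⟩
    exact hLX (hL this) 0 0
  have hBC : ∀ b ∈ B, b ∈ C := by
    intro b hb
    have : !![0, b; 0, 0] ∈ traceZero (I : Set A) B :=
      ⟨by simp [Matrix.trace_fin_two], by simp, by simp, by simpa using hb, by simp⟩
    exact hLX (hL this) 0 1
  have htop : (⊤ : Submodule (WittVector p F) A) ≤ C.toSubmodule := by
    rw [← hcond.sum_eq]
    refine sup_le (sup_le (sup_le ?_ ?_) ?_) ?_ <;> rw [Submodule.span_le]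
    · exact Set.singleton_subset_iff.mpr (one_mem C)
    · exact hIC
    · exact closedMul_le (Z := C.toSubmodule.toAddSubgroup) hCc fun x hx y hy =>
        mul_mem (S := Subalgebra (WittVector p F) A) (hIC x hx) (hIC y hy)
    · exact hBC
  intro a
  exact htop (Submodule.mem_top (x := a))

variable [Nontrivial Fˣ]

omit [Finite F] in
lemma isConstDetPseudoDeformation_subtype (hp : p ≠ 2)
    (hres : ∀ x : WittVector p F, res (algebraMap (WittVector p F) A x) = x.coeff 0)
    (hD : monomialSubgroup (constLift p (F := F) (A := A)) ≤ P)
    (hP : ∀ g ∈ P, ∃ d ∈ monomialSubgroup (constLift p (F := F) (A := A)),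
      IsPinkElement I B (d⁻¹ * g))
    (hL : traceZero (I : Set A) B ⊆ pinkLie (P ⊓ SR1 A))
    (hcond : StructureConditions (WittVector p F) I.toAddSubgroup B.toAddSubgroup) :
    IsConstDetPseudoDeformation p res ((Matrix.GeneralLinearGroup.map res).comp P.subtype)
      (fun g => g.val.val.trace) (detHom P.subtype) := by
  obtain ⟨ζ, hζ⟩ := exists_ne (1 : Fˣ)
  have hpm := natCast_prime_mem_maximalIdeal hres
  have hv : Continuous fun g : P => g.val.val := Units.continuous_val.comp continuous_subtype_val
  have hrange : monomialSubgroup (constLift p (F := F) (A := A)) ≤ P.subtype.range := by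
    rwa [Subgroup.range_subtype]
  refine ⟨?_, Or.inl ?_, isPseudoRep_trace P.subtype, ?_, ?_, ?_, ?_, ?_,
    dense_adjoin_range_trace hp hres hD hζ hL hcond⟩
  · have : ((((Matrix.GeneralLinearGroup.map res).comp P.subtype).ker : Subgroup P) : Set P) =
        ⋂ i, ⋂ j, (fun g : P => g.val.val i j - (1 : Matrix (Fin 2) (Fin 2) A) i j) ⁻¹'
          (maximalIdeal A : Set A) := by
      ext g
      simp only [Set.mem_iInter, Set.mem_preimage, SetLike.mem_coe, MonoidHom.mem_ker]
      simp only [← res_eq_zero_iff hres, map_sub, sub_eq_zero]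
      have h1 : ∀ i j, res ((1 : Matrix (Fin 2) (Fin 2) A) i j) = (1 : Matrix (Fin 2) (Fin 2) F) i j :=
        fun i j => by fin_cases i <;> fin_cases j <;> simp
      simp only [h1]
      exact ⟨fun h i j => congrArg (fun u : GL (Fin 2) F => u.val i j) h,
        fun h => Units.ext (Matrix.ext h)⟩
    rw [this]
    refine isOpen_iInter_of_finite fun i => isOpen_iInter_of_finite fun j => ?_
    exact isOpen_maximalIdeal_of_compact.preimage ((hv.matrix_elem i j).sub continuous_const)
  -- Absolute irreducibility: the monomial matrices over F still span the matrix algebra over the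
  -- algebraic closure.
  · have hr := monomialSubgroup_le_range_map (monomialSubgroup_le_range_map hrange res)
      (algebraMap F (AlgebraicClosure F))
    rw [coe_comp_constLift hres] at hr
    refine isIrreducible_of_span_eq_top (span_eq_top_of_monomial hr (ζ := ζ) ?_)
    rw [isUnit_iff_ne_zero, sub_ne_zero]
    intro h
    refine hζ (Units.ext ?_)
    exact (algebraMap F (AlgebraicClosure F)).injective (h.trans (map_one _).symm)
  · exact hv.matrix_trace
  · exact hv.matrix_det
  · intro g
    rw [Matrix.trace_fin_two, Matrix.trace_fin_two, map_add]
    rfl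
  · intro g
    exact RingHom.map_det res (g.val.val : Matrix (Fin 2) (Fin 2) A)
  · intro g
    obtain ⟨d, hd, hdg⟩ := hP g.1 g.2
    have h1 : g.1.val.det = d.val.det := by
      have := det_eq_one_of_mem_SR1 hdg.mem_SR1
      rw [show g.1.val = d.val * (d⁻¹ * g.1).val by rw [← Units.val_mul, mul_inv_cancel_left],
        Matrix.det_mul, this, mul_one]
    change ∃ x : F, g.1.val.det = constLift p x
    rw [h1]
    obtain ⟨x, y, rfl⟩ | ⟨x, y, rfl⟩ := hd
    · exact ⟨x * y, by simp [diagGL, Matrix.det_fin_two]⟩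
    · refine ⟨-1 * (x * y), ?_⟩
      rw [map_mul, constLift_neg_one (isUnit_two_of_odd hp hres) hres]
      simp [antidiagGL, Matrix.det_fin_two]

omit [Finite F] [IsLocalRing A] [TopologicalSpace A] [IsTopologicalRing A] [CompactSpace A]
  [T2Space A] in
lemma isTDRepresentation_subtype
    (hres : ∀ x : WittVector p F, res (algebraMap (WittVector p F) A x) = x.coeff 0)
    (hD : monomialSubgroup (constLift p (F := F) (A := A)) ≤ P) :
    IsTDRepresentation (fun g : P => g.val.val.trace) (detHom P.subtype) P.subtype := by
  obtain ⟨ζ, hζ⟩ := exists_ne (1 : Fˣ)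
  refine ⟨fun g => rfl, fun g => rfl, ?_⟩
  refine span_eq_top_of_monomial (ρ := P.subtype) (by rwa [Subgroup.range_subtype]) (ζ := ζ) ?_
  obtain ⟨v, hv⟩ := exists_inv_algebraMap hres hζ
  exact IsUnit.of_mul_eq_one_right _ hv

-- Modulo 𝔪 the factor in SR¹ becomes trivial, so only the monomial group remains.
omit [Finite F] [CharP F p] [TopologicalSpace A] [IsTopologicalRing A] [CompactSpace A]
  [T2Space A] [Nontrivial Fˣ] in
lemma projectiveImage_subtype
    (hres : ∀ x : WittVector p F, res (algebraMap (WittVector p F) A x) = x.coeff 0)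
    (hD : monomialSubgroup (constLift p (F := F) (A := A)) ≤ P)
    (hP : ∀ g ∈ P, ∃ d ∈ monomialSubgroup (constLift p (F := F) (A := A)),
      IsPinkElement I B (d⁻¹ * g)) :
    projectiveImage ((Matrix.GeneralLinearGroup.map res).comp P.subtype) =
      (monomialSubgroup (MonoidHom.id F)).map Matrix.ProjGenLinGroup.mk := by
  rw [projectiveImage, ← MonoidHom.map_range]
  congr 1
  refine le_antisymm ?_ ?_
  · rintro _ ⟨g, rfl⟩
    obtain ⟨d, hd, hdg⟩ := hP g.1 g.2
    have h1 : Matrix.GeneralLinearGroup.map res g.1 = Matrix.GeneralLinearGroup.map res d := by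
      have := map_eq_one_of_mem_SR1 hres hdg.mem_SR1
      rw [map_mul, map_inv, inv_mul_eq_one] at this
      exact this.symm
    rw [MonoidHom.comp_apply, Subgroup.subtype_apply, h1]
    obtain ⟨x, y, rfl⟩ | ⟨x, y, rfl⟩ := hd
    · rw [map_diagGL, coe_comp_constLift hres]
      exact diagGL_mem_monomialSubgroup _ x y
    · rw [map_antidiagGL, coe_comp_constLift hres]
      exact antidiagGL_mem_monomialSubgroup _ x y
  · have := monomialSubgroup_le_range_map (ρ := P.subtype) (by rwa [Subgroup.range_subtype]) res
    rwa [coe_comp_constLift hres] at this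

end Subgroup

end Optimality

/-- Optimality: every pair satisfying the structure conditions comes from a representation. -/
theorem exists_pseudoDeformation.{uA} {p : ℕ} [Fact p.Prime] (hp : p ≠ 2)
    {F : Type*} [Field F] [Finite F] [CharP F p] {A : Type uA} [CommRing A] [IsLocalRing A] [TopologicalSpace A] [IsTopologicalRing A]
    [CompactSpace A] [T2Space A] [Algebra (WittVector p F) A] {res : A →+* F}
    (hres : ∀ x : WittVector p F, res (algebraMap (WittVector p F) A x) = x.coeff 0)
    (hF : 3 < Nat.card F) {I B : Submodule (WittVector p F) A}
    (hI : IsClosed (I : Set A)) (hB : IsClosed (B : Set A))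
    (hIm : (I : Set A) ⊆ IsLocalRing.maximalIdeal A) (hBm : (B : Set A) ⊆ IsLocalRing.maximalIdeal A)
    (hcond : StructureConditions (WittVector p F) I.toAddSubgroup B.toAddSubgroup) :
    ∃ (P : ProfiniteGrp.{uA}) (ρbar : P →* GL (Fin 2) F) (t : P → A) (d : P →* A)
        (ρ : P →* GL (Fin 2) A),
        IsConstDetPseudoDeformation p res ρbar t d ∧
        (IsNoetherianRing A → IsAdmissible p res ρbar t d) ∧
        (∃ m : ℕ, 2 * m > 4 ∧ Nonempty (projectiveImage ρbar ≃* DihedralGroup m)) ∧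
        IsTDRepresentation t d ρ ∧
        (lieAlg ρ : Set (Matrix (Fin 2) (Fin 2) A)) = traceZero I B ∧
        (Submodule.span (WittVector p F) (lieAlg ρ : Set (Matrix (Fin 2) (Fin 2) A)) :
          Set (Matrix (Fin 2) (Fin 2) A)) = lieAlg ρ := by
  have hpm := natCast_prime_mem_maximalIdeal hres
  -- |F| > 3 is needed exactly here: the dihedral group has order 2(|F| - 1), which must exceed 4.
  have hcard : 2 < Nat.card Fˣ := by
    rw [Nat.card_units]
    omega
  have : Nontrivial Fˣ := (Finite.one_lt_card_iff_nontrivial).mp (by omega)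
  obtain ⟨P, hPc, hD, hP, hL, hfg⟩ := exists_subgroup_traceZero_subset hp hres hI hB hIm hBm hcond
  have : CompactSpace (Matrix (Fin 2) (Fin 2) A) :=
    inferInstanceAs (CompactSpace (Fin 2 → Fin 2 → A))
  have : CompactSpace P := isCompact_iff_compactSpace.mp hPc.isCompact
  have := totallyDisconnectedSpace_GL (A := A) (Fact.out : p.Prime).pos hpm
  have hps := isConstDetPseudoDeformation_subtype hp hres hD hP hL hcond
  have hLie := lieAlg_subtype_eq (isUnit_two_of_odd hp hres) hres hI hB hP hL
  obtain ⟨e⟩ := exists_mulEquiv_dihedralGroup F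
  refine ⟨ProfiniteGrp.of P, (Matrix.GeneralLinearGroup.map res).comp P.subtype,
    fun g : P => g.val.val.trace, detHom P.subtype, P.subtype, hps,
    fun hA => ⟨hps, (hfg hA).pFiniteness p⟩, ⟨Nat.card Fˣ, by omega, ?_⟩,
    isTDRepresentation_subtype hres hD, hLie, ?_⟩
  · exact ⟨(MulEquiv.subgroupCongr (projectiveImage_subtype hres hD hP)).trans e⟩
  · change (Submodule.span (WittVector p F) (lieAlg P.subtype : Set (Matrix (Fin 2) (Fin 2) A)) :
      Set (Matrix (Fin 2) (Fin 2) A)) = lieAlg P.subtype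
    rw [hLie]
    exact congrArg SetLike.coe (Submodule.span_eq (traceZeroSubmodule I B))

end PinkLie

end

theorem mainTheorem9 (p : ℕ) [Fact p.Prime] (hp : p ≠ 2)
    {F : Type w} [Field F] [Finite F] [CharP F p]
    {A : Type u} [CommRing A] [IsLocalRing A] [TopologicalSpace A] [IsTopologicalRing A]
    [CompactSpace A] [T2Space A] [Algebra (WittVector p F) A]
    (res : A →+* F) (hres : ∀ x : WittVector p F, res (algebraMap (WittVector p F) A x) = x.coeff 0) :
    -- the structure of the Lie algebra
    (∀ {P : Type v} [Group P] [TopologicalSpace P] [IsTopologicalGroup P] [CompactSpace P]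
        [TotallyDisconnectedSpace P] (ρbar : P →* GL (Fin 2) F) (t : P → A) (d : P →* A)
        (_ : IsConstDetPseudoDeformation p res ρbar t d)
        (m : ℕ) (_ : 2 * m > 4) (_ : Nonempty (projectiveImage ρbar ≃* DihedralGroup m))
        (ρ : P →* GL (Fin 2) A) (_ : IsTDRepresentation t d ρ) (_ : IsWellAdapted p res ρ),
      2 < Nat.gcd m (Nat.card F - 1) ∧
      ∀ Fq : Subfield F, 2 < Nat.gcd m (Nat.card Fq - 1) →
        ∃ I B : Submodule (wittSubring p F A Fq) A,
          IsClosed (I : Set A) ∧ IsClosed (B : Set A) ∧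
          (I : Set A) ⊆ IsLocalRing.maximalIdeal A ∧ (B : Set A) ⊆ IsLocalRing.maximalIdeal A ∧
          (Submodule.span (wittSubring p F A Fq) (lieAlg ρ : Set (Matrix (Fin 2) (Fin 2) A)) :
            Set (Matrix (Fin 2) (Fin 2) A)) = traceZero I B ∧
          StructureConditions (WittVector p F) I.toAddSubgroup B.toAddSubgroup) ∧
    -- optimality of this description
    (3 < Nat.card F → ∀ I B : Submodule (WittVector p F) A,
      IsClosed (I : Set A) → IsClosed (B : Set A) →
      (I : Set A) ⊆ IsLocalRing.maximalIdeal A → (B : Set A) ⊆ IsLocalRing.maximalIdeal A →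
      StructureConditions (WittVector p F) I.toAddSubgroup B.toAddSubgroup →
      ∃ (P : ProfiniteGrp.{u}) (ρbar : P →* GL (Fin 2) F) (t : P → A) (d : P →* A)
        (ρ : P →* GL (Fin 2) A),
        IsConstDetPseudoDeformation p res ρbar t d ∧
        (IsNoetherianRing A → IsAdmissible p res ρbar t d) ∧
        (∃ m : ℕ, 2 * m > 4 ∧ Nonempty (projectiveImage ρbar ≃* DihedralGroup m)) ∧
        IsTDRepresentation t d ρ ∧
        (lieAlg ρ : Set (Matrix (Fin 2) (Fin 2) A)) = traceZero I B ∧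
        (Submodule.span (WittVector p F) (lieAlg ρ : Set (Matrix (Fin 2) (Fin 2) A)) :
          Set (Matrix (Fin 2) (Fin 2) A)) = lieAlg ρ) := by
  exact ⟨fun ρbar t d hps m hm he ρ hρ hw => exists_lieAlg_eq_traceZero hp hres hps hm he hρ hw,
    fun hF I B hI hB hIm hBm hcond => exists_pseudoDeformation hp hres hF hI hB hIm hBm hcond⟩
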